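/- **Setting.** Let $H$ be a real Hilbert space and let $A$ be a positive self-adjoint operator in $H$ with dense domain $D(A)$ and compact inverse. Let $B:H\to H$ be bounded and linear, with adjoint $B^*$ and $b=\|B\|$, and let $\tau>0$. Let $k\in L^1_{loc}([0,\infty))$ be real-valued with $\int_{\max(0,t-\tau)}^t|k(s)|\,ds<C^*$ for all $t>0$, for some constant $C^*$. Let $\mu:[0,\infty)\to[0,\infty)$ be continuous, $C^1$ on $(0,\infty)$ and integrable, with $\mu(0)>0$, $\tilde\mu:=\int_0^\infty\mu(s)\,ds<1$ and $\mu'\le-\delta\mu$ on $(0,\infty)$ for some $\delta>0$. Let $\psi:D(A^{1/2})\to\mathbb R$ be Gâteaux differentiable at every point, with derivative $D\psi$, and assume: * (H1) for every $u\in D(A^{1/2})$ there is $c(u)>0$ with $|D\psi(u)(v)|\le c(u)\|v\|_H$ for all $v\in D(A^{1/2})$; then $\nabla\psi(u)\in H$ denotes the vector with $\langle\nabla\psi(u),v\rangle_H=D\psi(u)(v)$ for all $v\in D(A^{1/2})$; * (H2) for every $r>0$ there is a constant $\ell(r)>0$ with $\|\nabla\psi(u)-\nabla\psi(v)\|_H\le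 \ell(r)\|A^{1/2}(u-v)\|_H$ whenever $\|A^{1/2}u\|_H\le r$ and $\|A^{1/2}v\|_H\le r$; moreover these constants satisfy $\ell(r)\to0$ as $r\to0^+$; * (H3) $\psi(0)=0$, $\nabla\psi(0)=0$, and there is a continuous strictly increasing function $h$ on $[0,\infty)$ with $\|\nabla\psi(u)\|_H\le h(\|A^{1/2}u\|_H)\|A^{1/2}u\|_H$ for all $u\in D(A^{1/2})$. Let $L^2_\mu=L^2_\mu((0,\infty);D(A^{1/2}))$ be the space of $D(A^{1/2})$-valued functions $w$ with $\int_0^\infty\mu(s)\|A^{1/2}w(s)\|_H^2\,ds<\infty$, and let $\mathcal H=D(A^{1/2})\times H\times L^2_\mu$ with the norm $$\|(u,v,w)\|_{\mathcal H}^2=(1-\tilde\mu)\|A^{1/2}u\|_H^2+\|v\|_H^2+\int_0^\infty\mu(s)\|A^{1/2}w(s)\|_H^2\,ds .$$ Let $\mathcal A(u,v,w)=\bigl(v,\,-A\bigl((1-\tilde\mu)u+\int_0^\infty\mu(s)w(s)\,ds\bigr),\,-w_s+v\bigr)$ on the domain of all $(u,v,w)\in D(A^{1/2})\times D(A^{1/2})\times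 L^2_\mu$ with $(1-\tilde\mu)u+\int_0^\infty\mu(s)w(s)\,ds\in D(A)$, $w_s\in L^2_\mu$ and $w(0)=0$. Let $\mathcal B(u,v,w)=(0,BB^*v,0)$, $F(u,v,w)=(0,\nabla\psi(u),0)$, and $$L(r):=\frac{1}{\sqrt{1-\tilde\mu}}\;\ell\!\left(\frac{r}{\sqrt{1-\tilde\mu}}\right).$$ Given $U_0\in\mathcal H$ and $\tilde g\in C([0,\tau];\mathcal H)$, consider the problem $$U'(t)=\mathcal AU(t)-k(t)\mathcal BU(t-\tau)+F(U(t)),\qquad \mathcal BU(t-\tau)=\tilde g(t)\ \text{ for } t\in[0,\tau],\qquad U(0)=U_0. \tag{P}$$ **Theorem.** The operator $\mathcal A$ generates a strongly continuous semigroup $\{S(t)\}_{t\ge0}$ on $\mathcal H$, and there are $M,\omega>0$ such that $$\|S(t)\|\le Me^{-\omega t}\qquad\text{for all } t\ge0. \tag{1}$$ One has $F(0)=0$, and for every $r>0$, $L(r)>0$ and $\|F(U)-F(V)\|_{\mathcal H}\le L(r)\|U-V\|_{\mathcal H}$ whenever $\|U\|_{\mathcal H},\|V\|_{\mathcal H}\le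 r$. By a solution of (P) we mean a mild solution: a function $U\in C([0,\infty);\mathcal H)$ such that, for all $t\ge0$, $$U(t)=S(t)U_0+\int_0^tS(t-s)\bigl[-k(s)\,\mathcal BU(s-\tau)+F(U(s))\bigr]ds,$$ where $\mathcal BU(s-\tau)$ stands for $\tilde g(s)$ if $s\le\tau$. Let $M,\omega>0$ be any constants for which (1) holds, and let $\omega'\in[0,\omega)$ and $\gamma\in\mathbb R$ be such that $$b^2Me^{\omega\tau}\int_0^t|k(s+\tau)|\,ds\le\gamma+\omega't\qquad\text{for all }t\ge0 .$$ Then there are $\rho>0$ and $C_\rho>0$ with $L(C_\rho)<\frac{\omega-\omega'}{M}$ such that for all $U_0\in\mathcal H$ and $\tilde g\in C([0,\tau];\mathcal H)$ with $$\|U_0\|_{\mathcal H}^2+\int_0^\tau|k(s)|\,\|\tilde g(s)\|_{\mathcal H}^2\,ds<\rho^2 ,$$ problem (P) has a unique solution $U\in C([0,\infty);\mathcal H)$, and this solution satisfies $\|U(t)\|_{\mathcal H}\le C_\rho$ for all $t>0$ and $$\|U(t)\|_{\mathcal H}\le Me^{\gamma}\Bigl(\|U_0\|_{\mathcal H}+\int_0^\tau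 e^{\omega s}|k(s)|\,\|\tilde g(s)\|_{\mathcal H}\,ds\Bigr)e^{-(\omega-\omega'-ML(C_\rho))t}\qquad\text{for all }t\ge0 .$$ -/

import Mathlib

open Set Filter Topology MeasureTheory

noncomputable section

namespace DelayWave

universe u

/-- A positive self-adjoint operator with compact inverse, as an unbounded operator `A` in `H`.
(Self-adjointness of a `LinearPMap` contains density of its domain.) The last field says that
the inverse of `A` is an everywhere defined compact operator. -/
structure PosOp (H : Type*) [NormedAddCommGroup H] [InnerProductSpace ℝ H]
    [CompleteSpace H] where
  op : H →ₗ.[ℝ] H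
  selfAdjoint : IsSelfAdjoint op
  nonneg : ∀ x : op.domain, 0 ≤ inner ℝ (op x) (x : H)
  compact_inv : ∃ T : H →L[ℝ] H, IsCompactOperator T ∧ ∀ x y : H, (x, y) ∈ op.graph ↔ T y = x

section SquareRoot

variable {H : Type*} [NormedAddCommGroup H] [InnerProductSpace ℝ H] [CompleteSpace H]

/-- `R` is a positive self-adjoint square root of the operator `A`: `R` is self-adjoint,
nonnegative, and `R ∘ R = A` as unbounded operators (equality of graphs, hence of domains). -/
structure IsPosSqrt (R A : H →ₗ.[ℝ] H) : Prop where
  selfAdjoint : IsSelfAdjoint R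
  nonneg : ∀ x : R.domain, 0 ≤ inner ℝ (R x) (x : H)
  sq : ∀ x y : H, (x, y) ∈ A.graph ↔ ∃ z : H, (x, z) ∈ R.graph ∧ (z, y) ∈ R.graph

/-- The diagonal operator with entries `a` in a Hilbert basis, on its maximal domain. -/
def diagOp {ι : Type*} (e : HilbertBasis ι ℝ H) (a : ι → ℝ) : H →ₗ.[ℝ] H :=
  Submodule.toLinearPMap
    { carrier := {p : H × H | ∀ i, e.repr p.2 i = a i * e.repr p.1 i}
      zero_mem' := by intro i; simp
      add_mem' := by
        intro x y hx hy i
        simp [hx i, hy i, mul_add]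
      smul_mem' := by
        intro c x hx i
        simp [hx i]; ring }

theorem mem_graph_diagOp {ι : Type*} (e : HilbertBasis ι ℝ H) (a : ι → ℝ) (x y : H) :
    (x, y) ∈ (diagOp e a).graph ↔ ∀ i, e.repr y i = a i * e.repr x i := by
  unfold diagOp
  rw [Submodule.toLinearPMap_graph_eq]
  · rfl
  · rintro ⟨u, v⟩ h (hu : u = 0)
    apply e.repr.injective
    ext i
    have : e.repr v i = a i * e.repr u i := h i
    simp [this, hu]

theorem basis_mem_graph {ι : Type*} (e : HilbertBasis ι ℝ H) (a : ι → ℝ) (i : ι) :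
    (e i, a i • e i) ∈ (diagOp e a).graph := by
  classical
  rw [mem_graph_diagOp]
  intro j
  by_cases h : j = i
  · subst h; simp [HilbertBasis.repr_self]
  · simp [HilbertBasis.repr_self, h]

theorem diagOp_selfAdjoint {ι : Type*} (e : HilbertBasis ι ℝ H) (a : ι → ℝ) :
    IsSelfAdjoint (diagOp e a) := by
  have hdense : Dense ((diagOp e a).domain : Set H) := by
    have h1 : Submodule.span ℝ (range e) ≤ (diagOp e a).domain := by
      rw [Submodule.span_le]
      rintro _ ⟨i, rfl⟩
      exact LinearPMap.mem_domain_of_mem_graph (basis_mem_graph e a i)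
    have h2 : Dense ((Submodule.span ℝ (range e) : Submodule ℝ H) : Set H) := by
      exact Submodule.dense_iff_topologicalClosure_eq_top.2 e.dense_span
    exact h2.mono h1
  rw [LinearPMap.isSelfAdjoint_def]
  apply le_antisymm
  · apply LinearPMap.le_of_le_graph
    rintro ⟨y, z⟩ hyz
    rw [mem_graph_diagOp]
    intro i
    obtain ⟨u, hu1, hu2⟩ := (LinearPMap.mem_graph_iff _).1 hyz
    obtain ⟨v, hv1, hv2⟩ := (LinearPMap.mem_graph_iff _).1 (basis_mem_graph e a i)
    have := LinearPMap.adjoint_isFormalAdjoint hdense u v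
    simp only at hu1 hu2 hv1 hv2
    rw [hu2, hv1, hv2, hu1, inner_smul_right] at this
    rw [HilbertBasis.repr_apply_apply, HilbertBasis.repr_apply_apply, real_inner_comm, this,
      real_inner_comm]
  · apply LinearPMap.IsFormalAdjoint.le_adjoint hdense
    intro x y
    have hx := (mem_graph_diagOp e a _ _).1 (LinearPMap.mem_graph _ x)
    have hy := (mem_graph_diagOp e a _ _).1 (LinearPMap.mem_graph _ y)
    rw [← e.repr.inner_map_map, ← e.repr.inner_map_map, lp.inner_eq_tsum, lp.inner_eq_tsum]
    congr 1; ext i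
    rw [hx, hy]; simp; ring

open Module End in
theorem exists_eigenbasis {H : Type u} [NormedAddCommGroup H] [InnerProductSpace ℝ H]
    [CompleteSpace H] (T : H →L[ℝ] H) (hT : IsCompactOperator T)
    (hs : (T : H →ₗ[ℝ] H).IsSymmetric) :
    ∃ (ι : Type u) (e : HilbertBasis ι ℝ H) (t : ι → ℝ), ∀ i, T (e i) = t i • e i := by
  have hcl : ∀ c : ℝ, IsClosed ((eigenspace (T : End ℝ H) c : Submodule ℝ H) : Set H) := by
    intro c
    have : ((eigenspace (T : End ℝ H) c : Submodule ℝ H) : Set H) = {x | T x = c • x} := by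
      ext x; simp
    rw [this]
    exact isClosed_eq T.continuous (continuous_const_smul c)
  have : ∀ c : ℝ, CompleteSpace (eigenspace (T : End ℝ H) c) := fun c =>
    (hcl c).completeSpace_coe
  choose w b hb using fun c : ℝ => exists_hilbertBasis ℝ (eigenspace (T : End ℝ H) c)
  have ho := hs.orthogonalFamily_eigenspaces.orthonormal_sigma_orthonormal
    (fun c => (b c).orthonormal)
  refine ⟨Σ c : ℝ, w c, HilbertBasis.mkOfOrthogonalEqBot ho ?_, fun i => i.1, ?_⟩
  · rw [Submodule.eq_bot_iff]
    intro x hx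
    have : x ∈ (⨆ c, eigenspace (T : End ℝ H) c)ᗮ := by
      rw [← Submodule.iInf_orthogonal, Submodule.mem_iInf]
      intro c
      set E := eigenspace (T : End ℝ H) c
      have hP : E.orthogonalProjectionOnto x = 0 := by
        apply (b c).repr.injective
        ext i
        rw [HilbertBasis.repr_apply_apply, map_zero]
        refine (Submodule.inner_orthogonalProjectionOnto_eq_of_mem_left _ _).trans ?_
        exact hx _ (Submodule.subset_span ⟨⟨c, i⟩, rfl⟩)
      exact (Submodule.orthogonalProjectionOnto_eq_zero_iff).1 hP
    rw [T.orthogonalComplement_iSup_eigenspaces_eq_bot hT hs] at this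
    simpa using this
  · rintro ⟨c, i⟩
    rw [HilbertBasis.coe_mkOfOrthogonalEqBot]
    exact mem_eigenspace_iff.1 (b c i).2

theorem exists_isPosSqrt (A : PosOp H) : ∃ R : H →ₗ.[ℝ] H, IsPosSqrt R A.op := by
  obtain ⟨T, hT, hA⟩ := A.compact_inv
  have hdom : ∀ y, (T y, y) ∈ A.op.graph := fun y => (hA _ _).2 rfl
  have hadj : ∀ x y, inner ℝ (T x) y = inner ℝ x (T y) := by
    intro x y
    obtain ⟨u, hu1, hu2⟩ := (LinearPMap.mem_graph_iff _).1 (hdom x)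
    obtain ⟨v, hv1, hv2⟩ := (LinearPMap.mem_graph_iff _).1 (hdom y)
    have := LinearPMap.adjoint_isFormalAdjoint A.selfAdjoint.dense_domain
    rw [LinearPMap.isSelfAdjoint_def.1 A.selfAdjoint] at this
    have h := this u v
    simp only at hu1 hu2 hv1 hv2
    rw [hu1, hu2, hv1, hv2] at h
    exact h.symm
  obtain ⟨ι, e, t, ht⟩ := exists_eigenbasis T hT hadj
  have hinj : ∀ y, T y = 0 → y = 0 := by
    intro y hy
    have h := hdom y
    rw [hy] at h
    exact LinearPMap.graph_fst_eq_zero_snd _ h rfl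
  have htpos : ∀ i, 0 < t i := by
    intro i
    have h1 : t i ≠ 0 := by
      intro h0
      have := hinj (e i) (by rw [ht, h0, zero_smul])
      have h2 := e.orthonormal.1 i
      rw [this] at h2; simp at h2
    obtain ⟨u, hu1, hu2⟩ := (LinearPMap.mem_graph_iff _).1 (hdom (e i))
    have h := A.nonneg u
    simp only at hu1 hu2
    rw [hu1, hu2, ht, inner_smul_right, real_inner_self_eq_norm_sq, e.orthonormal.1 i] at h
    exact lt_of_le_of_ne (by simpa using h) h1.symm
  have hrepr : ∀ y i, e.repr (T y) i = t i * e.repr y i := by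
    intro y i
    rw [HilbertBasis.repr_apply_apply, HilbertBasis.repr_apply_apply, ← hadj, ht,
      inner_smul_left]; simp
  have hsq : ∀ i, t i * ((Real.sqrt (t i))⁻¹ * (Real.sqrt (t i))⁻¹) = 1 := by
    intro i
    rw [← mul_inv, Real.mul_self_sqrt (htpos i).le, mul_inv_cancel₀ (htpos i).ne']
  refine ⟨diagOp e fun i => (Real.sqrt (t i))⁻¹, diagOp_selfAdjoint _ _, ?_, ?_⟩
  · intro x
    have hx := (mem_graph_diagOp e _ _ _).1 (LinearPMap.mem_graph _ x)
    rw [← e.repr.inner_map_map, lp.inner_eq_tsum]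
    refine tsum_nonneg fun i => ?_
    rw [hx]
    have := Real.sqrt_nonneg (t i)
    simp only [RCLike.inner_apply, conj_trivial]
    have h3 : 0 ≤ (Real.sqrt (t i))⁻¹ * (e.repr (x : H) i) ^ 2 := by positivity
    nlinarith
  · intro x y
    rw [hA]
    simp only [mem_graph_diagOp]
    constructor
    · rintro rfl
      have hmem : Memℓp (fun i => (Real.sqrt (t i))⁻¹ * e.repr (T y) i) 2 := by
        have hsum := (lp.memℓp (e.repr y)).summable (by norm_num)
        refine memℓp_gen ?_
        refine Summable.of_nonneg_of_le (fun i => by positivity) (fun i => ?_)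
          (hsum.mul_left ‖T‖)
        have htT : t i ≤ ‖T‖ := by
          have := T.le_opNorm (e i)
          rw [ht, norm_smul, e.orthonormal.1 i, Real.norm_of_nonneg (htpos i).le] at this
          simpa using this
        have hs0 : (Real.sqrt (t i))⁻¹ * t i = Real.sqrt (t i) := by
          rw [inv_mul_eq_div, Real.div_sqrt]
        rw [hrepr, ← mul_assoc, hs0]
        simp only [ENNReal.toReal_ofNat, Real.rpow_ofNat, norm_mul, mul_pow, Real.norm_eq_abs,
          sq_abs, Real.sq_sqrt (htpos i).le]
        exact mul_le_mul_of_nonneg_right htT (sq_nonneg _)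
      refine ⟨e.repr.symm ⟨_, hmem⟩, fun i => by simp, fun i => ?_⟩
      simp only [LinearIsometryEquiv.apply_symm_apply]
      rw [hrepr]
      linear_combination (-(e.repr y i)) * hsq i
    · rintro ⟨z, hz1, hz2⟩
      apply e.repr.injective
      ext i
      rw [hrepr, hz2, hz1]
      linear_combination (e.repr x i) * hsq i

/-- `A^{1/2}`, the positive self-adjoint square root of `A`, with its domain `D(A^{1/2})`. -/
def PosOp.sqrt (A : PosOp H) : H →ₗ.[ℝ] H := (exists_isPosSqrt A).choose

theorem PosOp.sqrt_spec (A : PosOp H) : IsPosSqrt A.sqrt A.op := (exists_isPosSqrt A).choose_spec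

theorem PosOp.sqrt_injective (A : PosOp H) (x : A.sqrt.domain) (hx : A.sqrt x = 0) : x = 0 := by
  obtain ⟨T, -, hA⟩ := A.compact_inv
  have h1 : ((x : H), (0 : H)) ∈ A.sqrt.graph := by
    have := A.sqrt.mem_graph x
    rwa [hx] at this
  have h2 : ((x : H), (0 : H)) ∈ A.op.graph :=
    (A.sqrt_spec.sq _ _).2 ⟨0, h1, A.sqrt.graph.zero_mem⟩
  have h3 := (hA _ _).1 h2
  rw [map_zero] at h3
  exact Subtype.ext h3.symm

theorem PosOp.sqrt_surjective (A : PosOp H) (y : H) : ∃ x : A.sqrt.domain, A.sqrt x = y := by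
  obtain ⟨T, -, hA⟩ := A.compact_inv
  obtain ⟨z, -, hz⟩ := (A.sqrt_spec.sq _ _).1 ((hA (T y) y).2 rfl)
  obtain ⟨u, -, hu⟩ := (LinearPMap.mem_graph_iff _).1 hz
  exact ⟨u, hu⟩

/-- The domain `D(A^{1/2})`, to be normed by `√c ‖A^{1/2} u‖`, where `c > 0`. -/
def HalfDomain (A : PosOp H) (_c : Ioi (0 : ℝ)) : Type _ := A.sqrt.domain

namespace HalfDomain

variable {A : PosOp H} {c : Ioi (0 : ℝ)}

instance : AddCommGroup (HalfDomain A c) := inferInstanceAs (AddCommGroup A.sqrt.domain)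

instance : Module ℝ (HalfDomain A c) := inferInstanceAs (Module ℝ A.sqrt.domain)

/-- The inclusion `D(A^{1/2}) ⊆ H`. -/
def incl : HalfDomain A c →ₗ[ℝ] H := A.sqrt.domain.subtype

/-- The map `A^{1/2} : D(A^{1/2}) → H`. -/
def half : HalfDomain A c →ₗ[ℝ] H := A.sqrt.toFun

/-- The identity of `D(A^{1/2})`, between two scalings of the norm. -/
def rescale (c' : Ioi (0 : ℝ)) : HalfDomain A c →ₗ[ℝ] HalfDomain A c' :=
  (LinearMap.id : A.sqrt.domain →ₗ[ℝ] A.sqrt.domain)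

/-- The inner product `c ⟨A^{1/2} u, A^{1/2} v⟩` on `D(A^{1/2})`. -/
@[reducible] def core (A : PosOp H) (c : Ioi (0 : ℝ)) : InnerProductSpace.Core ℝ (HalfDomain A c) where
  inner u v := (c : ℝ) * inner ℝ (half u) (half v)
  conj_inner_symm u v := by simp [real_inner_comm]
  re_inner_nonneg u := mul_nonneg (le_of_lt c.2) real_inner_self_nonneg
  add_left u v w := by rw [map_add, inner_add_left, mul_add]
  smul_left u v r := by rw [map_smul, inner_smul_left]; simp; ring
  definite u hu := by
    have h := (mul_eq_zero.1 hu).resolve_left (ne_of_gt c.2)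
    exact A.sqrt_injective u (inner_self_eq_zero.1 h)

instance : NormedAddCommGroup (HalfDomain A c) :=
  (core A c).toNormedAddCommGroup

instance : InnerProductSpace ℝ (HalfDomain A c) :=
  InnerProductSpace.ofCore (core A c).toCore

theorem inner_def (u v : HalfDomain A c) :
    inner ℝ u v = (c : ℝ) * inner ℝ (half u) (half v) := rfl

theorem norm_eq (u : HalfDomain A c) : ‖u‖ = Real.sqrt c * ‖half u‖ := by
  rw [norm_eq_sqrt_real_inner, inner_def, Real.sqrt_mul (le_of_lt c.2),
    ← norm_eq_sqrt_real_inner]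

instance : CompleteSpace (HalfDomain A c) := by
  have hc : 0 < Real.sqrt c := Real.sqrt_pos.2 c.2
  let f : HalfDomain A c ≃ₗᵢ[ℝ] H :=
    { toLinearEquiv := LinearEquiv.ofBijective (Real.sqrt c • half) (by
        constructor
        · rw [← LinearMap.ker_eq_bot, LinearMap.ker_eq_bot']
          intro u hu
          exact A.sqrt_injective u ((smul_eq_zero.1 hu).resolve_left hc.ne')
        · intro y
          obtain ⟨x, hx⟩ := A.sqrt_surjective ((Real.sqrt c)⁻¹ • y)
          refine ⟨x, ?_⟩
          change Real.sqrt c • A.sqrt x = y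
          rw [hx, smul_inv_smul₀ hc.ne'])
      norm_map' := fun u => by
        change ‖Real.sqrt c • half u‖ = ‖u‖
        rw [norm_smul, norm_eq, Real.norm_of_nonneg hc.le] }
  exact f.toIsometryEquiv.completeSpace_iff.2 inferInstance

end HalfDomain

/-- `D(A^{1/2})` with the norm `‖A^{1/2} u‖`. -/
abbrev Energy (A : PosOp H) : Type _ := HalfDomain A ⟨1, Set.mem_Ioi.2 one_pos⟩

end SquareRoot

/-- A memory kernel `μ : [0, ∞) → [0, ∞)` (values at negative arguments are irrelevant). -/
structure MemoryKernel where
  μ : ℝ → ℝ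
  nonneg : ∀ s, 0 ≤ s → 0 ≤ μ s
  cont : ContinuousOn μ (Ici 0)
  contDiff : ContDiffOn ℝ 1 μ (Ioi 0)
  integrable : IntegrableOn μ (Ioi 0)
  pos_zero : 0 < μ 0
  mass_lt_one : (∫ s in Ioi (0 : ℝ), μ s) < 1
  decay : ∃ δ : ℝ, 0 < δ ∧ ∀ s, 0 < s → deriv μ s ≤ -δ * μ s

namespace MemoryKernel

/-- `μ̃ = ∫₀^∞ μ(s) ds`. -/
def mass (K : MemoryKernel) : ℝ := ∫ s in Ioi (0 : ℝ), K.μ s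

/-- `1 - μ̃`, a positive number. -/
def gap (K : MemoryKernel) : Ioi (0 : ℝ) := ⟨1 - K.mass, sub_pos.2 K.mass_lt_one⟩

/-- The measure `μ(s) ds` on `(0, ∞)`. -/
def weight (K : MemoryKernel) : Measure ℝ :=
  (volume.restrict (Ioi 0)).withDensity fun s => ENNReal.ofReal (K.μ s)

end MemoryKernel

section Model

variable {H : Type*} [NormedAddCommGroup H] [InnerProductSpace ℝ H] [CompleteSpace H]

/-- `L²_μ((0, ∞); D(A^{1/2}))`. -/
abbrev MemorySpace (A : PosOp H) (K : MemoryKernel) : Type _ := Lp (Energy A) 2 K.weight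

/-- The Hilbert space `D(A^{1/2}) × H × L²_μ((0, ∞); D(A^{1/2}))` with the inner product
`(1 - μ̃) ⟨A^{1/2} u, A^{1/2} u'⟩ + ⟨v, v'⟩ + ∫₀^∞ μ(s) ⟨A^{1/2} w(s), A^{1/2} w'(s)⟩ ds`. -/
abbrev Phase (A : PosOp H) (K : MemoryKernel) : Type _ :=
  WithLp 2 (HalfDomain A K.gap × WithLp 2 (H × MemorySpace A K))

namespace Phase

variable {A : PosOp H} {K : MemoryKernel}

/-- The vector `(u, v, w)`. -/
def mk (u : Energy A) (v : H) (w : MemorySpace A K) : Phase A K :=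
  WithLp.toLp 2 (HalfDomain.rescale K.gap u, WithLp.toLp 2 (v, w))

/-- The component `u` of `(u, v, w)`. -/
def pos (U : Phase A K) : Energy A := HalfDomain.rescale _ U.fst

/-- The component `v` of `(u, v, w)`. -/
def vel (U : Phase A K) : H := U.snd.fst

/-- The component `w` of `(u, v, w)`. -/
def mem (U : Phase A K) : MemorySpace A K := U.snd.snd

theorem inner_eq (U V : Phase A K) : inner ℝ U V =
    (1 - K.mass) * inner ℝ (HalfDomain.half U.pos) (HalfDomain.half V.pos)
      + (inner ℝ U.vel V.vel + inner ℝ U.mem V.mem) := rfl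

end Phase

variable {A : PosOp H} {K : MemoryKernel}

/-- `w` is locally absolutely continuous on `{μ > 0}` with values in `D(A^{1/2})`, has
derivative `w_s = w'` there, and `w(0) = 0`. (`{μ > 0}` is an interval starting at `0`, on whose
compact subintervals `μ` is bounded below, so that `w'` is integrable near `0`.) -/
def HasDerivVanishing (w w' : MemorySpace A K) : Prop :=
  ∀ᵐ s ∂K.weight, w s = ∫ r in (0 : ℝ)..s, w' r

/-- The graph of the operator `𝒜 (u, v, w) = (v, -A ((1 - μ̃) u + ∫₀^∞ μ(s) w(s) ds), -w_s + v)`,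
on the domain of all `(u, v, w)` with `v ∈ D(A^{1/2})`, `(1 - μ̃) u + ∫₀^∞ μ(s) w(s) ds ∈ D(A)`,
`w_s ∈ L²_μ((0, ∞); D(A^{1/2}))` and `w(0) = 0`: the relation says that `U` is in the domain
and `𝒜 U = Z`. -/
def WaveGraph (U Z : Phase A K) : Prop :=
  ∃ (v : Energy A) (w' : MemorySpace A K),
    HalfDomain.incl v = U.vel ∧ HasDerivVanishing U.mem w' ∧
    Z.pos = v ∧
    (HalfDomain.incl ((1 - K.mass) • U.pos + ∫ s in Ioi (0 : ℝ), K.μ s • U.mem s), -Z.vel)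
      ∈ A.op.graph ∧
    ∀ᵐ s ∂K.weight, Z.mem s = -w' s + v

/-- The delay feedback operator `(u, v, w) ↦ (0, B B* v, 0)`. -/
def feedback (B : H →L[ℝ] H) (U : Phase A K) : Phase A K :=
  Phase.mk 0 (B (ContinuousLinearMap.adjoint B U.vel)) 0

open Classical in
/-- The gradient `∇ψ(u) ∈ H`: the vector that represents the Gâteaux derivative of `ψ` at `u`
in the inner product of `H`. It is unique, since `D(A^{1/2})` is dense in `H`
(and set to `0` if there is none). -/
def grad (ψ : Energy A → ℝ) (u : Energy A) : H :=
  if h : ∃ g : H, ∀ v : Energy A,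
      HasDerivAt (fun t : ℝ => ψ (u + t • v)) (inner ℝ g (HalfDomain.incl v)) 0
  then h.choose else 0

/-- The nonlinear term `F(u, v, w) = (0, ∇ψ(u), 0)`. -/
def source (ψ : Energy A → ℝ) (U : Phase A K) : Phase A K :=
  Phase.mk 0 (grad ψ U.pos) 0

/-- The assumptions on the potential `ψ : D(A^{1/2}) → ℝ`; `L r` is the Lipschitz constant of
`∇ψ` on the ball `‖A^{1/2} u‖ ≤ r`. -/
structure IsPotential (ψ : Energy A → ℝ) (L : ℝ → ℝ) : Prop where
  gateaux : ∀ u : Energy A, ∃ D : Energy A →L[ℝ] ℝ,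
    (∀ v, HasDerivAt (fun t : ℝ => ψ (u + t • v)) (D v) 0) ∧
    ∃ c : ℝ, 0 < c ∧ ∀ v, |D v| ≤ c * ‖HalfDomain.incl v‖
  lipschitz : ∀ r : ℝ, 0 < r → 0 < L r ∧ ∀ u v : Energy A,
    ‖HalfDomain.half u‖ ≤ r → ‖HalfDomain.half v‖ ≤ r →
      ‖grad ψ u - grad ψ v‖ ≤ L r * ‖HalfDomain.half (u - v)‖
  zero : ψ 0 = 0
  grad_zero : grad ψ 0 = 0
  growth : ∃ h : ℝ → ℝ, StrictMonoOn h (Ici 0) ∧ ContinuousOn h (Ici 0) ∧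
    ∀ u : Energy A, ‖grad ψ u‖ ≤ h ‖HalfDomain.half u‖ * ‖HalfDomain.half u‖

/-- The Lipschitz constant of `F` on the ball of radius `r` of the phase space that corresponds
to the Lipschitz constants `L` of `∇ψ`. -/
def phaseLip (K : MemoryKernel) (L : ℝ → ℝ) (r : ℝ) : ℝ :=
  L (r / Real.sqrt (1 - K.mass)) / Real.sqrt (1 - K.mass)

end Model

section Semigroup

variable {X : Type*} [NormedAddCommGroup X] [NormedSpace ℝ X]

/-- `(S t)_{t ≥ 0}` is a strongly continuous semigroup of bounded operators
(negative times are irrelevant). -/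
structure IsC0Semigroup (S : ℝ → X →L[ℝ] X) : Prop where
  zero : S 0 = ContinuousLinearMap.id ℝ X
  add : ∀ s t, 0 ≤ s → 0 ≤ t → S (s + t) = (S s).comp (S t)
  tendsto : ∀ x, Tendsto (fun t => S t x) (𝓝[>] 0) (𝓝 x)

/-- The infinitesimal generator of `S` is the operator with graph `G`. -/
def IsGenerator (S : ℝ → X →L[ℝ] X) (G : X → X → Prop) : Prop :=
  ∀ x y, G x y ↔ Tendsto (fun t : ℝ => t⁻¹ • (S t x - x)) (𝓝[>] 0) (𝓝 y)

end Semigroup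

section Problem

variable {H : Type*} [NormedAddCommGroup H] [InnerProductSpace ℝ H] [CompleteSpace H]
variable {A : PosOp H} {K : MemoryKernel}

/-- `ℬ U(t - τ)` for `t ≥ 0`, where the prescribed history `g` is used for `t ∈ [0, τ]`. -/
def delayed (B : H →L[ℝ] H) (τ : ℝ) (g U : ℝ → Phase A K) (t : ℝ) : Phase A K :=
  if t ≤ τ then g t else feedback B (U (t - τ))

/-- `U ∈ C([0, ∞); ℋ)` is a (mild) solution of
`U' = 𝒜 U - k(t) ℬ U(t - τ) + F(U)`, `U(0) = U₀`, `ℬ U(t - τ) = g(t)` on `[0, τ]`, where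
`S` is the semigroup generated by `𝒜`: Duhamel's formula holds. -/
structure IsSolution (S : ℝ → Phase A K →L[ℝ] Phase A K) (B : H →L[ℝ] H) (τ : ℝ) (k : ℝ → ℝ)
    (ψ : Energy A → ℝ) (U₀ : Phase A K) (g U : ℝ → Phase A K) : Prop where
  cont : ContinuousOn U (Ici 0)
  duhamel : ∀ t, 0 ≤ t → U t = S t U₀ +
    ∫ s in (0 : ℝ)..t, S (t - s) (-(k s • delayed B τ g U s) + source ψ (U s))

/-- The data `U₀ ∈ ℋ` and `g ∈ C([0, τ]; ℋ)` are smaller than `ρ`. -/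
def SmallData (τ : ℝ) (k : ℝ → ℝ) (ρ : ℝ) (U₀ : Phase A K) (g : ℝ → Phase A K) : Prop :=
  ContinuousOn g (Icc 0 τ) ∧ ‖U₀‖ ^ 2 + (∫ s in (0 : ℝ)..τ, |k s| * ‖g s‖ ^ 2) < ρ ^ 2

/-- Small data have a unique global solution, and it is bounded by `C`. -/
def GloballyWellPosed (S : ℝ → Phase A K →L[ℝ] Phase A K) (B : H →L[ℝ] H) (τ : ℝ) (k : ℝ → ℝ)
    (ψ : Energy A → ℝ) (ρ C : ℝ) : Prop :=
  ∀ (U₀ : Phase A K) (g : ℝ → Phase A K), SmallData τ k ρ U₀ g →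
    ∃ U : ℝ → Phase A K, IsSolution S B τ k ψ U₀ g U ∧ (∀ t, 0 < t → ‖U t‖ ≤ C) ∧
      ∀ V : ℝ → Phase A K, IsSolution S B τ k ψ U₀ g V → EqOn V U (Ici 0)

end Problem

end DelayWave

end

/-! The linear part generates an exponentially decaying semigroup; the delay and the source are
perturbations whose joint effect is controlled by Gronwall's inequality. Write `m` for `μ̃`.

Linear part. In `⟨𝒜U, U⟩` all coupling terms cancel and `-⟨w', w⟩` is left, where `w'` is the
derivative of the memory component `w`. As `w` is the primitive of `w'` and `μ(s) = ∫ₛ^∞ -μ'`,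
Fubini's theorem turns `2⟨w', w⟩` into `∫ -μ' ‖w‖²`, which is at least `δ‖w‖²`
(`HasPrimitive.inner_eq`, `HasPrimitive.le_inner`). So `𝒜` is dissipative. Its resolvent equation
reduces to `A z + β z = g` (`waveSubmodule_range`), and Yosida approximation yields a contraction
semigroup (`IsMaxDissipative.exists_semigroup`). Only the memory is damped directly. To reach `u`
and `v`, a large multiple of the energy is perturbed by `⟨v, (m/2)u - ∫μw⟩`: the derivative of this
term contains `-(m/2)‖v‖²` and `-(m/2)(1-m)‖A^{1/2}u‖²`, and the remaining terms are absorbed by the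
dissipation and by fractions of these two (`exists_lyapunov`). An equivalent form with strict decay
gives exponential stability (`exists_exp_decay`).

Delay and source. A change of variables bounds `∫ |k(s)| ‖U(s-τ)‖` over `[τ, t]` by `∫ |k(s+τ)|
‖U(s)‖` over `[0, t]` (`integral_delay_le`), so the delay only shifts the kernel of a Volterra
inequality. For a globally Lipschitz source, Picard iteration then converges on the whole half-line
(`exists_volterra_fixedPoint`); this is arranged by composing the source with the radial projection
onto a ball of radius `C`. Gronwall's inequality for `e^{ωt}‖U(t)‖` has exponent at most `γ + ω't +
M l t`, where `l` is the Lipschitz constant on that ball (`norm_le_of_duhamel`). Since `ℓ(r) → 0`,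
some `C` satisfies `M l < ω - ω'`. Small data then keep the solution in the ball, where the
truncation does nothing (`exists_small_solution`). Uniqueness needs only that the source is
Lipschitz on bounded sets (`delay_problem_unique`). -/

noncomputable section

namespace DelayWave

/-! ### Product rule for primitives of integrable functions -/

section ProductRule

variable {E F G : Type*} [NormedAddCommGroup E] [NormedSpace ℝ E] [CompleteSpace E]
  [NormedAddCommGroup F] [NormedSpace ℝ F] [CompleteSpace F]
  [NormedAddCommGroup G] [NormedSpace ℝ G] [CompleteSpace G]

/-- The product rule for indefinite Bochner integrals, in integrated form. -/
theorem bilin_primitive_eq (L : E →L[ℝ] F →L[ℝ] G) {f : ℝ → E} {g : ℝ → F} {t : ℝ} (ht : 0 ≤ t)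
    (hf : IntervalIntegrable f volume 0 t) (hg : IntervalIntegrable g volume 0 t) :
    L (∫ r in (0 : ℝ)..t, f r) (∫ r in (0 : ℝ)..t, g r) =
      ∫ s in (0 : ℝ)..t, (L (∫ r in (0 : ℝ)..s, f r) (g s) + L (f s) (∫ r in (0 : ℝ)..s, g r)) := by
  rw [intervalIntegrable_iff_integrableOn_Ioc_of_le ht] at hf hg
  set μ : Measure ℝ := volume.restrict (Ioc 0 t) with hμ
  change Integrable f μ at hf
  change Integrable g μ at hg
  -- Fubini's theorem on the square `(0, t]²`, cut along the diagonal: the triangle `r ≤ s` gives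
  -- the first summand and its complement the second. No differentiability of the primitives is
  -- used.
  have hprod : Integrable (fun z : ℝ × ℝ => L (f z.1) (g z.2)) (μ.prod μ) :=
    hf.op_fst_snd (by fun_prop) ⟨‖L‖, L.le_opNorm₂⟩ hg
  have hm1 : MeasurableSet {z : ℝ × ℝ | z.1 ≤ z.2} := measurableSet_le measurable_fst measurable_snd
  have hm2 : MeasurableSet {z : ℝ × ℝ | z.2 < z.1} := measurableSet_lt measurable_snd measurable_fst
  have h1 : Integrable ({z : ℝ × ℝ | z.1 ≤ z.2}.indicator fun z => L (f z.1) (g z.2)) (μ.prod μ) :=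
    hprod.indicator hm1
  have h2 : Integrable ({z : ℝ × ℝ | z.2 < z.1}.indicator fun z => L (f z.1) (g z.2)) (μ.prod μ) :=
    hprod.indicator hm2
  have e0 : ∫ z, L (f z.1) (g z.2) ∂(μ.prod μ) = L (∫ r, f r ∂μ) (∫ r, g r ∂μ) := by
    rw [integral_prod _ hprod]
    simp_rw [ContinuousLinearMap.integral_comp_comm _ hg]
    change ∫ x, L.flip (∫ y, g y ∂μ) (f x) ∂μ = _
    rw [ContinuousLinearMap.integral_comp_comm _ hf]
    simp
  have esum : (fun z : ℝ × ℝ => L (f z.1) (g z.2)) =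
      fun z => {z : ℝ × ℝ | z.1 ≤ z.2}.indicator (fun z => L (f z.1) (g z.2)) z +
        {z : ℝ × ℝ | z.2 < z.1}.indicator (fun z => L (f z.1) (g z.2)) z := by
    funext z
    by_cases h : z.1 ≤ z.2
    · simp [indicator, h, not_lt.2 h]
    · simp [indicator, h, not_le.1 h]
  have i1 : ∀ s ∈ Ioc 0 t, ∫ a, {z : ℝ × ℝ | z.1 ≤ z.2}.indicator (fun z => L (f z.1) (g z.2)) (a, s) ∂μ
      = L (∫ r in (0 : ℝ)..s, f r) (g s) := by
    intro s hs
    have : ∀ a, {z : ℝ × ℝ | z.1 ≤ z.2}.indicator (fun z => L (f z.1) (g z.2)) (a, s)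
        = (Iic s).indicator (fun a => L.flip (g s) (f a)) a := by
      intro a; simp [indicator]
    simp_rw [this]
    rw [integral_indicator measurableSet_Iic, hμ, Measure.restrict_restrict measurableSet_Iic]
    have hset : Iic s ∩ Ioc 0 t = Ioc 0 s := by
      ext a; simp only [mem_inter_iff, mem_Iic, mem_Ioc]
      constructor
      · rintro ⟨h1, h2, h3⟩; exact ⟨h2, h1⟩
      · rintro ⟨h1, h2⟩; exact ⟨h2, h1, h2.trans hs.2⟩
    rw [hset, ContinuousLinearMap.integral_comp_comm, intervalIntegral.integral_of_le hs.1.le]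
    · rfl
    · exact IntegrableOn.mono_set (t := Ioc 0 t) hf (Ioc_subset_Ioc_right hs.2)
  have i2 : ∀ s ∈ Ioc 0 t, ∫ b, {z : ℝ × ℝ | z.2 < z.1}.indicator (fun z => L (f z.1) (g z.2)) (s, b) ∂μ
      = L (f s) (∫ r in (0 : ℝ)..s, g r) := by
    intro s hs
    have : ∀ b, {z : ℝ × ℝ | z.2 < z.1}.indicator (fun z => L (f z.1) (g z.2)) (s, b)
        = (Iio s).indicator (fun b => L (f s) (g b)) b := by
      intro a; simp [indicator]
    simp_rw [this]
    rw [integral_indicator measurableSet_Iio, hμ, Measure.restrict_restrict measurableSet_Iio]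
    have hset : Iio s ∩ Ioc 0 t = Ioo 0 s := by
      ext a; simp only [mem_inter_iff, mem_Iio, mem_Ioc, mem_Ioo]
      constructor
      · rintro ⟨h1, h2, h3⟩; exact ⟨h2, h1⟩
      · rintro ⟨h1, h2⟩; exact ⟨h2, h1, h2.le.trans hs.2⟩
    rw [hset, ← integral_Ioc_eq_integral_Ioo, ContinuousLinearMap.integral_comp_comm,
      intervalIntegral.integral_of_le hs.1.le]
    exact IntegrableOn.mono_set (t := Ioc 0 t) hg (Ioc_subset_Ioc_right hs.2)
  have j1 : ∫ z, {z : ℝ × ℝ | z.1 ≤ z.2}.indicator (fun z => L (f z.1) (g z.2)) z ∂(μ.prod μ)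
      = ∫ s, L (∫ r in (0 : ℝ)..s, f r) (g s) ∂μ := by
    rw [integral_prod_symm _ h1]
    exact setIntegral_congr_fun measurableSet_Ioc i1
  have j2 : ∫ z, {z : ℝ × ℝ | z.2 < z.1}.indicator (fun z => L (f z.1) (g z.2)) z ∂(μ.prod μ)
      = ∫ s, L (f s) (∫ r in (0 : ℝ)..s, g r) ∂μ := by
    rw [integral_prod _ h2]
    exact setIntegral_congr_fun measurableSet_Ioc i2
  have k1 : Integrable (fun s => L (∫ r in (0 : ℝ)..s, f r) (g s)) μ :=
    h1.integral_prod_right.congr ((ae_restrict_mem measurableSet_Ioc).mono fun s hs => i1 s hs)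
  have k2 : Integrable (fun s => L (f s) (∫ r in (0 : ℝ)..s, g r)) μ :=
    h2.integral_prod_left.congr ((ae_restrict_mem measurableSet_Ioc).mono fun s hs => i2 s hs)
  rw [intervalIntegral.integral_of_le ht, intervalIntegral.integral_of_le ht,
    intervalIntegral.integral_of_le ht, ← hμ, ← e0, integral_add k1 k2, ← j1, ← j2,
    ← integral_add h1 h2, ← esum]

end ProductRule

/-! ### Volterra inequalities and equations with a locally integrable kernel -/

section Volterra

variable {a : ℝ → ℝ}

theorem intervalIntegrable_of_locallyIntegrableOn {E : Type*} [NormedAddCommGroup E] {a : ℝ → E}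
    (ha : LocallyIntegrableOn a (Ici 0)) {s t : ℝ} (hs : 0 ≤ s) (ht : 0 ≤ t) :
    IntervalIntegrable a volume s t := by
  rw [intervalIntegrable_iff]
  exact (ha.integrableOn_compact_subset (t := Icc (min s t) (max s t))
    (fun x hx => (le_min hs ht).trans hx.1) isCompact_Icc).mono_set
      (by rw [uIoc]; exact Ioc_subset_Icc_self)

theorem continuousOn_Ici_of_Icc {X : Type*} [TopologicalSpace X] {f : ℝ → X}
    (h : ∀ T, 0 < T → ContinuousOn f (Icc 0 T)) : ContinuousOn f (Ici 0) := by
  intro t ht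
  have h1 : ContinuousWithinAt f (Icc 0 (t + 1)) t :=
    h (t + 1) (by linarith [mem_Ici.1 ht]) t ⟨ht, by linarith⟩
  refine h1.mono_of_mem_nhdsWithin ?_
  rw [← Ici_inter_Iic]
  exact inter_mem self_mem_nhdsWithin (mem_nhdsWithin_of_mem_nhds (Iic_mem_nhds (by linarith)))

theorem primitive_continuousOn {E : Type*} [NormedAddCommGroup E] [NormedSpace ℝ E] {a : ℝ → E}
    (ha : LocallyIntegrableOn a (Ici 0)) :
    ContinuousOn (fun t => ∫ s in (0 : ℝ)..t, a s) (Ici 0) := by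
  refine continuousOn_Ici_of_Icc fun T hT => ?_
  refine intervalIntegral.continuousOn_primitive_interval ?_ |>.mono (uIcc_of_le hT.le).ge
  rw [uIcc_of_le hT.le]
  exact ha.integrableOn_compact_subset (fun x hx => hx.1) isCompact_Icc

theorem intervalIntegrable_mul_continuousOn {a b : ℝ → ℝ} (ha : LocallyIntegrableOn a (Ici 0))
    {t : ℝ} (ht : 0 ≤ t) (hb : ContinuousOn b (Icc 0 t)) :
    IntervalIntegrable (fun s => a s * b s) volume 0 t :=
  (intervalIntegrable_of_locallyIntegrableOn ha le_rfl ht).mul_continuousOn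
    (by rwa [uIcc_of_le ht])

/-- The chain rule for a primitive that is only absolutely continuous: induction on `n` with
`bilin_primitive_eq`, since `a` need not be continuous. -/
theorem primitive_pow_succ (ha : LocallyIntegrableOn a (Ici 0)) (n : ℕ) {t : ℝ} (ht : 0 ≤ t) :
    (∫ s in (0 : ℝ)..t, a s) ^ (n + 1) =
      ∫ s in (0 : ℝ)..t, a s * ((n + 1) * (∫ r in (0 : ℝ)..s, a r) ^ n) := by
  induction n generalizing t with
  | zero => simp
  | succ n ih =>
    have hcont : ContinuousOn (fun s => ((n : ℝ) + 1) * (∫ r in (0 : ℝ)..s, a r) ^ n) (Icc 0 t) :=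
      continuousOn_const.mul (((primitive_continuousOn ha).mono Icc_subset_Ici_self).pow n)
    rw [pow_succ, ih ht]
    have := bilin_primitive_eq (ContinuousLinearMap.mul ℝ ℝ) ht
      (intervalIntegrable_mul_continuousOn ha ht hcont)
      (intervalIntegrable_of_locallyIntegrableOn ha le_rfl ht)
    simp only [ContinuousLinearMap.mul_apply'] at this
    rw [this]
    refine intervalIntegral.integral_congr fun s hs => ?_
    rw [uIcc_of_le ht] at hs
    rw [← ih hs.1]
    push_cast
    ring

theorem primitive_nonneg (ha0 : ∀ t, 0 ≤ t → 0 ≤ a t) {t : ℝ} (ht : 0 ≤ t) :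
    0 ≤ ∫ s in (0 : ℝ)..t, a s :=
  intervalIntegral.integral_nonneg ht fun s hs => ha0 s hs.1

theorem primitive_mono (ha : LocallyIntegrableOn a (Ici 0)) (ha0 : ∀ t, 0 ≤ t → 0 ≤ a t)
    {s t : ℝ} (hs : 0 ≤ s) (hst : s ≤ t) :
    ∫ r in (0 : ℝ)..s, a r ≤ ∫ r in (0 : ℝ)..t, a r := by
  rw [← intervalIntegral.integral_add_adjacent_intervals
    (intervalIntegrable_of_locallyIntegrableOn ha le_rfl hs)
    (intervalIntegrable_of_locallyIntegrableOn ha hs (hs.trans hst)), le_add_iff_nonneg_right]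
  exact intervalIntegral.integral_nonneg hst fun r hr => ha0 r (hs.trans hr.1)

/-- By `primitive_pow_succ`, each application of the Volterra operator raises the power of `∫ a` by
one and supplies the next factor of the factorial. Both Gronwall's inequality and the Picard
iteration rest on this. Neither `e n` nor `C` has to be nonnegative. -/
theorem le_primitive_pow_div_factorial (ha : LocallyIntegrableOn a (Ici 0)) (ha0 : ∀ t, 0 ≤ t → 0 ≤ a t)
    {T C : ℝ} (e : ℕ → ℝ → ℝ)
    (h0 : ∀ t ∈ Icc 0 T, e 0 t ≤ C)
    (he : ∀ n, ContinuousOn (e n) (Icc 0 T))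
    (hs : ∀ n, ∀ t ∈ Icc 0 T, e (n + 1) t ≤ ∫ s in (0 : ℝ)..t, a s * e n s) (n : ℕ) :
    ∀ t ∈ Icc 0 T, e n t ≤ C * ((∫ s in (0 : ℝ)..t, a s) ^ n / n.factorial) := by
  induction n with
  | zero => intro t ht; simpa using h0 t ht
  | succ n ih =>
    intro t ht
    refine (hs n t ht).trans ?_
    have hsub : Icc 0 t ⊆ Icc 0 T := Icc_subset_Icc_right ht.2
    have hcont : ContinuousOn (fun s => ((n : ℝ) + 1) * (∫ r in (0 : ℝ)..s, a r) ^ n) (Icc 0 t) :=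
      continuousOn_const.mul (((primitive_continuousOn ha).mono Icc_subset_Ici_self).pow n)
    have h1 : ∫ s in (0 : ℝ)..t, a s * e n s ≤ ∫ s in (0 : ℝ)..t,
        (C / (n + 1).factorial) * (a s * ((n + 1) * (∫ r in (0 : ℝ)..s, a r) ^ n)) := by
      refine intervalIntegral.integral_mono_on ht.1
        (intervalIntegrable_mul_continuousOn ha ht.1 ((he n).mono hsub))
        ((intervalIntegrable_mul_continuousOn ha ht.1 hcont).const_mul _) fun s hs => ?_
      have h2 := mul_le_mul_of_nonneg_left (ih s (hsub hs)) (ha0 s hs.1)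
      refine h2.trans (le_of_eq ?_)
      rw [Nat.factorial_succ]
      have : (n.factorial : ℝ) ≠ 0 := by positivity
      push_cast
      field_simp
    rw [intervalIntegral.integral_const_mul, ← primitive_pow_succ ha n ht.1] at h1
    refine h1.trans (le_of_eq (by ring))

/-- Gronwall's inequality with a locally integrable coefficient. -/
theorem le_mul_exp_primitive (ha : LocallyIntegrableOn a (Ici 0)) (ha0 : ∀ t, 0 ≤ t → 0 ≤ a t)
    {N T : ℝ} {y : ℝ → ℝ} (hy : ContinuousOn y (Icc 0 T))
    (h : ∀ t ∈ Icc 0 T, y t ≤ N + ∫ s in (0 : ℝ)..t, a s * y s) :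
    ∀ t ∈ Icc 0 T, y t ≤ N * Real.exp (∫ s in (0 : ℝ)..t, a s) := by
  obtain ⟨C, hC⟩ := isCompact_Icc.bddAbove_image hy
  have hα : ContinuousOn (fun t => ∫ s in (0 : ℝ)..t, a s) (Icc 0 T) :=
    (primitive_continuousOn ha).mono Icc_subset_Ici_self
  have hsumc : ∀ n : ℕ, ContinuousOn (fun t => ∑ j ∈ Finset.range n,
      (∫ s in (0 : ℝ)..t, a s) ^ j / (j.factorial : ℝ)) (Icc 0 T) := fun n =>
    continuousOn_finsetSum _ fun j _ => (hα.pow j).div_const _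
  -- Subtracting from `y` the multiple `N` of the `n`-th partial sum of the exponential series
  -- leaves a sequence that satisfies the iterated inequality. Its upper bound tends to `0`, and the
  -- partial sums tend to the exponential.
  have key := le_primitive_pow_div_factorial ha ha0 (T := T) (C := C)
    (fun n t => y t - N * ∑ j ∈ Finset.range n, (∫ s in (0 : ℝ)..t, a s) ^ j / (j.factorial : ℝ))
    (fun t ht => by simpa using hC (mem_image_of_mem y ht))
    (fun n => hy.sub (continuousOn_const.mul (hsumc n))) ?_
  · intro t ht
    have l1 : Tendsto (fun n : ℕ => y t - N * ∑ j ∈ Finset.range n,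
        (∫ s in (0 : ℝ)..t, a s) ^ j / (j.factorial : ℝ)) atTop
        (𝓝 (y t - N * Real.exp (∫ s in (0 : ℝ)..t, a s))) := by
      refine tendsto_const_nhds.sub (tendsto_const_nhds.mul ?_)
      rw [Real.exp_eq_exp_ℝ]
      exact (NormedSpace.expSeries_div_hasSum_exp (𝔸 := ℝ) _).tendsto_sum_nat
    have l2 := (FloorSemiring.tendsto_pow_div_factorial_atTop
      (∫ s in (0 : ℝ)..t, a s)).const_mul C
    rw [mul_zero] at l2
    have := le_of_tendsto_of_tendsto' l1 l2 fun n => key n t ht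
    linarith
  · intro n t ht
    have hsub : Icc 0 t ⊆ Icc 0 T := Icc_subset_Icc_right ht.2
    have hpow : ∀ j : ℕ, (∫ s in (0 : ℝ)..t, a s) ^ (j + 1) / ((j + 1).factorial : ℝ) =
        ∫ s in (0 : ℝ)..t, a s * ((∫ r in (0 : ℝ)..s, a r) ^ j / (j.factorial : ℝ)) := by
      intro j
      rw [primitive_pow_succ ha j ht.1, ← intervalIntegral.integral_div]
      refine intervalIntegral.integral_congr fun s _ => ?_
      simp only [Nat.factorial_succ]
      have : (j.factorial : ℝ) ≠ 0 := by positivity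
      push_cast
      field_simp
    have hsum : ∑ j ∈ Finset.range (n + 1), (∫ s in (0 : ℝ)..t, a s) ^ j / (j.factorial : ℝ) =
        1 + ∫ s in (0 : ℝ)..t, a s * ∑ j ∈ Finset.range n,
          (∫ r in (0 : ℝ)..s, a r) ^ j / (j.factorial : ℝ) := by
      rw [Finset.sum_range_succ']
      simp_rw [hpow, Finset.mul_sum]
      rw [intervalIntegral.integral_finsetSum]
      · simp; ring
      · intro j _
        exact intervalIntegrable_mul_continuousOn ha ht.1 (((hα.pow j).div_const _).mono hsub)
    simp only [hsum, mul_sub]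
    rw [intervalIntegral.integral_sub
      (intervalIntegrable_mul_continuousOn ha ht.1 (hy.mono hsub))]
    · simp_rw [mul_left_comm _ N]
      rw [intervalIntegral.integral_const_mul]
      linarith [h t ht]
    · exact intervalIntegrable_mul_continuousOn ha ht.1
        ((continuousOn_const.mul (hsumc n)).mono hsub)

variable {X : Type*} [NormedAddCommGroup X]

/-- Two functions whose distance satisfies a homogeneous Volterra inequality agree. -/
theorem eqOn_of_norm_sub_le_volterra (ha : LocallyIntegrableOn a (Ici 0))
    (ha0 : ∀ t, 0 ≤ t → 0 ≤ a t) {T : ℝ} {U V : ℝ → X} (hU : ContinuousOn U (Icc 0 T))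
    (hV : ContinuousOn V (Icc 0 T))
    (h : ∀ t ∈ Icc 0 T, ‖U t - V t‖ ≤ ∫ s in (0 : ℝ)..t, a s * ‖U s - V s‖) :
    EqOn U V (Icc 0 T) := by
  intro t ht
  have := le_mul_exp_primitive ha ha0 (N := 0) (hU.sub hV).norm (by simpa using h) t ht
  rw [zero_mul] at this
  exact sub_eq_zero.1 (norm_le_zero_iff.1 this)

/-- Volterra operators with a locally integrable kernel have a fixed point. -/
theorem exists_volterra_fixedPoint [CompleteSpace X] (ha : LocallyIntegrableOn a (Ici 0))
    (ha0 : ∀ t, 0 ≤ t → 0 ≤ a t) (Φ : (ℝ → X) → ℝ → X)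
    (hc : ∀ U, ContinuousOn U (Ici 0) → ContinuousOn (Φ U) (Ici 0))
    (hΦ : ∀ U V, ContinuousOn U (Ici 0) → ContinuousOn V (Ici 0) → ∀ t, 0 ≤ t →
      ‖Φ U t - Φ V t‖ ≤ ∫ s in (0 : ℝ)..t, a s * ‖U s - V s‖) :
    ∃ U, ContinuousOn U (Ici 0) ∧ EqOn (Φ U) U (Ici 0) := by
  -- Picard iteration from `0`. On `[0, T]` consecutive iterates differ by at most `C α(T)ⁿ / n!`,
  -- which is summable for every `T`, so the iteration converges on the whole half-line and no
  -- smallness is required.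
  let u : ℕ → ℝ → X := fun n => Φ^[n] 0
  have hu : ∀ n, ContinuousOn (u n) (Ici 0) := by
    intro n
    induction n with
    | zero => exact continuousOn_const
    | succ n ih => simp only [u, Function.iterate_succ_apply']; exact hc _ ih
  have hsucc : ∀ n, u (n + 1) = Φ (u n) := fun n => Function.iterate_succ_apply' _ _ _
  let α : ℝ → ℝ := fun t => ∫ s in (0 : ℝ)..t, a s
  have hbound : ∀ T, 0 < T → ∃ C, ∀ n, ∀ t ∈ Icc 0 T,
      ‖u (n + 1) t - u n t‖ ≤ C * (α T ^ n / n.factorial) := by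
    intro T hT
    have hdc : ∀ n, ContinuousOn (fun t => ‖u (n + 1) t - u n t‖) (Icc 0 T) := fun n =>
      (((hu (n + 1)).sub (hu n)).mono Icc_subset_Ici_self).norm
    obtain ⟨C, hC⟩ := isCompact_Icc.bddAbove_image (hdc 0)
    refine ⟨C, fun n t ht => ?_⟩
    have h0 : ∀ t ∈ Icc 0 T, ‖u (0 + 1) t - u 0 t‖ ≤ C := fun t ht =>
      hC (mem_image_of_mem (fun t => ‖u (0 + 1) t - u 0 t‖) ht)
    refine (le_primitive_pow_div_factorial ha ha0 (fun n t => ‖u (n + 1) t - u n t‖) h0 hdc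
      (fun n t ht => ?_) n t ht).trans ?_
    · simp only [hsucc]
      have := hΦ (u (n + 1)) (u n) (hu _) (hu _) t ht.1
      simpa only [hsucc] using this
    · have hC0 : 0 ≤ C := (norm_nonneg _).trans (h0 t ht)
      gcongr
      · exact primitive_nonneg ha0 ht.1
      · exact primitive_mono ha ha0 ht.1 ht.2
  let U : ℝ → X := fun t => ∑' n, (u (n + 1) t - u n t)
  have hpart : ∀ n t, ∑ j ∈ Finset.range n, (u (j + 1) t - u j t) = u n t := by
    intro n t
    rw [Finset.sum_range_sub (fun n => u n t)]
    simp [u]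
  have hunif : ∀ T, 0 < T → TendstoUniformlyOn u U atTop (Icc 0 T) := by
    intro T hT
    obtain ⟨C, hC⟩ := hbound T hT
    have hs : Summable fun n : ℕ => C * (α T ^ n / n.factorial) :=
      (Real.summable_pow_div_factorial _).mul_left C
    have := tendstoUniformlyOn_tsum_nat hs hC
    simpa only [hpart] using this
  have hUT : ∀ T, 0 < T → ContinuousOn U (Icc 0 T) := fun T hT =>
    (hunif T hT).continuousOn (Frequently.of_forall fun n => (hu n).mono Icc_subset_Ici_self)
  have hU : ContinuousOn U (Ici 0) := continuousOn_Ici_of_Icc hUT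
  refine ⟨U, hU, fun t ht => ?_⟩
  have ht0 : (0 : ℝ) ≤ t := ht
  have hT := hunif (t + 1) (by linarith)
  have l1 : Tendsto (fun n => u (n + 1) t) atTop (𝓝 (U t)) :=
    (hT.tendsto_at (x := t) ⟨ht, by linarith⟩).comp (tendsto_add_atTop_nat 1)
  have l2 : Tendsto (fun n => u (n + 1) t) atTop (𝓝 (Φ U t)) := by
    rw [Metric.tendsto_atTop]
    intro ε hε
    have hα0 : 0 ≤ α t := primitive_nonneg ha0 ht
    obtain ⟨N, hN⟩ := eventually_atTop.1
      (Metric.tendstoUniformlyOn_iff.1 hT (ε / (α t + 1)) (by positivity))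
    refine ⟨N, fun n hn => ?_⟩
    rw [dist_eq_norm, hsucc]
    refine (hΦ _ _ (hu n) hU t ht).trans_lt ?_
    have : ∫ s in (0 : ℝ)..t, a s * ‖u n s - U s‖ ≤ ∫ s in (0 : ℝ)..t, a s * (ε / (α t + 1)) := by
      refine intervalIntegral.integral_mono_on ht
        (intervalIntegrable_mul_continuousOn ha ht
          (((hu n).sub hU).mono Icc_subset_Ici_self).norm)
        ((intervalIntegrable_of_locallyIntegrableOn ha le_rfl ht).mul_const _) fun s hs => ?_
      refine mul_le_mul_of_nonneg_left ?_ (ha0 s hs.1)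
      rw [← dist_eq_norm, dist_comm]
      exact (hN n hn s ⟨hs.1, by linarith [hs.2]⟩).le
    refine this.trans_lt ?_
    rw [intervalIntegral.integral_mul_const]
    change α t * (ε / (α t + 1)) < ε
    rw [mul_div_assoc', div_lt_iff₀ (by positivity)]
    nlinarith
  exact tendsto_nhds_unique l2 l1

end Volterra

/-! ### Strong continuity of bounded semigroups -/

section BoundedSemigroup

variable {X : Type*} [NormedAddCommGroup X] [NormedSpace ℝ X]

/-- The semigroup law and the uniform bound give `‖S s x - S t x‖ ≤ M ‖S |s - t| x - x‖`, so
continuity from the right at `0` yields continuity from both sides everywhere. -/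
theorem IsC0Semigroup.continuousOn {S : ℝ → X →L[ℝ] X} (hS : IsC0Semigroup S) {M : ℝ}
    (hM : ∀ t, 0 ≤ t → ‖S t‖ ≤ M) (x : X) : ContinuousOn (fun t => S t x) (Ici 0) := by
  have hM0 : 0 ≤ M := (norm_nonneg _).trans (hM 0 le_rfl)
  have key : ∀ s t, 0 ≤ s → 0 ≤ t → ‖S s x - S t x‖ ≤ M * ‖S |s - t| x - x‖ := by
    have h1 : ∀ s t, 0 ≤ s → s ≤ t → ‖S s x - S t x‖ ≤ M * ‖S |s - t| x - x‖ := by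
      intro s t hs hst
      have h2 : S t x = S s (S (t - s) x) := by
        have := hS.add s (t - s) hs (sub_nonneg.2 hst)
        rw [add_sub_cancel] at this
        rw [this]; rfl
      rw [abs_sub_comm, abs_of_nonneg (sub_nonneg.2 hst), h2, norm_sub_rev, ← map_sub]
      exact (S s).le_of_opNorm_le (hM s hs) _
    intro s t hs ht
    rcases le_total s t with h | h
    · exact h1 s t hs h
    · rw [norm_sub_rev, abs_sub_comm]; exact h1 t s ht h
  have h0 : Tendsto (fun r => S r x) (𝓝[≥] 0) (𝓝 x) := by
    rw [← Ioi_insert, nhdsWithin_insert, tendsto_sup]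
    refine ⟨?_, hS.tendsto x⟩
    rw [tendsto_pure_left]
    intro s hs
    simpa [hS.zero] using mem_of_mem_nhds hs
  intro t ht
  rw [ContinuousWithinAt, tendsto_iff_norm_sub_tendsto_zero]
  have habs : Tendsto (fun s => |s - t|) (𝓝[Ici 0] t) (𝓝[≥] 0) := by
    refine tendsto_nhdsWithin_iff.2 ⟨?_, Eventually.of_forall fun s => mem_Ici.2 (abs_nonneg _)⟩
    have : Continuous fun s : ℝ => |s - t| := by fun_prop
    simpa using (this.tendsto t).mono_left nhdsWithin_le_nhds
  have h3 := (tendsto_iff_norm_sub_tendsto_zero.1 (h0.comp habs)).const_mul M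
  rw [mul_zero] at h3
  exact squeeze_zero' (Eventually.of_forall fun s => norm_nonneg _)
    (eventually_nhdsWithin_of_forall fun s hs => key s t hs ht) h3

end BoundedSemigroup

/-! ### Generation of contraction semigroups and exponential stability -/

section HilleYosida

variable {X : Type*} [NormedAddCommGroup X] [InnerProductSpace ℝ X]

/-- `G` is the graph of a maximal dissipative operator. -/
structure IsMaxDissipative (G : Submodule ℝ (X × X)) : Prop where
  dissipative : ∀ x y, (x, y) ∈ G → inner ℝ y x ≤ 0
  range : ∀ l : ℝ, 0 < l → ∀ f, ∃ x, (x, l • x - f) ∈ G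
  single : ∀ y, (0, y) ∈ G → y = 0

namespace IsMaxDissipative

variable {G : Submodule ℝ (X × X)}

/-- Pairing the resolvent equation with `x` and using dissipativity gives `l‖x‖² ≤ ⟨f, x⟩`. -/
theorem norm_le (hG : IsMaxDissipative G) {l : ℝ} {x f : X}
    (h : (x, l • x - f) ∈ G) : l * ‖x‖ ≤ ‖f‖ := by
  have h1 := hG.dissipative _ _ h
  rw [inner_sub_left, real_inner_smul_left, real_inner_self_eq_norm_sq] at h1
  have h2 := real_inner_le_norm f x
  rcases eq_or_lt_of_le (norm_nonneg x) with h3 | h3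
  · rw [← h3]; simp
  · nlinarith

theorem exists_resolvent (hG : IsMaxDissipative G) {l : ℝ} (hl : 0 < l) :
    ∃ R : X →L[ℝ] X, (∀ f, l * ‖R f‖ ≤ ‖f‖) ∧ ∀ f x, (x, l • x - f) ∈ G ↔ x = R f := by
  choose r hr using hG.range l hl
  have huniq : ∀ f x, (x, l • x - f) ∈ G → x = r f := by
    intro f x hx
    have h1 : (x - r f, l • (x - r f) - 0) ∈ G := by
      have := G.sub_mem hx (hr f)
      convert this using 1
      ext <;> simp [smul_sub]
    have h2 := hG.norm_le h1
    rw [norm_zero] at h2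
    have h3 : ‖x - r f‖ ≤ 0 := by nlinarith [norm_nonneg (x - r f)]
    exact sub_eq_zero.1 (norm_le_zero_iff.1 h3)
  let R : X →ₗ[ℝ] X :=
    { toFun := r
      map_add' := fun f g => by
        refine (huniq _ _ ?_).symm
        convert G.add_mem (hr f) (hr g) using 1
        ext <;> simp [smul_add]; abel
      map_smul' := fun c f => by
        refine (huniq _ _ ?_).symm
        convert G.smul_mem c (hr f) using 1
        ext <;> simp [smul_sub, smul_comm l c] }
  refine ⟨R.mkContinuous l⁻¹ fun f => ?_, fun f => hG.norm_le (hr f), fun f x => ⟨huniq f x, ?_⟩⟩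
  · have := hG.norm_le (hr f)
    rw [inv_mul_eq_div, le_div_iff₀ hl, mul_comm]
    exact this
  · rintro rfl
    exact hr f

/-- If `z` is orthogonal to the domain, take `(x, x - z)` in the graph. Dissipativity becomes `‖x‖²
≤ 0`, so `x = 0`, and then `(0, -z)` lies in the graph, which forces `z = 0`. -/
theorem dense_domain [CompleteSpace X] (hG : IsMaxDissipative G) :
    Dense {x | ∃ y, (x, y) ∈ G} := by
  have : ({x | ∃ y, (x, y) ∈ G} : Set X) = (G.map (LinearMap.fst ℝ X X) : Submodule ℝ X) := by
    ext x; simp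
  rw [this, Submodule.dense_iff_topologicalClosure_eq_top,
    Submodule.topologicalClosure_eq_top_iff, Submodule.eq_bot_iff]
  intro z hz
  obtain ⟨x, hx⟩ := hG.range 1 one_pos z
  have hzx : inner ℝ z x = 0 := by
    rw [real_inner_comm]
    exact hz x ⟨_, hx, rfl⟩
  have h1 := hG.dissipative _ _ hx
  rw [inner_sub_left, hzx, one_smul, real_inner_self_eq_norm_sq] at h1
  have h2 : x = 0 := by
    rw [← norm_eq_zero, ← sq_eq_zero_iff]
    exact le_antisymm (by linarith) (sq_nonneg _)
  subst h2
  simpa using hG.single _ hx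

/-- The Yosida approximation of the operator with graph `G`, at parameter `n + 1`. -/
theorem exists_yosida [CompleteSpace X] (hG : IsMaxDissipative G) :
    ∃ Y : ℕ → X →L[ℝ] X, (∀ n x, inner ℝ (Y n x) x ≤ 0) ∧ (∀ m n, Commute (Y m) (Y n)) ∧
      (∀ x y, (x, y) ∈ G → ∀ n, ‖Y n x‖ ≤ ‖y‖) ∧
      (∀ x y, (x, y) ∈ G → Tendsto (fun n => Y n x) atTop (𝓝 y)) := by
  have hpos : ∀ n : ℕ, (0 : ℝ) < n + 1 := fun n => by positivity
  choose R hRn hR using fun n : ℕ => hG.exists_resolvent (hpos n)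
  have hmem : ∀ n f, (R n f, ((n : ℝ) + 1) • R n f - f) ∈ G := fun n f => (hR n f _).2 rfl
  have hres : ∀ m n f, R n f - R m f = ((m : ℝ) - n) • R n (R m f) := by
    intro m n f
    rw [← map_smul]
    refine (hR n _ _).1 ?_
    convert G.sub_mem (hmem n f) (hmem m f) using 1
    ext
    · simp
    · simp only [Prod.snd_sub]; module
  have hcomm : ∀ m n, Commute (R m) (R n) := by
    intro m n
    rcases eq_or_ne m n with rfl | hmn
    · exact Commute.refl _
    · ext f
      change R m (R n f) = R n (R m f)
      have h1 := hres m n f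
      have h2 := hres n m f
      have hne : (m : ℝ) - n ≠ 0 := sub_ne_zero.2 (Nat.cast_injective.ne hmn)
      have h3 : ((m : ℝ) - n) • R m (R n f) = ((m : ℝ) - n) • R n (R m f) := by
        rw [← h1, ← neg_sub (R m f), h2, ← neg_smul, neg_sub]
      exact smul_right_injective X hne h3
  -- With `l = n + 1` this is `l(lR - 1)`; on the domain it equals `lR` applied to the image, and
  -- `‖lR‖ ≤ 1`. The shift by one keeps the resolvent parameter positive.
  let Y : ℕ → X →L[ℝ] X := fun n => ((n : ℝ) + 1) • (((n : ℝ) + 1) • R n - 1)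
  have hY : ∀ n f, Y n f = ((n : ℝ) + 1) • (((n : ℝ) + 1) • R n f - f) := fun n f => rfl
  have hYG : ∀ x y, (x, y) ∈ G → ∀ n, Y n x = ((n : ℝ) + 1) • R n y := by
    intro x y hxy n
    rw [hY]
    congr 1
    rw [← map_smul, sub_eq_iff_eq_add, ← sub_eq_iff_eq_add', ← map_sub, eq_comm]
    refine (hR n _ _).1 ?_
    simpa using hxy
  have hle : ∀ (n : ℕ) y, ‖((n : ℝ) + 1) • R n y‖ ≤ ‖y‖ := by
    intro n y
    rw [norm_smul, Real.norm_of_nonneg (hpos n).le]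
    exact hRn n y
  refine ⟨Y, ?_, ?_, ?_, ?_⟩
  · intro n f
    rw [hY, real_inner_smul_left]
    refine mul_nonpos_of_nonneg_of_nonpos (hpos n).le ?_
    rw [inner_sub_left, real_inner_self_eq_norm_sq]
    have h1 := real_inner_le_norm (((n : ℝ) + 1) • R n f) f
    nlinarith [hle n f, norm_nonneg f]
  · intro m n
    have h1 : Commute (((m : ℝ) + 1) • R m - 1) (((n : ℝ) + 1) • R n - 1) := by
      have h2 : Commute (((m : ℝ) + 1) • R m) (((n : ℝ) + 1) • R n) :=
        ((hcomm m n).smul_left _).smul_right _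
      exact (h2.sub_right (Commute.one_right _)).sub_left ((Commute.one_left _))
    exact (h1.smul_left _).smul_right _
  · intro x y hxy n
    rw [hYG x y hxy]
    exact hle n y
  · intro x y hxy
    -- `lR` tends strongly to the identity: on the domain the error is at most `‖w‖ / l`, and
    -- density together with `‖lR‖ ≤ 1` extends this to every vector.
    have hD : ∀ z w, (z, w) ∈ G → Tendsto (fun n : ℕ => ((n : ℝ) + 1) • R n z) atTop (𝓝 z) := by
      intro z w hzw
      rw [tendsto_iff_norm_sub_tendsto_zero]
      have h1 : ∀ n : ℕ, ‖((n : ℝ) + 1) • R n z - z‖ ≤ ‖w‖ * (1 / ((n : ℝ) + 1)) := by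
        intro n
        have h2 : ‖Y n z‖ ≤ ‖w‖ := by rw [hYG z w hzw]; exact hle n w
        rw [hY, norm_smul, Real.norm_of_nonneg (hpos n).le] at h2
        rw [mul_one_div, le_div_iff₀ (hpos n)]
        linarith
      have h2 := (tendsto_one_div_add_atTop_nhds_zero_nat (𝕜 := ℝ)).const_mul ‖w‖
      rw [mul_zero] at h2
      exact squeeze_zero (fun n => norm_nonneg _) h1 h2
    have hall : Tendsto (fun n : ℕ => ((n : ℝ) + 1) • R n y) atTop (𝓝 y) := by
      rw [Metric.tendsto_atTop]
      intro ε hε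
      obtain ⟨z, ⟨w, hzw⟩, hz⟩ := hG.dense_domain.exists_dist_lt y (show 0 < ε / 3 by positivity)
      obtain ⟨N, hN⟩ := Metric.tendsto_atTop.1 (hD z w hzw) (ε / 3) (by positivity)
      refine ⟨N, fun n hn => ?_⟩
      have h1 := hN n hn
      have h2 := hle n (y - z)
      rw [map_sub, smul_sub] at h2
      rw [dist_eq_norm] at *
      calc ‖((n : ℝ) + 1) • R n y - y‖ = ‖(((n : ℝ) + 1) • R n y - ((n : ℝ) + 1) • R n z)
            + (((n : ℝ) + 1) • R n z - z) - (y - z)‖ := by congr 1; abel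
        _ ≤ ‖((n : ℝ) + 1) • R n y - ((n : ℝ) + 1) • R n z‖
            + ‖((n : ℝ) + 1) • R n z - z‖ + ‖y - z‖ :=
          (norm_sub_le _ _).trans (by gcongr; exact norm_add_le _ _)
        _ < ε := by linarith
    exact hall.congr fun n => (hYG x y hxy n).symm

end IsMaxDissipative

section Exponential

variable [CompleteSpace X]

theorem hasDerivAt_exp_smul_apply (A : X →L[ℝ] X) (x : X) (t : ℝ) :
    HasDerivAt (fun s : ℝ => NormedSpace.exp (s • A) x) (NormedSpace.exp (t • A) (A x)) t :=
  (hasDerivAt_exp_smul_const A t).clm_apply (hasDerivAt_const t x) |>.congr_deriv (by simp)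

theorem hasDerivAt_exp_smul_apply' (A : X →L[ℝ] X) (x : X) (t : ℝ) :
    HasDerivAt (fun s : ℝ => NormedSpace.exp (s • A) x) (A (NormedSpace.exp (t • A) x)) t :=
  (hasDerivAt_exp_smul_const' A t).clm_apply (hasDerivAt_const t x) |>.congr_deriv (by simp)

/-- The squared norm along the flow has derivative `2⟨A e^{sA}x, e^{sA}x⟩ ≤ 0`. -/
theorem norm_exp_smul_apply_le {A : X →L[ℝ] X} (hA : ∀ x, inner ℝ (A x) x ≤ 0) (x : X) {t : ℝ}
    (ht : 0 ≤ t) : ‖NormedSpace.exp (t • A) x‖ ≤ ‖x‖ := by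
  have hd : ∀ t : ℝ, HasDerivAt (fun s : ℝ => ‖NormedSpace.exp (s • A) x‖ ^ 2)
      (2 * inner ℝ (NormedSpace.exp (t • A) x) (A (NormedSpace.exp (t • A) x))) t := fun t =>
    (hasDerivAt_exp_smul_apply' A x t).norm_sq
  have hanti : Antitone (fun s : ℝ => ‖NormedSpace.exp (s • A) x‖ ^ 2) := by
    refine antitone_of_deriv_nonpos (fun t => (hd t).differentiableAt) fun t => ?_
    rw [(hd t).deriv, real_inner_comm]
    linarith [hA (NormedSpace.exp (t • A) x)]
  have := hanti ht
  simp only [zero_smul, NormedSpace.exp_zero, one_apply_eq_self] at this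
  exact le_of_sq_le_sq this (norm_nonneg _)

/-- The path `s ↦ e^{sA} e^{(t-s)C} x` joins the two vectors, and since `A` and `C` commute its
velocity is a product of contractions applied to `Ax - Cx`. -/
theorem norm_exp_sub_exp_apply_le {A C : X →L[ℝ] X} (hA : ∀ x, inner ℝ (A x) x ≤ 0)
    (hC : ∀ x, inner ℝ (C x) x ≤ 0) (hAC : Commute A C) (x : X) {t : ℝ} (ht : 0 ≤ t) :
    ‖NormedSpace.exp (t • A) x - NormedSpace.exp (t • C) x‖ ≤ t * ‖A x - C x‖ := by
  have hd : ∀ s : ℝ, HasDerivAt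
      (fun s : ℝ => NormedSpace.exp (s • A) (NormedSpace.exp ((t - s) • C) x))
      (NormedSpace.exp (s • A) (NormedSpace.exp ((t - s) • C) (A x - C x))) s := by
    intro s
    have h1 := hasDerivAt_exp_smul_const A s
    have h2 : HasDerivAt (fun s : ℝ => NormedSpace.exp ((t - s) • C) x)
        (-(NormedSpace.exp ((t - s) • C) (C x))) s := by
      have := (hasDerivAt_exp_smul_apply C x (t - s)).scomp s
        ((hasDerivAt_id s).const_sub t)
      simpa [Function.comp_def] using this
    refine (h1.clm_apply h2).congr_deriv ?_
    have hcomm : Commute A (NormedSpace.exp ((t - s) • C)) :=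
      (hAC.smul_right (t - s)).exp_right
    have h3 : A (NormedSpace.exp ((t - s) • C) x) = NormedSpace.exp ((t - s) • C) (A x) :=
      congrArg (fun B : X →L[ℝ] X => B x) hcomm.eq
    simp [h3, map_sub, ← sub_eq_add_neg]
  have := norm_image_sub_le_of_norm_deriv_le_segment' (a := 0) (b := t)
    (fun s _ => (hd s).hasDerivWithinAt) (C := ‖A x - C x‖) (fun s hs =>
      (norm_exp_smul_apply_le hA _ hs.1).trans
        (norm_exp_smul_apply_le hC _ (sub_nonneg.2 hs.2.le))) t (right_mem_Icc.2 ht)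
  simpa [mul_comm] using this

end Exponential

/-- The Hille–Yosida (Lumer–Phillips) theorem for maximal dissipative operators in a Hilbert
space. -/
theorem IsMaxDissipative.exists_semigroup [CompleteSpace X] {G : Submodule ℝ (X × X)}
    (hG : IsMaxDissipative G) :
    ∃ S : ℝ → X →L[ℝ] X, IsC0Semigroup S ∧ (∀ t, 0 ≤ t → ‖S t‖ ≤ 1) ∧
      (∀ x y, (x, y) ∈ G → ∀ t, 0 ≤ t → S t x = x + ∫ s in (0 : ℝ)..t, S s y) ∧
      IsGenerator S fun x y => (x, y) ∈ G := by
  obtain ⟨Y, hYd, hYc, hYb, hYt⟩ := hG.exists_yosida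
  let T : ℕ → ℝ → X →L[ℝ] X := fun n t => NormedSpace.exp (t • Y n)
  have hT1 : ∀ n t, 0 ≤ t → ∀ x, ‖T n t x‖ ≤ ‖x‖ := fun n t ht x =>
    norm_exp_smul_apply_le (hYd n) x ht
  have hTD : ∀ x y, (x, y) ∈ G → ∀ t, 0 ≤ t → CauchySeq fun n => T n t x := by
    intro x y hxy t ht
    rw [Metric.cauchySeq_iff]
    intro ε hε
    obtain ⟨N, hN⟩ := Metric.cauchySeq_iff.1 (hYt x y hxy).cauchySeq (ε / (t + 1)) (by positivity)
    refine ⟨N, fun m hm n hn => ?_⟩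
    have h1 := norm_exp_sub_exp_apply_le (hYd m) (hYd n) (hYc m n) x ht
    have h2 := hN m hm n hn
    rw [dist_eq_norm] at h2 ⊢
    refine h1.trans_lt ?_
    rw [lt_div_iff₀ (by positivity)] at h2
    nlinarith [norm_nonneg (Y m x - Y n x)]
  have hTC : ∀ x t, 0 ≤ t → CauchySeq fun n => T n t x := by
    intro x t ht
    rw [Metric.cauchySeq_iff]
    intro ε hε
    obtain ⟨z, ⟨w, hzw⟩, hz⟩ := hG.dense_domain.exists_dist_lt x (show 0 < ε / 3 by positivity)
    obtain ⟨N, hN⟩ := Metric.cauchySeq_iff.1 (hTD z w hzw t ht) (ε / 3) (by positivity)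
    refine ⟨N, fun m hm n hn => ?_⟩
    have h1 := hN m hm n hn
    have h2 := hT1 m t ht (x - z)
    have h3 := hT1 n t ht (x - z)
    rw [dist_eq_norm] at *
    calc ‖T m t x - T n t x‖ = ‖T m t (x - z) + (T m t z - T n t z) - T n t (x - z)‖ := by
          congr 1; rw [map_sub, map_sub]; abel
      _ ≤ ‖T m t (x - z)‖ + ‖T m t z - T n t z‖ + ‖T n t (x - z)‖ :=
          (norm_sub_le _ _).trans (by gcongr; exact norm_add_le _ _)
      _ < ε := by linarith
  -- Cutting time off at `0` makes the limit exist for every real `t`; the contraction bounds cover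
  -- only nonnegative times.
  have hlim : ∀ t : ℝ, ∃ f : X → X, Tendsto (fun n x => T n (max t 0) x) atTop (𝓝 f) := by
    intro t
    choose f hf using fun x => cauchySeq_tendsto_of_complete (hTC x (max t 0) (le_max_right _ _))
    exact ⟨f, tendsto_pi_nhds.2 hf⟩
  choose f hf using hlim
  let S : ℝ → X →L[ℝ] X := fun t => continuousLinearMapOfTendsto (fun n => T n (max t 0)) (hf t)
  have hS : ∀ t, 0 ≤ t → ∀ x, Tendsto (fun n => T n t x) atTop (𝓝 (S t x)) := by
    intro t ht x
    have := tendsto_pi_nhds.1 (hf t) x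
    rw [max_eq_left ht] at this
    exact this
  have hSle : ∀ t, 0 ≤ t → ∀ x, ‖S t x‖ ≤ ‖x‖ := fun t ht x =>
    le_of_tendsto' (hS t ht x).norm fun n => hT1 n t ht x
  have hS1 : ∀ t, 0 ≤ t → ‖S t‖ ≤ 1 := fun t ht =>
    ContinuousLinearMap.opNorm_le_bound _ zero_le_one fun x => by simpa using hSle t ht x
  have hSY : ∀ (u : ℕ → X) x, Tendsto u atTop (𝓝 x) → ∀ t, 0 ≤ t →
      Tendsto (fun n => T n t (u n)) atTop (𝓝 (S t x)) := by
    intro u x hu t ht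
    have h1 : Tendsto (fun n => T n t (u n - x)) atTop (𝓝 0) := by
      refine squeeze_zero_norm (fun n => hT1 n t ht _) ?_
      simpa using (tendsto_iff_norm_sub_tendsto_zero.1 hu)
    have := h1.add (hS t ht x)
    simpa using this
  have hSD : ∀ x y, (x, y) ∈ G → ∀ t, 0 ≤ t → ‖S t x - x‖ ≤ t * ‖y‖ := by
    intro x y hxy t ht
    refine le_of_tendsto' ((hS t ht x).sub_const x).norm fun n => ?_
    have := norm_exp_sub_exp_apply_le (hYd n) (C := 0) (by simp) (Commute.zero_right _) x ht
    simp only [smul_zero, NormedSpace.exp_zero, one_apply_eq_self,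
      zero_apply, sub_zero] at this
    exact this.trans (mul_le_mul_of_nonneg_left (hYb x y hxy n) ht)
  have hC0 : IsC0Semigroup S := by
    refine ⟨?_, ?_, ?_⟩
    · ext x
      refine tendsto_nhds_unique (hS 0 le_rfl x) ?_
      simp [T]
    · intro s t hs ht
      ext x
      refine tendsto_nhds_unique (hS (s + t) (add_nonneg hs ht) x) ?_
      refine (hSY _ _ (hS t ht x) s hs).congr fun n => ?_
      have : T n (s + t) = T n s * T n t := by
        simp only [T, add_smul]
        let +nondep : NormedAlgebra ℚ (X →L[ℝ] X) := NormedAlgebra.restrictScalars ℚ ℝ _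
        exact NormedSpace.exp_add_of_commute (((Commute.refl (Y n)).smul_left s).smul_right t)
      rw [this]; rfl
    · intro x
      rw [Metric.tendsto_nhds]
      intro ε hε
      obtain ⟨z, ⟨w, hzw⟩, hz⟩ := hG.dense_domain.exists_dist_lt x (show 0 < ε / 3 by positivity)
      have h0 : 0 < ε / (3 * (‖w‖ + 1)) := by positivity
      filter_upwards [Ioo_mem_nhdsGT h0] with t ht
      have h1 := hSD z w hzw t ht.1.le
      have h2 := hSle t ht.1.le (x - z)
      have h3 : t * ‖w‖ < ε / 3 := by
        have := ht.2
        rw [lt_div_iff₀ (by positivity)] at this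
        nlinarith [norm_nonneg w, ht.1]
      rw [dist_eq_norm] at *
      calc ‖S t x - x‖ = ‖S t (x - z) + (S t z - z) - (x - z)‖ := by
            congr 1; rw [map_sub]; abel
        _ ≤ ‖S t (x - z)‖ + ‖S t z - z‖ + ‖x - z‖ :=
            (norm_sub_le _ _).trans (by gcongr; exact norm_add_le _ _)
        _ < ε := by linarith
  have hScont := fun x => hC0.continuousOn hS1 x
  have hint : ∀ x y, (x, y) ∈ G → ∀ t, 0 ≤ t → S t x = x + ∫ s in (0 : ℝ)..t, S s y := by
    intro x y hxy t ht
    have hTint : ∀ n, T n t x = x + ∫ s in (0 : ℝ)..t, T n s (Y n x) := by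
      intro n
      rw [intervalIntegral.integral_eq_sub_of_hasDerivAt
        (fun s _ => hasDerivAt_exp_smul_apply (Y n) x s)]
      · simp [T]
      · refine Continuous.intervalIntegrable ?_ _ _
        exact continuous_iff_continuousAt.2 fun s =>
          (hasDerivAt_exp_smul_apply (Y n) (Y n x) s).continuousAt
    refine tendsto_nhds_unique (hS t ht x) ?_
    simp_rw [hTint]
    refine tendsto_const_nhds.add ?_
    refine intervalIntegral.tendsto_integral_filter_of_dominated_convergence (fun _ => ‖y‖) ?_ ?_
      intervalIntegrable_const ?_
    · refine Eventually.of_forall fun n => Continuous.aestronglyMeasurable ?_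
      exact continuous_iff_continuousAt.2 fun s =>
        (hasDerivAt_exp_smul_apply (Y n) (Y n x) s).continuousAt
    · refine Eventually.of_forall fun n => Eventually.of_forall fun s hs => ?_
      rw [uIoc_of_le ht] at hs
      exact (hT1 n s hs.1.le _).trans (hYb x y hxy n)
    · refine Eventually.of_forall fun s hs => ?_
      rw [uIoc_of_le ht] at hs
      exact hSY _ _ (hYt x y hxy) s hs.1.le
  have hgen : ∀ x y, (x, y) ∈ G →
      Tendsto (fun t : ℝ => t⁻¹ • (S t x - x)) (𝓝[>] 0) (𝓝 y) := by
    intro x y hxy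
    have h1 : HasDerivWithinAt (fun t => ∫ s in (0 : ℝ)..t, S s y) (S 0 y) (Ici 0) 0 := by
      refine intervalIntegral.integral_hasDerivWithinAt_right (by simp) (t := Ioi 0) ?_
        ((hScont y 0 self_mem_Ici).mono Ioi_subset_Ici_self)
      refine ⟨Ioi 0, self_mem_nhdsWithin, ?_⟩
      exact ((hScont y).mono Ioi_subset_Ici_self).aestronglyMeasurable measurableSet_Ioi
    have h2 := hasDerivWithinAt_iff_tendsto_slope.1 h1
    rw [Ici_sdiff_left, hC0.zero] at h2
    refine (h2.congr' ?_)
    filter_upwards [self_mem_nhdsWithin] with t ht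
    rw [slope_def_module, hint x y hxy t (le_of_lt ht)]
    simp
  refine ⟨S, hC0, hS1, hint, fun x y => ⟨hgen x y, fun h => ?_⟩⟩
  -- The generator cannot properly extend `G`: with `x'` the solution of the resolvent equation for
  -- `x - y`, the generator would map `x - x'` to itself, and for a contraction semigroup this
  -- forces `x = x'`.
  obtain ⟨x', hx'⟩ := hG.range 1 one_pos (x - y)
  have h1 := h.sub (hgen _ _ hx')
  have hd : Tendsto (fun t : ℝ => inner ℝ (t⁻¹ • (S t (x - x') - (x - x'))) (x - x')) (𝓝[>] 0)
      (𝓝 (inner ℝ (x - x') (x - x'))) := by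
    have h2 := h1.inner (𝕜 := ℝ) (tendsto_const_nhds (x := x - x'))
    convert h2 using 2
    · rw [← smul_sub, map_sub]; congr 2; abel
    · congr 1; rw [one_smul]; abel
  have h3 : inner ℝ (x - x') (x - x') ≤ 0 := by
    refine le_of_tendsto hd ?_
    filter_upwards [self_mem_nhdsWithin] with t ht
    have ht0 : 0 < t := ht
    rw [real_inner_smul_left]
    refine mul_nonpos_of_nonneg_of_nonpos (inv_nonneg.2 ht0.le) ?_
    rw [inner_sub_left, real_inner_self_eq_norm_sq]
    have h4 := real_inner_le_norm (S t (x - x')) (x - x')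
    nlinarith [hSle t ht0.le (x - x'), norm_nonneg (x - x')]
  have h5 : x = x' := by
    rw [← sub_eq_zero]
    exact inner_self_eq_zero.1 (le_antisymm h3 real_inner_self_nonneg)
  subst h5
  simpa using hx'

/-- A semigroup of contractions decays exponentially if its generator is strictly dissipative with
respect to an equivalent (not necessarily symmetric) bilinear form. -/
theorem exists_exp_decay [CompleteSpace X] {S : ℝ → X →L[ℝ] X} {G : Submodule ℝ (X × X)}
    (hG : IsMaxDissipative G) (hC0 : IsC0Semigroup S) (hS1 : ∀ t, 0 ≤ t → ‖S t‖ ≤ 1)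
    (hint : ∀ x y, (x, y) ∈ G → ∀ t, 0 ≤ t → S t x = x + ∫ s in (0 : ℝ)..t, S s y)
    (hgen : IsGenerator S fun x y => (x, y) ∈ G)
    (Q : X →L[ℝ] X →L[ℝ] ℝ) {c₀ c : ℝ} (hc₀ : 0 < c₀) (hc : 0 < c)
    (hQ : ∀ x, c₀ * ‖x‖ ^ 2 ≤ Q x x)
    (hQG : ∀ x y, (x, y) ∈ G → Q x y + Q y x ≤ -c * ‖x‖ ^ 2) :
    ∃ M ω : ℝ, 0 < M ∧ 0 < ω ∧ ∀ t, 0 ≤ t → ‖S t‖ ≤ M * Real.exp (-ω * t) := by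
  set q := ‖Q‖ + 1 with hq
  have hq0 : 0 < q := by positivity
  have hQq : ∀ x, Q x x ≤ q * ‖x‖ ^ 2 := by
    intro x
    have := (le_abs_self _).trans (Q.le_opNorm₂ x x)
    nlinarith [sq_nonneg ‖x‖]
  have hScont := fun x => hC0.continuousOn hS1 x
  have hinv : ∀ x y, (x, y) ∈ G → ∀ t, 0 ≤ t → (S t x, S t y) ∈ G := by
    intro x y hxy t ht
    refine (hgen _ _).2 ?_
    refine (((S t).continuous.tendsto y).comp ((hgen x y).1 hxy)).congr' ?_
    filter_upwards [self_mem_nhdsWithin] with s hs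
    have h1 : S t (S s x) = S s (S t x) := by
      have h2 := hC0.add t s ht (le_of_lt hs)
      rw [add_comm, hC0.add s t (le_of_lt hs) ht] at h2
      exact (congrArg (fun B : X →L[ℝ] X => B x) h2).symm
    simp [h1]
  have hdom : ∀ x y, (x, y) ∈ G → ∀ t, 0 ≤ t →
      Real.exp (c / q * t) * (c₀ * ‖S t x‖ ^ 2) ≤ q * ‖x‖ ^ 2 := by
    intro x y hxy t ht
    have hder : ∀ r, 0 < r → HasDerivAt (fun t => S t x) (S r y) r := by
      intro r hr
      have hmeas : StronglyMeasurableAtFilter (fun s => S s y) (𝓝 r) volume :=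
        ⟨Ioi 0, Ioi_mem_nhds hr,
          ((hScont y).mono Ioi_subset_Ici_self).aestronglyMeasurable measurableSet_Ioi⟩
      have hii : IntervalIntegrable (fun s => S s y) volume 0 r := by
        refine ContinuousOn.intervalIntegrable ?_
        rw [uIcc_of_le hr.le]
        exact (hScont y).mono Icc_subset_Ici_self
      have h1 := (intervalIntegral.integral_hasDerivAt_right hii hmeas
        ((hScont y).continuousAt (Ici_mem_nhds hr))).const_add x
      refine h1.congr_of_eventuallyEq ?_
      filter_upwards [Ioi_mem_nhds hr] with s hs
      exact hint x y hxy s (le_of_lt hs)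
    have hd : ∀ r, 0 < r → HasDerivAt (fun t => Real.exp (c / q * t) * Q (S t x) (S t x))
        (Real.exp (c / q * r) * (c / q) * Q (S r x) (S r x) +
          Real.exp (c / q * r) * (Q (S r y) (S r x) + Q (S r x) (S r y))) r := by
      intro r hr
      have h1 : HasDerivAt (fun t => Real.exp (c / q * t)) (Real.exp (c / q * r) * (c / q)) r := by
        have := ((hasDerivAt_id r).const_mul (c / q)).exp
        simpa using this
      refine h1.mul ?_
      exact (Q.hasFDerivAt.comp_hasDerivAt r (hder r hr)).clm_apply (hder r hr)
    -- Because `Q ≤ q‖·‖²`, the loss `-c‖S r x‖²` is at most `-(c/q) Q`, which the growth of the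
    -- exponential factor does not exceed. This is computed on the domain, where orbits are
    -- differentiable, and then extended by density.
    have hanti : AntitoneOn (fun t => Real.exp (c / q * t) * Q (S t x) (S t x)) (Ici 0) := by
      refine antitoneOn_of_deriv_nonpos (convex_Ici 0) ?_ ?_ ?_
      · refine ContinuousOn.mul (by fun_prop) ?_
        exact (Q.continuous.comp_continuousOn (hScont x)).clm_apply (hScont x)
      · rw [interior_Ici]
        exact fun r hr => (hd r hr).differentiableAt.differentiableWithinAt
      · rw [interior_Ici]
        intro r hr
        rw [(hd r hr).deriv]
        have h1 := hQG _ _ (hinv x y hxy r (le_of_lt hr))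
        have h2 : c / q * Q (S r x) (S r x) ≤ c * ‖S r x‖ ^ 2 := by
          have := mul_le_mul_of_nonneg_left (hQq (S r x)) (div_pos hc hq0).le
          refine this.trans (le_of_eq ?_)
          field_simp
        have h3 := Real.exp_pos (c / q * r)
        have h4 : c / q * Q (S r x) (S r x) + (Q (S r y) (S r x) + Q (S r x) (S r y)) ≤ 0 := by
          linarith
        nlinarith
    have h1 := hanti self_mem_Ici (mem_Ici.2 ht) ht
    simp only [mul_zero, Real.exp_zero, one_mul, hC0.zero, ContinuousLinearMap.id_apply] at h1
    exact (mul_le_mul_of_nonneg_left (hQ _) (Real.exp_pos _).le).trans (h1.trans (hQq x))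
  have hall : ∀ x t, 0 ≤ t → Real.exp (c / q * t) * (c₀ * ‖S t x‖ ^ 2) ≤ q * ‖x‖ ^ 2 := by
    intro x t ht
    have hcl : IsClosed {x | Real.exp (c / q * t) * (c₀ * ‖S t x‖ ^ 2) ≤ q * ‖x‖ ^ 2} :=
      isClosed_le (by fun_prop) (by fun_prop)
    have hsub : {x | ∃ y, (x, y) ∈ G} ⊆
        {x | Real.exp (c / q * t) * (c₀ * ‖S t x‖ ^ 2) ≤ q * ‖x‖ ^ 2} := by
      rintro x ⟨y, hxy⟩
      exact hdom x y hxy t ht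
    exact hcl.closure_subset_iff.2 hsub (hG.dense_domain x)
  -- The bound obtained is for squared norms, hence the square root and the half rate.
  refine ⟨Real.sqrt (q / c₀), c / q / 2, by positivity, by positivity, fun t ht => ?_⟩
  refine ContinuousLinearMap.opNorm_le_bound _ (by positivity) fun x => ?_
  refine le_of_sq_le_sq ?_ (by positivity)
  have h1 := hall x t ht
  have h2 : (Real.exp (-(c / q / 2) * t)) ^ 2 * Real.exp (c / q * t) = 1 := by
    rw [← Real.exp_nat_mul, ← Real.exp_add]
    convert Real.exp_zero using 2
    push_cast; ring
  rw [mul_pow, mul_pow, Real.sq_sqrt (by positivity)]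
  have h3 := mul_le_mul_of_nonneg_left h1 (sq_nonneg (Real.exp (-(c / q / 2) * t)))
  rw [← mul_assoc, h2, one_mul] at h3
  rw [div_mul_eq_mul_div, div_mul_eq_mul_div, le_div_iff₀ hc₀]
  linarith

end HilleYosida

theorem locallyIntegrableOn_Ici_of_intervalIntegrable {E : Type*} [NormedAddCommGroup E]
    {f : ℝ → E} (h : ∀ T, 0 < T → IntervalIntegrable f volume 0 T) :
    LocallyIntegrableOn f (Ici 0) := by
  intro t ht
  have ht0 : (0 : ℝ) < t + 1 := by linarith [mem_Ici.1 ht]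
  refine ⟨Icc 0 (t + 1), ?_, ?_⟩
  · rw [← Ici_inter_Iic]
    exact inter_mem self_mem_nhdsWithin (mem_nhdsWithin_of_mem_nhds (Iic_mem_nhds (by linarith)))
  · rw [integrableOn_Icc_iff_integrableOn_Ioc]
    exact (intervalIntegrable_iff_integrableOn_Ioc_of_le ht0.le).1 (h _ ht0)

/-! ### Duhamel integrals -/

section Convolution

variable {X : Type*} [NormedAddCommGroup X] [NormedSpace ℝ X]
  {S : ℝ → X →L[ℝ] X} {M : ℝ}

/-- Uniform boundedness upgrades strong continuity to joint continuity. The cut-off in time lets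
Duhamel integrals be taken over an interval that does not depend on `t`. -/
theorem IsC0Semigroup.continuous_extend (hS : IsC0Semigroup S) (hM : ∀ t, 0 ≤ t → ‖S t‖ ≤ M) :
    Continuous fun p : ℝ × X => S (max p.1 0) p.2 := by
  rw [continuous_iff_continuousAt]
  rintro ⟨t, x⟩
  rw [ContinuousAt, tendsto_iff_norm_sub_tendsto_zero]
  have hcont : Continuous fun s : ℝ => S (max s 0) x :=
    (hS.continuousOn hM x).comp_continuous (by fun_prop) fun s => mem_Ici.2 (le_max_right _ _)
  have h1 : Tendsto (fun p : ℝ × X => M * ‖p.2 - x‖ + ‖S (max p.1 0) x - S (max t 0) x‖)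
      (𝓝 (t, x)) (𝓝 0) := by
    have : Continuous fun p : ℝ × X => M * ‖p.2 - x‖ + ‖S (max p.1 0) x - S (max t 0) x‖ := by
      have := hcont.comp (continuous_fst (X := ℝ) (Y := X))
      simp only [Function.comp_def] at this
      exact Continuous.add (by fun_prop) (this.sub continuous_const).norm
    simpa using this.tendsto (t, x)
  refine squeeze_zero (fun _ => norm_nonneg _) (fun p => ?_) h1
  calc ‖S (max p.1 0) p.2 - S (max t 0) x‖
      = ‖S (max p.1 0) (p.2 - x) + (S (max p.1 0) x - S (max t 0) x)‖ := by
        congr 1; rw [map_sub]; abel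
    _ ≤ _ := (norm_add_le _ _).trans
        (by gcongr; exact (S _).le_of_opNorm_le (hM _ (le_max_right _ _)) _)

theorem IsC0Semigroup.intervalIntegrable_extend (hS : IsC0Semigroup S)
    (hM : ∀ t, 0 ≤ t → ‖S t‖ ≤ M) {f : ℝ → X} {T : ℝ} (hf : IntervalIntegrable f volume 0 T)
    (t : ℝ) : IntervalIntegrable (fun s => S (max (t - s) 0) (f s)) volume 0 T := by
  refine (hf.norm.const_mul M).mono_fun ?_ (Eventually.of_forall fun s => ?_)
  · exact (hS.continuous_extend hM).comp_aestronglyMeasurable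
      ((by fun_prop : Continuous fun s : ℝ => t - s).aestronglyMeasurable.prodMk
        hf.aestronglyMeasurable_restrict_uIoc)
  · have hM0 : 0 ≤ M := (norm_nonneg _).trans (hM 0 le_rfl)
    simp only [norm_mul, norm_norm, Real.norm_of_nonneg hM0]
    exact (S _).le_of_opNorm_le (hM _ (le_max_right _ _)) _

theorem IsC0Semigroup.intervalIntegrable_conv (hS : IsC0Semigroup S)
    (hM : ∀ t, 0 ≤ t → ‖S t‖ ≤ M) {f : ℝ → X} {t : ℝ} (ht : 0 ≤ t)
    (hf : IntervalIntegrable f volume 0 t) :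
    IntervalIntegrable (fun s => S (t - s) (f s)) volume 0 t := by
  refine (hS.intervalIntegrable_extend hM hf t).congr_uIoo fun s hs => ?_
  rw [uIoo_of_le ht] at hs
  simp only [max_eq_left (sub_nonneg.2 hs.2.le)]

/-- With `max (t - s) 0` in place of `t - s` the integral runs over the fixed interval `[0, T]` and
is continuous in `t` by dominated convergence. The surplus part `s > t` is `∫ₜᵀ f`, because `S 0` is
the identity, and is subtracted. -/
theorem IsC0Semigroup.continuousOn_conv [CompleteSpace X] (hS : IsC0Semigroup S)
    (hM : ∀ t, 0 ≤ t → ‖S t‖ ≤ M) {f : ℝ → X} (hf : LocallyIntegrableOn f (Ici 0)) :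
    ContinuousOn (fun t => ∫ s in (0 : ℝ)..t, S (t - s) (f s)) (Ici 0) := by
  refine continuousOn_Ici_of_Icc fun T hT => ?_
  have hfT := intervalIntegrable_of_locallyIntegrableOn hf le_rfl hT.le
  have h1 : Continuous fun t => ∫ s in (0 : ℝ)..T, S (max (t - s) 0) (f s) := by
    refine intervalIntegral.continuous_of_dominated_interval (bound := fun s => M * ‖f s‖)
      (fun t => (hS.intervalIntegrable_extend hM hfT t).aestronglyMeasurable_restrict_uIoc)
      (fun t => Eventually.of_forall fun s _ =>
        (S _).le_of_opNorm_le (hM _ (le_max_right _ _)) _) (hfT.norm.const_mul M)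
      (Eventually.of_forall fun s _ => ?_)
    exact (hS.continuous_extend hM).comp (by fun_prop : Continuous fun t : ℝ => (t - s, f s))
  have h2 : ContinuousOn (fun t => (∫ s in (0 : ℝ)..T, S (max (t - s) 0) (f s)) -
      ((∫ s in (0 : ℝ)..T, f s) - ∫ s in (0 : ℝ)..t, f s)) (Icc 0 T) :=
    h1.continuousOn.sub (continuousOn_const.sub
      ((primitive_continuousOn hf).mono Icc_subset_Ici_self))
  refine h2.congr fun t ht => ?_
  have e1 := intervalIntegral.integral_add_adjacent_intervals
    (intervalIntegrable_of_locallyIntegrableOn hf le_rfl ht.1)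
    (intervalIntegrable_of_locallyIntegrableOn hf ht.1 hT.le)
  have hi := hS.intervalIntegrable_extend hM hfT t
  have e2 := intervalIntegral.integral_add_adjacent_intervals
    (hi.mono_set (by rw [uIcc_of_le ht.1, uIcc_of_le hT.le]; exact Icc_subset_Icc_right ht.2))
    (hi.mono_set (c := t) (d := T)
      (by rw [uIcc_of_le ht.2, uIcc_of_le hT.le]; exact Icc_subset_Icc_left ht.1))
  have e3 : ∫ s in (0 : ℝ)..t, S (max (t - s) 0) (f s) = ∫ s in (0 : ℝ)..t, S (t - s) (f s) := by
    refine intervalIntegral.integral_congr fun s hs => ?_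
    rw [uIcc_of_le ht.1] at hs
    simp only [max_eq_left (sub_nonneg.2 hs.2)]
  have e4 : ∫ s in t..T, S (max (t - s) 0) (f s) = ∫ s in t..T, f s := by
    refine intervalIntegral.integral_congr fun s hs => ?_
    rw [uIcc_of_le ht.2] at hs
    simp only [max_eq_right (sub_nonpos.2 hs.1), hS.zero, ContinuousLinearMap.id_apply]
  simp only
  rw [← e1, ← e2, e3, e4]
  abel

theorem norm_conv_le {f : ℝ → X} {w t : ℝ} (ht : 0 ≤ t)
    (hM : ∀ t, 0 ≤ t → ‖S t‖ ≤ M * Real.exp (-w * t)) (hf : IntervalIntegrable f volume 0 t) :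
    ‖∫ s in (0 : ℝ)..t, S (t - s) (f s)‖ ≤
      Real.exp (-w * t) * ∫ s in (0 : ℝ)..t, M * (Real.exp (w * s) * ‖f s‖) := by
  rw [← intervalIntegral.integral_const_mul]
  refine intervalIntegral.norm_integral_le_of_norm_le ht (Eventually.of_forall fun s hs => ?_) ?_
  · refine ((S _).le_of_opNorm_le (hM _ (sub_nonneg.2 hs.2)) _).trans (le_of_eq ?_)
    have : Real.exp (-w * (t - s)) = Real.exp (-w * t) * Real.exp (w * s) := by
      rw [← Real.exp_add]; congr 1; ring
    rw [this]; ring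
  · exact ((hf.norm.continuousOn_mul (by fun_prop)).const_mul _).const_mul _

end Convolution

/-! ### Truncation to a ball -/

section RadialProjection

variable {X : Type*} [NormedAddCommGroup X] [NormedSpace ℝ X]

/-- The radial projection onto the closed ball of radius `C`. -/
def radialProj (C : ℝ) (x : X) : X := (C / max C ‖x‖) • x

theorem norm_radialProj_le {C : ℝ} (hC : 0 < C) (x : X) : ‖radialProj C x‖ ≤ C := by
  have hm : 0 < max C ‖x‖ := lt_max_of_lt_left hC
  rw [radialProj, norm_smul, Real.norm_of_nonneg (by positivity), div_mul_eq_mul_div,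
    div_le_iff₀ hm]
  exact mul_le_mul_of_nonneg_left (le_max_right _ _) hC.le

theorem norm_radialProj_le_norm {C : ℝ} (hC : 0 < C) (x : X) : ‖radialProj C x‖ ≤ ‖x‖ := by
  have hm : 0 < max C ‖x‖ := lt_max_of_lt_left hC
  rw [radialProj, norm_smul, Real.norm_of_nonneg (by positivity)]
  exact mul_le_of_le_one_left (norm_nonneg _) ((div_le_one hm).2 (le_max_left _ _))

theorem radialProj_eq_self {C : ℝ} (hC : 0 < C) {x : X} (hx : ‖x‖ ≤ C) : radialProj C x = x := by
  rw [radialProj, max_eq_left hx, div_self hC.ne', one_smul]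

/-- One share of `‖x - y‖` comes from the change of the scalar factor, one from the change of the
vector. The constant `2` does no harm: it enters the construction of the solution but not its decay
rate. -/
theorem norm_radialProj_sub_le {C : ℝ} (hC : 0 < C) (x y : X) :
    ‖radialProj C x - radialProj C y‖ ≤ 2 * ‖x - y‖ := by
  have hx : 0 < max C ‖x‖ := lt_max_of_lt_left hC
  have hy : 0 < max C ‖y‖ := lt_max_of_lt_left hC
  have h1 : radialProj C x - radialProj C y =
      (C / max C ‖x‖ - C / max C ‖y‖) • x + (C / max C ‖y‖) • (x - y) := by
    simp only [radialProj]; module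
  have h2 : C / max C ‖x‖ - C / max C ‖y‖ =
      (max C ‖y‖ - max C ‖x‖) * (C / max C ‖y‖ / max C ‖x‖) := by
    field_simp
  have h3 : C / max C ‖y‖ ≤ 1 := (div_le_one hy).2 (le_max_left _ _)
  have h4 : |max C ‖y‖ - max C ‖x‖| ≤ ‖x - y‖ := by
    refine (abs_max_sub_max_le_max _ _ _ _).trans ?_
    rw [sub_self, abs_zero, max_eq_right (abs_nonneg _), norm_sub_rev]
    exact abs_norm_sub_norm_le _ _
  rw [h1]
  refine (norm_add_le _ _).trans ?_
  rw [norm_smul, norm_smul, h2, norm_mul, Real.norm_eq_abs, Real.norm_of_nonneg (by positivity),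
    Real.norm_of_nonneg (by positivity)]
  have h5 : C / max C ‖y‖ / max C ‖x‖ * ‖x‖ ≤ 1 := by
    rw [div_mul_eq_mul_div, div_le_one hx]
    exact (mul_le_of_le_one_left (norm_nonneg _) h3).trans (le_max_right _ _)
  have h6 := mul_le_mul h4 h5 (by positivity) (norm_nonneg _)
  have h7 := mul_le_mul_of_nonneg_right h3 (norm_nonneg (x - y))
  nlinarith

end RadialProjection

/-! ### Removal of the delay from integral inequalities -/

section Shift

theorem intervalIntegrable_shift {κ : ℝ → ℝ} (hκ : LocallyIntegrableOn κ (Ici 0)) {τ : ℝ}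
    (hτ : 0 ≤ τ) : LocallyIntegrableOn (fun s => κ (s + τ)) (Ici 0) := by
  refine locallyIntegrableOn_Ici_of_intervalIntegrable fun T hT => ?_
  have := (intervalIntegrable_of_locallyIntegrableOn hκ hτ (by positivity : 0 ≤ T + τ)).comp_add_right τ
  simpa using this

/-- The substitution `s ↦ s + τ` leaves an integral over `[0, t - τ]`, which may be enlarged to `[0,
t]` because the integrand is nonnegative. The shift thus passes from the unknown to the coefficient.
-/
theorem integral_delay_le {κ z : ℝ → ℝ} (hκ : LocallyIntegrableOn κ (Ici 0))
    (hκ0 : ∀ s, 0 ≤ s → 0 ≤ κ s) {τ t : ℝ} (hτ : 0 ≤ τ) (ht : 0 ≤ t)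
    (hz : ContinuousOn z (Icc 0 t)) (hz0 : ∀ s ∈ Icc 0 t, 0 ≤ z s) :
    (∫ s in (0 : ℝ)..t, if s ≤ τ then 0 else κ s * z (s - τ)) ≤
      ∫ s in (0 : ℝ)..t, κ (s + τ) * z s := by
  have hpos : ∀ s ∈ Icc 0 t, 0 ≤ κ (s + τ) * z s := fun s hs =>
    mul_nonneg (hκ0 _ (add_nonneg hs.1 hτ)) (hz0 s hs)
  rcases le_total t τ with h | h
  · have : ∫ s in (0 : ℝ)..t, (if s ≤ τ then 0 else κ s * z (s - τ)) = 0 := by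
      refine (intervalIntegral.integral_congr (g := fun _ => 0) fun s hs => ?_).trans (by simp)
      rw [uIcc_of_le ht] at hs
      simp [hs.2.trans h]
    rw [this]
    exact intervalIntegral.integral_nonneg ht hpos
  · have hsub : Icc 0 (t - τ) ⊆ Icc 0 t := Icc_subset_Icc_right (by linarith)
    have hi := intervalIntegrable_mul_continuousOn (intervalIntegrable_shift hκ hτ) ht hz
    have hi1 : IntervalIntegrable (fun s => κ (s + τ) * z s) volume 0 (t - τ) :=
      intervalIntegrable_mul_continuousOn (intervalIntegrable_shift hκ hτ) (by linarith)
        (hz.mono hsub)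
    have hi2 : IntervalIntegrable (fun s => κ (s + τ) * z s) volume (t - τ) t :=
      hi.mono_set (by
        rw [uIcc_of_le ht, uIcc_of_le (by linarith)]; exact Icc_subset_Icc_left (by linarith))
    have e1 : ∫ s in τ..t, (if s ≤ τ then 0 else κ s * z (s - τ)) =
        ∫ s in τ..t, κ s * z (s - τ) := by
      refine intervalIntegral.integral_congr_ae (Eventually.of_forall fun s hs => ?_)
      rw [uIoc_of_le h] at hs
      simp [not_le.2 hs.1]
    have e2 : ∫ s in τ..t, κ s * z (s - τ) = ∫ s in (0 : ℝ)..(t - τ), κ (s + τ) * z s := by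
      have := intervalIntegral.integral_comp_sub_right (a := τ) (b := t)
        (fun s => κ (s + τ) * z s) τ
      simpa using this
    have e3 : ∫ s in (0 : ℝ)..τ, (if s ≤ τ then 0 else κ s * z (s - τ)) = 0 := by
      refine (intervalIntegral.integral_congr (g := fun _ => 0) fun s hs => ?_).trans (by simp)
      rw [uIcc_of_le hτ] at hs
      simp [hs.2]
    have j1 : IntervalIntegrable (fun s => if s ≤ τ then 0 else κ s * z (s - τ)) volume 0 τ := by
      refine (intervalIntegrable_const (c := (0 : ℝ))).congr_uIoo fun s hs => ?_
      rw [uIoo_of_le hτ] at hs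
      simp [hs.2.le]
    have j2 : IntervalIntegrable (fun s => if s ≤ τ then 0 else κ s * z (s - τ)) volume τ t := by
      have := hi1.comp_sub_right τ
      simp only [zero_add, sub_add_cancel] at this
      refine this.congr_uIoo fun s hs => ?_
      rw [uIoo_of_le h] at hs
      simp [not_le.2 hs.1]
    rw [← intervalIntegral.integral_add_adjacent_intervals j1 j2, e3, zero_add, e1, e2,
      ← intervalIntegral.integral_add_adjacent_intervals hi1 hi2, le_add_iff_nonneg_right]
    exact intervalIntegral.integral_nonneg (by linarith) fun s hs =>
      hpos s ⟨by linarith [hs.1], hs.2⟩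

end Shift

/-! ### The abstract semilinear delay problem -/

section DelayProblem

variable {X : Type*} [NormedAddCommGroup X] [NormedSpace ℝ X]

/-- The delayed feedback `b (U (t - τ))`, with the prescribed history `g` on `[0, τ]`. -/
def delayTerm (b : X → X) (τ : ℝ) (g U : ℝ → X) (t : ℝ) : X :=
  if t ≤ τ then g t else b (U (t - τ))

/-- The right-hand side of Duhamel's formula for the delay problem. -/
def duhamel (S : ℝ → X →L[ℝ] X) (b : X → X) (τ : ℝ) (k : ℝ → ℝ) (F : X → X) (U₀ : X)
    (g U : ℝ → X) (t : ℝ) : X :=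
  S t U₀ + ∫ s in (0 : ℝ)..t, S (t - s) (-(k s • delayTerm b τ g U s) + F (U s))

variable {S : ℝ → X →L[ℝ] X} {b : X → X} {τ : ℝ} {k : ℝ → ℝ} {F : X → X} {U₀ : X} {g : ℝ → X}

theorem intervalIntegrable_delayTerm (hτ : 0 ≤ τ) (hk : LocallyIntegrableOn k (Ici 0))
    (hb : Continuous b) (hg : ContinuousOn g (Icc 0 τ)) {U : ℝ → X} {t : ℝ} (ht : 0 ≤ t)
    (hU : ContinuousOn U (Icc 0 t)) :
    IntervalIntegrable (fun s => k s • delayTerm b τ g U s) volume 0 t := by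
  have h1 : IntervalIntegrable (fun s => k s • delayTerm b τ g U s) volume 0 τ := by
    have : IntervalIntegrable (fun s => k s • g s) volume 0 τ :=
      (intervalIntegrable_of_locallyIntegrableOn hk le_rfl hτ).smul_continuousOn
        (by rwa [uIcc_of_le hτ])
    refine this.congr_uIoo fun s hs => ?_
    rw [uIoo_of_le hτ] at hs
    simp [delayTerm, hs.2.le]
  rcases le_total t τ with h | h
  · exact h1.mono_set (by rw [uIcc_of_le ht, uIcc_of_le hτ]; exact Icc_subset_Icc_right h)
  · refine h1.trans ?_
    have : IntervalIntegrable (fun s => k s • b (U (s - τ))) volume τ t := by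
      refine (intervalIntegrable_of_locallyIntegrableOn hk hτ ht).smul_continuousOn ?_
      rw [uIcc_of_le h]
      refine hb.comp_continuousOn (hU.comp (by fun_prop) fun s hs => ?_)
      exact ⟨by linarith [hs.1], by linarith [hs.2]⟩
    refine this.congr_uIoo fun s hs => ?_
    rw [uIoo_of_le h] at hs
    simp [delayTerm, not_le.2 hs.1]

theorem intervalIntegrable_forcing (hτ : 0 ≤ τ) (hk : LocallyIntegrableOn k (Ici 0))
    (hb : Continuous b) (hg : ContinuousOn g (Icc 0 τ)) {U : ℝ → X} {t : ℝ} (ht : 0 ≤ t)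
    (hU : ContinuousOn U (Icc 0 t)) (hF : ContinuousOn (fun s => F (U s)) (Icc 0 t)) :
    IntervalIntegrable (fun s => -(k s • delayTerm b τ g U s) + F (U s)) volume 0 t :=
  (intervalIntegrable_delayTerm hτ hk hb hg ht hU).neg.add
    (ContinuousOn.intervalIntegrable (by rwa [uIcc_of_le ht]))

/-- The kernel of the Volterra inequalities for the delay problem. -/
def volterraKernel (k : ℝ → ℝ) (τ c d : ℝ) (s : ℝ) : ℝ := c * |k (s + τ)| + d

theorem volterraKernel_locallyIntegrableOn (hτ : 0 ≤ τ) (hk : LocallyIntegrableOn k (Ici 0))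
    (c d : ℝ) : LocallyIntegrableOn (volterraKernel k τ c d) (Ici 0) := by
  refine locallyIntegrableOn_Ici_of_intervalIntegrable fun T hT => ?_
  exact ((intervalIntegrable_of_locallyIntegrableOn (intervalIntegrable_shift hk hτ)
    le_rfl hT.le).norm.const_mul c).add intervalIntegrable_const

theorem volterraKernel_nonneg {c d : ℝ} (hc : 0 ≤ c) (hd : 0 ≤ d) (s : ℝ) :
    0 ≤ volterraKernel k τ c d s := by
  unfold volterraKernel; positivity

theorem integral_volterraKernel (hτ : 0 ≤ τ) (hk : LocallyIntegrableOn k (Ici 0))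
    (c d : ℝ) {t : ℝ} (ht : 0 ≤ t) :
    ∫ s in (0 : ℝ)..t, volterraKernel k τ c d s =
      c * (∫ s in (0 : ℝ)..t, |k (s + τ)|) + d * t := by
  have h := (intervalIntegrable_of_locallyIntegrableOn (intervalIntegrable_shift hk hτ)
    le_rfl ht).norm
  simp only [Real.norm_eq_abs] at h
  simp only [volterraKernel]
  rw [intervalIntegral.integral_add (h.const_mul c) intervalIntegrable_const,
    intervalIntegral.integral_const_mul]
  simp [mul_comm]

theorem integral_delay_add_le (hτ : 0 ≤ τ) (hk : LocallyIntegrableOn k (Ici 0)) {c d : ℝ}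
    (hc : 0 ≤ c) {z : ℝ → ℝ} {t : ℝ} (ht : 0 ≤ t)
    (hz : ContinuousOn z (Icc 0 t)) (hz0 : ∀ s ∈ Icc 0 t, 0 ≤ z s) :
    (∫ s in (0 : ℝ)..t, ((if s ≤ τ then 0 else (c * |k s|) * z (s - τ)) + d * z s)) ≤
      ∫ s in (0 : ℝ)..t, volterraKernel k τ c d s * z s := by
  have hck : LocallyIntegrableOn (fun s => c * |k s|) (Ici 0) :=
    locallyIntegrableOn_Ici_of_intervalIntegrable fun T hT =>
      (intervalIntegrable_of_locallyIntegrableOn hk le_rfl hT.le).norm.const_mul c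
  have h1 : IntervalIntegrable (fun s => if s ≤ τ then 0 else (c * |k s|) * z (s - τ))
      volume 0 t := by
    have := intervalIntegrable_delayTerm (b := id) (g := fun _ => (0 : ℝ)) hτ hck continuous_id
      continuousOn_const ht hz
    refine this.congr fun s _ => ?_
    by_cases h : s ≤ τ <;> simp [delayTerm, h]
  have h2 : IntervalIntegrable z volume 0 t :=
    ContinuousOn.intervalIntegrable (by rwa [uIcc_of_le ht])
  have h3 := intervalIntegrable_mul_continuousOn (intervalIntegrable_shift hck hτ) ht hz
  rw [intervalIntegral.integral_add h1 (h2.const_mul d)]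
  simp only [volterraKernel, add_mul]
  rw [intervalIntegral.integral_add h3 (h2.const_mul d)]
  gcongr
  exact integral_delay_le hck (fun s _ => by positivity) hτ ht hz hz0

/-- Comparison of the Duhamel integrals of two functions. -/
theorem norm_duhamel_sub_le {M : ℝ} (hM : ∀ t, 0 ≤ t → ‖S t‖ ≤ M) (hS : IsC0Semigroup S)
    (hτ : 0 ≤ τ) (hk : LocallyIntegrableOn k (Ici 0))
    {β : ℝ} (hβ : 0 ≤ β) (hb : ∀ x y, ‖b x - b y‖ ≤ β * ‖x - y‖) (hg : ContinuousOn g (Icc 0 τ))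
    {U V : ℝ → X} {t Λ : ℝ} (ht : 0 ≤ t) (hU : ContinuousOn U (Icc 0 t))
    (hV : ContinuousOn V (Icc 0 t)) (hFU : ContinuousOn (fun s => F (U s)) (Icc 0 t))
    (hFV : ContinuousOn (fun s => F (V s)) (Icc 0 t))
    (hF : ∀ s ∈ Icc 0 t, ‖F (U s) - F (V s)‖ ≤ Λ * ‖U s - V s‖) :
    ‖duhamel S b τ k F U₀ g U t - duhamel S b τ k F U₀ g V t‖ ≤
      ∫ s in (0 : ℝ)..t, volterraKernel k τ (M * β) (M * Λ) s * ‖U s - V s‖ := by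
  have hbc : Continuous b := (LipschitzWith.of_dist_le_mul (K := ⟨β, hβ⟩) fun x y => by
    rw [dist_eq_norm, dist_eq_norm]; exact hb x y).continuous
  have hM0 : 0 ≤ M := (norm_nonneg _).trans (hM 0 le_rfl)
  have iU := intervalIntegrable_forcing hτ hk hbc hg ht hU hFU
  have iV := intervalIntegrable_forcing hτ hk hbc hg ht hV hFV
  have hz : ContinuousOn (fun s => ‖U s - V s‖) (Icc 0 t) := (hU.sub hV).norm
  have e1 : duhamel S b τ k F U₀ g U t - duhamel S b τ k F U₀ g V t =
      ∫ s in (0 : ℝ)..t, S (t - s) ((-(k s • delayTerm b τ g U s) + F (U s)) -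
        (-(k s • delayTerm b τ g V s) + F (V s))) := by
    simp only [duhamel, map_sub]
    rw [intervalIntegral.integral_sub (hS.intervalIntegrable_conv hM ht iU)
      (hS.intervalIntegrable_conv hM ht iV)]
    abel
  have h1 := norm_conv_le (w := 0) ht (fun t ht => by simpa using hM t ht) (iU.sub iV)
  rw [e1]
  refine h1.trans ?_
  simp only [neg_zero, zero_mul, Real.exp_zero, one_mul]
  refine le_trans ?_ (integral_delay_add_le hτ hk (mul_nonneg hM0 hβ) ht hz
    fun s _ => norm_nonneg _)
  refine intervalIntegral.integral_mono_on ht ((iU.sub iV).norm.const_mul M) ?_ fun s hs => ?_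
  · have hck : LocallyIntegrableOn (fun s => (M * β) * |k s|) (Ici 0) :=
      locallyIntegrableOn_Ici_of_intervalIntegrable fun T hT =>
        (intervalIntegrable_of_locallyIntegrableOn hk le_rfl hT.le).norm.const_mul _
    refine IntervalIntegrable.add ?_ (ContinuousOn.intervalIntegrable
      (by rw [uIcc_of_le ht]; exact continuousOn_const.mul hz))
    have := intervalIntegrable_delayTerm (b := id) (g := fun _ => (0 : ℝ)) hτ hck continuous_id
      continuousOn_const ht hz
    refine this.congr fun s _ => ?_
    by_cases h : s ≤ τ <;> simp [delayTerm, h]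
  · have h2 : ‖-(k s • delayTerm b τ g U s) + F (U s) - (-(k s • delayTerm b τ g V s) + F (V s))‖
        ≤ (if s ≤ τ then 0 else (β * |k s|) * ‖U (s - τ) - V (s - τ)‖) + Λ * ‖U s - V s‖ := by
      have e2 : -(k s • delayTerm b τ g U s) + F (U s) - (-(k s • delayTerm b τ g V s) + F (V s))
          = -(k s • (delayTerm b τ g U s - delayTerm b τ g V s)) + (F (U s) - F (V s)) := by
        rw [smul_sub]; abel
      rw [e2]
      refine (norm_add_le _ _).trans (add_le_add ?_ (hF s hs))
      rw [norm_neg, norm_smul, Real.norm_eq_abs]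
      -- For `s ≤ τ` both delay terms are the same history `g s` and cancel.
      by_cases h : s ≤ τ
      · simp [delayTerm, h]
      · simp only [delayTerm, h, if_false]
        have := mul_le_mul_of_nonneg_left (hb (U (s - τ)) (V (s - τ))) (abs_nonneg (k s))
        linarith
    refine (mul_le_mul_of_nonneg_left h2 hM0).trans (le_of_eq ?_)
    split_ifs <;> ring

/-- Exponential decay of small solutions. -/
theorem norm_le_of_duhamel {M w : ℝ} (hM : ∀ t, 0 ≤ t → ‖S t‖ ≤ M * Real.exp (-w * t))
    (hM0 : 0 ≤ M) (hτ : 0 ≤ τ) (hk : LocallyIntegrableOn k (Ici 0))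
    {β : ℝ} (hβ : 0 ≤ β) (hbc : Continuous b) (hb : ∀ x, ‖b x‖ ≤ β * ‖x‖)
    (hg : ContinuousOn g (Icc 0 τ))
    {w' γ l : ℝ} (hl : 0 ≤ l)
    (hγ : ∀ t, 0 ≤ t → β * M * Real.exp (w * τ) * (∫ s in (0 : ℝ)..t, |k (s + τ)|) ≤ γ + w' * t)
    {U : ℝ → X} (hU : ContinuousOn U (Ici 0)) (hFU : ContinuousOn (fun s => F (U s)) (Ici 0))
    (hF : ∀ s, 0 ≤ s → ‖F (U s)‖ ≤ l * ‖U s‖)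
    (hsol : ∀ t, 0 ≤ t → U t = duhamel S b τ k F U₀ g U t) {t : ℝ} (ht : 0 ≤ t) :
    ‖U t‖ ≤ M * Real.exp γ * (‖U₀‖ + ∫ s in (0 : ℝ)..τ, Real.exp (w * s) * |k s| * ‖g s‖) *
      Real.exp (-(w - w' - M * l) * t) := by
  have hUt : ∀ t, ContinuousOn U (Icc 0 t) := fun t => hU.mono Icc_subset_Ici_self
  set N : ℝ := M * (‖U₀‖ + ∫ s in (0 : ℝ)..τ, Real.exp (w * s) * |k s| * ‖g s‖) with hN
  have hI0 : 0 ≤ ∫ s in (0 : ℝ)..τ, Real.exp (w * s) * |k s| * ‖g s‖ :=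
    intervalIntegral.integral_nonneg hτ fun s _ => by positivity
  have hN0 : 0 ≤ N := by positivity
  have hy : ContinuousOn (fun t => Real.exp (w * t) * ‖U t‖) (Ici 0) :=
    ContinuousOn.mul (by fun_prop) hU.norm
  have hck : LocallyIntegrableOn (fun s => (M * β * Real.exp (w * τ)) * |k s|) (Ici 0) :=
    locallyIntegrableOn_Ici_of_intervalIntegrable fun T hT =>
      (intervalIntegrable_of_locallyIntegrableOn hk le_rfl hT.le).norm.const_mul _
  have hφ : IntervalIntegrable (fun s => Real.exp (w * s) * |k s| * ‖g s‖) volume 0 τ := by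
    refine IntervalIntegrable.mul_continuousOn ?_ (by rw [uIcc_of_le hτ]; exact hg.norm)
    exact (intervalIntegrable_of_locallyIntegrableOn hk le_rfl hτ).norm.continuousOn_mul
      (by fun_prop)
  -- Duhamel's formula multiplied by `e^{wr}`. Splitting `e^{ws} = e^{wτ} e^{w(s-τ)}` weights the
  -- delayed value correctly at the price of the factor `e^{wτ}`; the history interval contributes
  -- at most its full integral, which is part of `N`.
  have hineq : ∀ r, 0 ≤ r → Real.exp (w * r) * ‖U r‖ ≤ N + ∫ s in (0 : ℝ)..r,
      volterraKernel k τ (M * β * Real.exp (w * τ)) (M * l) s * (Real.exp (w * s) * ‖U s‖) := by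
    intro r hr
    have hf := intervalIntegrable_forcing hτ hk hbc hg hr (hUt r) (hFU.mono Icc_subset_Ici_self)
    have hyr := hy.mono (show Icc 0 r ⊆ Ici 0 from Icc_subset_Ici_self)
    have h1 : ‖U r‖ ≤ Real.exp (-w * r) * (M * ‖U₀‖ + ∫ s in (0 : ℝ)..r,
        M * (Real.exp (w * s) * ‖-(k s • delayTerm b τ g U s) + F (U s)‖)) := by
      rw [hsol r hr, duhamel]
      refine (norm_add_le _ _).trans ?_
      rw [mul_add]
      refine add_le_add ?_ (norm_conv_le hr hM hf)
      refine ((S r).le_of_opNorm_le (hM r hr) U₀).trans (le_of_eq (by ring))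
    have h2 : Real.exp (w * r) * ‖U r‖ ≤ M * ‖U₀‖ + ∫ s in (0 : ℝ)..r,
        M * (Real.exp (w * s) * ‖-(k s • delayTerm b τ g U s) + F (U s)‖) := by
      have := mul_le_mul_of_nonneg_left h1 (Real.exp_pos (w * r)).le
      rwa [← mul_assoc, ← Real.exp_add, show w * r + -w * r = 0 by ring, Real.exp_zero,
        one_mul] at this
    have i1 : IntervalIntegrable (fun s => if s ≤ τ then Real.exp (w * s) * |k s| * ‖g s‖ else 0)
        volume 0 r := by
      have := intervalIntegrable_delayTerm (b := fun _ => (0 : ℝ))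
        (g := fun s => Real.exp (w * s) * ‖g s‖) hτ hk.norm continuous_const
        (ContinuousOn.mul (by fun_prop) hg.norm) hr (continuousOn_const (c := (0 : ℝ)))
      refine this.congr fun s _ => ?_
      by_cases h : s ≤ τ
      · simp [delayTerm, h]; ring
      · simp [delayTerm, h]
    have i2 : IntervalIntegrable (fun s => (if s ≤ τ then 0 else
        (M * β * Real.exp (w * τ)) * |k s| * (Real.exp (w * (s - τ)) * ‖U (s - τ)‖)) +
        M * l * (Real.exp (w * s) * ‖U s‖)) volume 0 r := by
      refine IntervalIntegrable.add ?_ (ContinuousOn.intervalIntegrable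
        (by rw [uIcc_of_le hr]; exact continuousOn_const.mul hyr))
      have := intervalIntegrable_delayTerm (b := id) (g := fun _ => (0 : ℝ)) hτ hck continuous_id
        continuousOn_const hr hyr
      refine this.congr fun s _ => ?_
      by_cases h : s ≤ τ <;> simp [delayTerm, h]
    have h3 : ∫ s in (0 : ℝ)..r,
        M * (Real.exp (w * s) * ‖-(k s • delayTerm b τ g U s) + F (U s)‖) ≤
        ∫ s in (0 : ℝ)..r, (M * (if s ≤ τ then Real.exp (w * s) * |k s| * ‖g s‖ else 0) +
          ((if s ≤ τ then 0 else
            (M * β * Real.exp (w * τ)) * |k s| * (Real.exp (w * (s - τ)) * ‖U (s - τ)‖)) +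
          M * l * (Real.exp (w * s) * ‖U s‖))) := by
      refine intervalIntegral.integral_mono_on hr
        ((hf.norm.continuousOn_mul (by fun_prop)).const_mul M) ((i1.const_mul M).add i2)
        fun s hs => ?_
      have e1 : ‖-(k s • delayTerm b τ g U s) + F (U s)‖ ≤
          |k s| * ‖delayTerm b τ g U s‖ + l * ‖U s‖ := by
        refine (norm_add_le _ _).trans (add_le_add ?_ (hF s hs.1))
        rw [norm_neg, norm_smul, Real.norm_eq_abs]
      have e2 := mul_le_mul_of_nonneg_left e1 (Real.exp_pos (w * s)).le
      refine (mul_le_mul_of_nonneg_left e2 hM0).trans ?_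
      by_cases h : s ≤ τ
      · simp only [delayTerm, h, if_true]
        exact le_of_eq (by ring)
      · simp only [delayTerm, h, if_false]
        have e3 : Real.exp (w * s) = Real.exp (w * τ) * Real.exp (w * (s - τ)) := by
          rw [← Real.exp_add]; congr 1; ring
        have e4 := mul_le_mul_of_nonneg_left (hb (U (s - τ)))
          (by positivity : 0 ≤ M * (Real.exp (w * s) * |k s|))
        have e5 : M * β * Real.exp (w * τ) * |k s| * (Real.exp (w * (s - τ)) * ‖U (s - τ)‖) =
            M * (Real.exp (w * s) * |k s|) * (β * ‖U (s - τ)‖) := by rw [e3]; ring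
        rw [e5]
        linarith
    rw [intervalIntegral.integral_add (i1.const_mul M) i2] at h3
    simp only [intervalIntegral.integral_const_mul] at h2 h3
    have h4 := integral_delay_add_le hτ hk (d := M * l)
      (by positivity : 0 ≤ M * β * Real.exp (w * τ)) hr hyr fun s _ => by positivity
    have h5 : ∫ s in (0 : ℝ)..r, (if s ≤ τ then Real.exp (w * s) * |k s| * ‖g s‖ else 0) ≤
        ∫ s in (0 : ℝ)..τ, Real.exp (w * s) * |k s| * ‖g s‖ := by
      rcases le_total r τ with h | h
      · have e1 : ∫ s in (0 : ℝ)..r, (if s ≤ τ then Real.exp (w * s) * |k s| * ‖g s‖ else 0) =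
            ∫ s in (0 : ℝ)..r, Real.exp (w * s) * |k s| * ‖g s‖ := by
          refine intervalIntegral.integral_congr fun s hs => ?_
          rw [uIcc_of_le hr] at hs
          simp [hs.2.trans h]
        rw [e1]
        exact intervalIntegral.integral_mono_interval le_rfl hr h
          (Eventually.of_forall fun s => by simp only [Pi.zero_apply]; positivity) hφ
      · have j1 := i1.mono_set (c := 0) (d := τ)
          (by rw [uIcc_of_le hτ, uIcc_of_le hr]; exact Icc_subset_Icc_right h)
        have j2 := i1.mono_set (c := τ) (d := r)
          (by rw [uIcc_of_le h, uIcc_of_le hr]; exact Icc_subset_Icc_left hτ)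
        rw [← intervalIntegral.integral_add_adjacent_intervals j1 j2]
        have e1 : ∫ s in τ..r, (if s ≤ τ then Real.exp (w * s) * |k s| * ‖g s‖ else 0) = 0 := by
          refine (intervalIntegral.integral_congr_ae (g := fun _ => 0)
            (Eventually.of_forall fun s hs => ?_)).trans (by simp)
          rw [uIoc_of_le h] at hs
          simp [not_le.2 hs.1]
        rw [e1, add_zero]
        refine le_of_eq (intervalIntegral.integral_congr fun s hs => ?_)
        rw [uIcc_of_le hτ] at hs
        simp [hs.2]
    have h6 := mul_le_mul_of_nonneg_left h5 hM0
    rw [hN, mul_add]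
    linarith
  have hgr := le_mul_exp_primitive (T := t)
    (volterraKernel_locallyIntegrableOn hτ hk (M * β * Real.exp (w * τ)) (M * l))
    (fun s _ => volterraKernel_nonneg (by positivity) (by positivity) s)
    (hy.mono Icc_subset_Ici_self) (fun r hr => hineq r hr.1) t (right_mem_Icc.2 ht)
  rw [integral_volterraKernel hτ hk _ _ ht] at hgr
  have h7 : M * β * Real.exp (w * τ) * (∫ s in (0 : ℝ)..t, |k (s + τ)|) + M * l * t ≤
      γ + w' * t + M * l * t := by
    have := hγ t ht
    rw [mul_comm M β]
    linarith
  have h8 := hgr.trans (mul_le_mul_of_nonneg_left (Real.exp_le_exp.2 h7) hN0)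
  have h9 := mul_le_mul_of_nonneg_left h8 (Real.exp_pos (-(w * t))).le
  rw [← mul_assoc, ← Real.exp_add, neg_add_cancel, Real.exp_zero, one_mul] at h9
  refine h9.trans (le_of_eq ?_)
  have h10 : Real.exp (-(w * t)) * Real.exp (γ + w' * t + M * l * t) =
      Real.exp γ * Real.exp (-(w - w' - M * l) * t) := by
    rw [← Real.exp_add, ← Real.exp_add]; congr 1; ring
  rw [hN]
  calc _ = M * (‖U₀‖ + ∫ s in (0 : ℝ)..τ, Real.exp (w * s) * |k s| * ‖g s‖) *
      (Real.exp (-(w * t)) * Real.exp (γ + w' * t + M * l * t)) := by ring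
    _ = _ := by rw [h10]; ring

/-- By compactness both solutions stay in one ball on `[0, t]`, where `F` is Lipschitz, so their
distance satisfies a homogeneous Volterra inequality. No smallness is involved. -/
theorem delay_problem_unique {M : ℝ} (hM : ∀ t, 0 ≤ t → ‖S t‖ ≤ M) (hS : IsC0Semigroup S)
    (hτ : 0 ≤ τ) (hk : LocallyIntegrableOn k (Ici 0))
    {β : ℝ} (hβ : 0 ≤ β) (hb : ∀ x y, ‖b x - b y‖ ≤ β * ‖x - y‖) (hg : ContinuousOn g (Icc 0 τ))
    (hF : ∀ r, 0 < r → ∃ l, 0 ≤ l ∧ ∀ x y, ‖x‖ ≤ r → ‖y‖ ≤ r → ‖F x - F y‖ ≤ l * ‖x - y‖)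
    {U V : ℝ → X} (hU : ContinuousOn U (Ici 0)) (hV : ContinuousOn V (Ici 0))
    (hUs : ∀ t, 0 ≤ t → U t = duhamel S b τ k F U₀ g U t)
    (hVs : ∀ t, 0 ≤ t → V t = duhamel S b τ k F U₀ g V t) : EqOn U V (Ici 0) := by
  intro t ht
  have hUt : ContinuousOn U (Icc 0 t) := hU.mono Icc_subset_Ici_self
  have hVt : ContinuousOn V (Icc 0 t) := hV.mono Icc_subset_Ici_self
  obtain ⟨r₁, h₁⟩ := isCompact_Icc.bddAbove_image hUt.norm
  obtain ⟨r₂, h₂⟩ := isCompact_Icc.bddAbove_image hVt.norm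
  set r := max (max r₁ r₂) 1 with hr
  have hr0 : 0 < r := lt_max_of_lt_right one_pos
  have hUr : ∀ s ∈ Icc 0 t, ‖U s‖ ≤ r := fun s hs =>
    (h₁ (mem_image_of_mem (fun s => ‖U s‖) hs)).trans ((le_max_left _ _).trans (le_max_left _ _))
  have hVr : ∀ s ∈ Icc 0 t, ‖V s‖ ≤ r := fun s hs =>
    (h₂ (mem_image_of_mem (fun s => ‖V s‖) hs)).trans ((le_max_right _ _).trans (le_max_left _ _))
  obtain ⟨l, hl, hFl⟩ := hF r hr0
  have hM0 : 0 ≤ M := (norm_nonneg _).trans (hM 0 le_rfl)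
  have hFc : ContinuousOn F {x | ‖x‖ ≤ r} := by
    refine (LipschitzOnWith.of_dist_le_mul (K := ⟨l, hl⟩) fun x hx y hy => ?_).continuousOn
    rw [dist_eq_norm, dist_eq_norm]
    exact hFl x y hx hy
  refine eqOn_of_norm_sub_le_volterra
    (volterraKernel_locallyIntegrableOn hτ hk (M * β) (M * l))
    (fun s _ => volterraKernel_nonneg (by positivity) (by positivity) s) hUt hVt
    (fun s hs => ?_) (right_mem_Icc.2 ht)
  have hsub : Icc 0 s ⊆ Icc 0 t := Icc_subset_Icc_right hs.2
  have := norm_duhamel_sub_le (U₀ := U₀) (Λ := l) hM hS hτ hk hβ hb hg hs.1 (hUt.mono hsub) (hVt.mono hsub)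
    (hFc.comp (hUt.mono hsub) fun x hx => hUr x (hsub hx))
    (hFc.comp (hVt.mono hsub) fun x hx => hVr x (hsub hx))
    fun x hx => hFl _ _ (hUr x (hsub hx)) (hVr x (hsub hx))
  rwa [← hUs s hs.1, ← hVs s hs.1] at this

/-- Small data have a global solution, which decays exponentially. -/
theorem exists_small_solution [CompleteSpace X] {M w : ℝ}
    (hM : ∀ t, 0 ≤ t → ‖S t‖ ≤ M * Real.exp (-w * t))
    (hM0 : 0 ≤ M) (hw : 0 ≤ w) (hS : IsC0Semigroup S)
    (hτ : 0 ≤ τ) (hk : LocallyIntegrableOn k (Ici 0))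
    {β : ℝ} (hβ : 0 ≤ β) (hb0 : b 0 = 0) (hb : ∀ x y, ‖b x - b y‖ ≤ β * ‖x - y‖)
    (hg : ContinuousOn g (Icc 0 τ))
    {w' γ l C : ℝ} (hl : 0 ≤ l) (hC : 0 < C)
    (hγ : ∀ t, 0 ≤ t → β * M * Real.exp (w * τ) * (∫ s in (0 : ℝ)..t, |k (s + τ)|) ≤ γ + w' * t)
    (hF0 : F 0 = 0) (hF : ∀ x y, ‖x‖ ≤ C → ‖y‖ ≤ C → ‖F x - F y‖ ≤ l * ‖x - y‖)
    (hlw : M * l ≤ w - w')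
    (hsmall : M * Real.exp γ *
      (‖U₀‖ + ∫ s in (0 : ℝ)..τ, Real.exp (w * s) * |k s| * ‖g s‖) ≤ C) :
    ∃ U : ℝ → X, ContinuousOn U (Ici 0) ∧ (∀ t, 0 ≤ t → U t = duhamel S b τ k F U₀ g U t) ∧
      (∀ t, 0 ≤ t → ‖U t‖ ≤ C) ∧
      ∀ t, 0 ≤ t → ‖U t‖ ≤ M * Real.exp γ *
        (‖U₀‖ + ∫ s in (0 : ℝ)..τ, Real.exp (w * s) * |k s| * ‖g s‖) *
          Real.exp (-(w - w' - M * l) * t) := by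
  have hMc : ∀ t, 0 ≤ t → ‖S t‖ ≤ M := fun t ht => (hM t ht).trans
    (mul_le_of_le_one_right hM0 (Real.exp_le_one_iff.2 (by nlinarith)))
  have hbc : Continuous b := (LipschitzWith.of_dist_le_mul (K := ⟨β, hβ⟩) fun x y => by
    rw [dist_eq_norm, dist_eq_norm]; exact hb x y).continuous
  have hb' : ∀ x, ‖b x‖ ≤ β * ‖x‖ := fun x => by simpa [hb0] using hb x 0
  -- The truncated source is globally Lipschitz, so the fixed point exists for all times. Since the
  -- projection does not increase norms and `F 0 = 0`, the growth bound `‖F' x‖ ≤ l‖x‖` keeps the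
  -- constant `l`, and the decay estimate applies to the truncated problem with its full rate.
  let F' : X → X := fun x => F (radialProj C x)
  have hF' : ∀ x y, ‖F' x - F' y‖ ≤ (l * 2) * ‖x - y‖ := by
    intro x y
    refine (hF _ _ (norm_radialProj_le hC x) (norm_radialProj_le hC y)).trans ?_
    rw [mul_assoc]
    exact mul_le_mul_of_nonneg_left (norm_radialProj_sub_le hC x y) hl
  have hF'c : Continuous F' := (LipschitzWith.of_dist_le_mul (K := ⟨l * 2, by positivity⟩)
    fun x y => by rw [dist_eq_norm, dist_eq_norm]; exact hF' x y).continuous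
  have hF'l : ∀ x, ‖F' x‖ ≤ l * ‖x‖ := by
    intro x
    have := hF (radialProj C x) 0 (norm_radialProj_le hC x) (by simpa using hC.le)
    rw [hF0, sub_zero, sub_zero] at this
    exact this.trans (mul_le_mul_of_nonneg_left (norm_radialProj_le_norm hC x) hl)
  obtain ⟨U, hU, hUfix⟩ := exists_volterra_fixedPoint
    (volterraKernel_locallyIntegrableOn hτ hk (M * β) (M * (l * 2)))
    (fun s _ => volterraKernel_nonneg (by positivity) (by positivity) s)
    (duhamel S b τ k F' U₀ g)
    (fun U hU => (hS.continuousOn hMc U₀).add (hS.continuousOn_conv hMc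
      (locallyIntegrableOn_Ici_of_intervalIntegrable fun T hT =>
        intervalIntegrable_forcing hτ hk hbc hg hT.le (hU.mono Icc_subset_Ici_self)
          (hF'c.comp_continuousOn (hU.mono Icc_subset_Ici_self)))))
    (fun U V hU hV t ht => norm_duhamel_sub_le hMc hS hτ hk hβ hb hg ht
      (hU.mono Icc_subset_Ici_self) (hV.mono Icc_subset_Ici_self)
      (hF'c.comp_continuousOn (hU.mono Icc_subset_Ici_self))
      (hF'c.comp_continuousOn (hV.mono Icc_subset_Ici_self)) fun s _ => hF' _ _)
  have hdecay : ∀ t, 0 ≤ t → ‖U t‖ ≤ M * Real.exp γ *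
        (‖U₀‖ + ∫ s in (0 : ℝ)..τ, Real.exp (w * s) * |k s| * ‖g s‖) *
          Real.exp (-(w - w' - M * l) * t) := fun t ht =>
    norm_le_of_duhamel hM hM0 hτ hk hβ hbc hb' hg hl hγ hU (hF'c.comp_continuousOn hU)
      (fun s _ => hF'l _) (fun t ht => (hUfix ht).symm) ht
  -- The decay bound and `hsmall` confine the solution to the ball of radius `C`, where `F'` and `F`
  -- agree.
  have hUC : ∀ t, 0 ≤ t → ‖U t‖ ≤ C := by
    intro t ht
    have hI0 : 0 ≤ ∫ s in (0 : ℝ)..τ, Real.exp (w * s) * |k s| * ‖g s‖ :=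
      intervalIntegral.integral_nonneg hτ fun s _ => by positivity
    refine (hdecay t ht).trans (le_trans (mul_le_of_le_one_right (by positivity) ?_) hsmall)
    exact Real.exp_le_one_iff.2 (by nlinarith)
  refine ⟨U, hU, fun t ht => ?_, hUC, hdecay⟩
  rw [← hUfix ht]
  simp only [duhamel]
  congr 1
  refine intervalIntegral.integral_congr fun s hs => ?_
  rw [uIcc_of_le ht] at hs
  simp only [F', radialProj_eq_self hC (hUC s hs.1)]

end DelayProblem

/-- The Cauchy–Schwarz inequality with a weight. -/
theorem norm_sq_integral_smul_le {α E : Type*} [MeasurableSpace α] {ν : Measure α}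
    [NormedAddCommGroup E] [InnerProductSpace ℝ E] [CompleteSpace E] {κ : α → ℝ} {f : α → E}
    (hκ0 : ∀ᵐ x ∂ν, 0 ≤ κ x) (hκ : Integrable κ ν) (hf : Integrable (fun x => κ x • f x) ν)
    (hf2 : Integrable (fun x => κ x * ‖f x‖ ^ 2) ν) :
    ‖∫ x, κ x • f x ∂ν‖ ^ 2 ≤ (∫ x, κ x ∂ν) * ∫ x, κ x * ‖f x‖ ^ 2 ∂ν := by
  set e := ∫ x, κ x • f x ∂ν with he
  have hin : Integrable (fun x => inner ℝ e (κ x • f x)) ν := hf.const_inner e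
  have hine : ∫ x, inner ℝ e (κ x • f x) ∂ν = ‖e‖ ^ 2 := by
    rw [integral_inner hf, ← he, real_inner_self_eq_norm_sq]
  -- Expansion of `∫ κ‖t e - f‖² ≥ 0`, with `e` the integral to be estimated. The discriminant gives
  -- the claim multiplied by `‖e‖²`.
  have hquad : ∀ t : ℝ, 0 ≤ ((∫ x, κ x ∂ν) * ‖e‖ ^ 2) * (t * t) + (-2 * ‖e‖ ^ 2) * t +
      ∫ x, κ x * ‖f x‖ ^ 2 ∂ν := by
    intro t
    have h1 : 0 ≤ ∫ x, (κ x * (t ^ 2 * ‖e‖ ^ 2) - 2 * t * inner ℝ e (κ x • f x) +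
        κ x * ‖f x‖ ^ 2) ∂ν := by
      refine integral_nonneg_of_ae (hκ0.mono fun x hx => ?_)
      have h2 : κ x * (t ^ 2 * ‖e‖ ^ 2) - 2 * t * inner ℝ e (κ x • f x) + κ x * ‖f x‖ ^ 2 =
          κ x * ‖t • e - f x‖ ^ 2 := by
        rw [norm_sub_sq_real, norm_smul, real_inner_smul_left, real_inner_smul_right, mul_pow,
          Real.norm_eq_abs, sq_abs]
        ring
      simp only [Pi.zero_apply]
      rw [h2]
      positivity
    have h3 := integral_add ((hκ.mul_const (t ^ 2 * ‖e‖ ^ 2)).sub (hin.const_mul (2 * t))) hf2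
    have h4 := integral_sub (hκ.mul_const (t ^ 2 * ‖e‖ ^ 2)) (hin.const_mul (2 * t))
    rw [integral_mul_const, integral_const_mul, hine] at h4
    simp only [Pi.sub_apply] at h3
    rw [h3, h4] at h1
    linarith
  have hd := discrim_le_zero hquad
  rw [discrim] at hd
  rcases eq_or_lt_of_le (sq_nonneg ‖e‖) with h | h
  · rw [← h]
    exact mul_nonneg (integral_nonneg_of_ae hκ0)
      (integral_nonneg_of_ae (hκ0.mono fun x hx => by simp only [Pi.zero_apply]; positivity))
  · by_contra hcon
    push Not at hcon
    nlinarith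

/-! ### The memory kernel and integration against it -/

namespace MemoryKernel

variable (K : MemoryKernel)

theorem aemeasurable_μ : AEMeasurable K.μ (volume.restrict (Ioi 0)) :=
  (K.cont.mono Ioi_subset_Ici_self).aemeasurable measurableSet_Ioi

/-- Zeros of the kernel are negligible for the weight, so an element of the memory space is
undetermined there. -/
theorem ae_weight_iff {p : ℝ → Prop} :
    (∀ᵐ s ∂K.weight, p s) ↔ ∀ᵐ s ∂(volume.restrict (Ioi 0)), 0 < K.μ s → p s := by
  rw [weight, ae_withDensity_iff' K.aemeasurable_μ.ennreal_ofReal]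
  simp only [ne_eq, ENNReal.ofReal_eq_zero, not_le]

theorem hasDerivAt {s : ℝ} (hs : 0 < s) : HasDerivAt K.μ (deriv K.μ s) s :=
  ((K.contDiff.differentiableOn one_ne_zero).differentiableAt (Ioi_mem_nhds hs)).hasDerivAt

theorem deriv_nonpos {s : ℝ} (hs : 0 < s) : deriv K.μ s ≤ 0 := by
  obtain ⟨δ, hδ, h⟩ := K.decay
  nlinarith [h s hs, K.nonneg s hs.le]

/-- A zero of a nonnegative function is a minimum. Hence integrals against `-μ'` do not see the
points where an element of the memory space is undetermined. -/
theorem deriv_eq_zero {s : ℝ} (hs : 0 < s) (h : K.μ s = 0) : deriv K.μ s = 0 := by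
  refine IsLocalMin.deriv_eq_zero ?_
  filter_upwards [Ioi_mem_nhds hs] with r hr
  rw [h]
  exact K.nonneg r (le_of_lt hr)

theorem antitoneOn : AntitoneOn K.μ (Ici 0) := by
  refine antitoneOn_of_deriv_nonpos (convex_Ici 0) K.cont ?_ ?_
  · rw [interior_Ici]
    exact fun s hs => (K.hasDerivAt hs).differentiableAt.differentiableWithinAt
  · rw [interior_Ici]
    exact fun s hs => K.deriv_nonpos hs

/-- The decay condition says that `e^{δs} μ(s)` is nonincreasing. -/
theorem tendsto_zero : Tendsto K.μ atTop (𝓝 0) := by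
  obtain ⟨δ, hδ, h⟩ := K.decay
  have hd : ∀ s, 0 < s → HasDerivAt (fun s => Real.exp (δ * s) * K.μ s)
      (Real.exp (δ * s) * δ * K.μ s + Real.exp (δ * s) * deriv K.μ s) s := by
    intro s hs
    have h1 : HasDerivAt (fun t => Real.exp (δ * t)) (Real.exp (δ * s) * δ) s := by
      simpa using ((hasDerivAt_id s).const_mul δ).exp
    exact h1.mul (K.hasDerivAt hs)
  have hanti : AntitoneOn (fun s => Real.exp (δ * s) * K.μ s) (Ici 0) := by
    refine antitoneOn_of_deriv_nonpos (convex_Ici 0) (ContinuousOn.mul (by fun_prop) K.cont) ?_ ?_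
    · rw [interior_Ici]
      exact fun s hs => (hd s hs).differentiableAt.differentiableWithinAt
    · rw [interior_Ici]
      intro s hs
      rw [(hd s hs).deriv]
      nlinarith [h s hs, Real.exp_pos (δ * s)]
  have hle : ∀ s, 0 ≤ s → K.μ s ≤ K.μ 0 * Real.exp (-(δ * s)) := by
    intro s hs
    have h1 := hanti self_mem_Ici (mem_Ici.2 hs) hs
    simp only [mul_zero, Real.exp_zero, one_mul] at h1
    rw [Real.exp_neg, ← div_eq_mul_inv, le_div_iff₀ (Real.exp_pos _)]
    linarith
  have hlim : Tendsto (fun s => K.μ 0 * Real.exp (-(δ * s))) atTop (𝓝 0) := by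
    have h1 : Tendsto (fun s : ℝ => δ * s) atTop atTop := tendsto_id.const_mul_atTop hδ
    simpa using (Real.tendsto_exp_neg_atTop_nhds_zero.comp h1).const_mul (K.μ 0)
  refine tendsto_of_tendsto_of_tendsto_of_le_of_le' tendsto_const_nhds hlim ?_ ?_
  · filter_upwards [eventually_ge_atTop 0] with s hs using K.nonneg s hs
  · filter_upwards [eventually_ge_atTop 0] with s hs using hle s hs

theorem integrableOn_deriv {a : ℝ} (ha : 0 ≤ a) : IntegrableOn (deriv K.μ) (Ioi a) :=
  integrableOn_Ioi_deriv_of_nonpos ((K.cont a ha).mono (Ici_subset_Ici.2 ha))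
    (fun _ hx => K.hasDerivAt (ha.trans_lt hx)) (fun _ hx => K.deriv_nonpos (ha.trans_lt hx))
    K.tendsto_zero

theorem integral_neg_deriv {a : ℝ} (ha : 0 ≤ a) : ∫ s in Ioi a, -deriv K.μ s = K.μ a := by
  rw [integral_neg, integral_Ioi_of_hasDerivAt_of_nonpos ((K.cont a ha).mono (Ici_subset_Ici.2 ha))
    (fun _ hx => K.hasDerivAt (ha.trans_lt hx)) (fun _ hx => K.deriv_nonpos (ha.trans_lt hx))
    K.tendsto_zero]
  simp

instance : IsFiniteMeasure K.weight :=
  isFiniteMeasure_withDensity_ofReal K.integrable.2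

variable {K} {E : Type*} [NormedAddCommGroup E] [NormedSpace ℝ E]

theorem integral_weight (f : ℝ → E) :
    ∫ s, f s ∂K.weight = ∫ s in Ioi (0 : ℝ), K.μ s • f s := by
  rw [weight, integral_withDensity_eq_integral_toReal_smul₀ K.aemeasurable_μ.ennreal_ofReal
    (Eventually.of_forall fun _ => ENNReal.ofReal_lt_top)]
  refine setIntegral_congr_fun measurableSet_Ioi fun s hs => ?_
  simp only [ENNReal.toReal_ofReal (K.nonneg s (le_of_lt hs))]

theorem integrable_weight_iff {f : ℝ → E} :
    Integrable f K.weight ↔ IntegrableOn (fun s => K.μ s • f s) (Ioi 0) := by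
  rw [weight, integrable_withDensity_iff_integrable_smul₀' K.aemeasurable_μ.ennreal_ofReal
    (Eventually.of_forall fun _ => ENNReal.ofReal_lt_top)]
  refine integrable_congr ((ae_restrict_mem measurableSet_Ioi).mono fun s hs => ?_)
  simp only [ENNReal.toReal_ofReal (K.nonneg s (le_of_lt hs))]

/-- As `μ` is nonincreasing, `μ s > 0` makes it positive on all of `(0, s]`, so Lebesgue null sets
and weight null sets coincide there. -/
theorem ae_Ioc_of_ae_weight {p : ℝ → Prop} (h : ∀ᵐ r ∂K.weight, p r) {s : ℝ} (hs : 0 < K.μ s) :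
    ∀ᵐ r, r ∈ Ioc 0 s → p r := by
  have h1 := (ae_restrict_iff' measurableSet_Ioi).1 (K.ae_weight_iff.1 h)
  filter_upwards [h1] with r hr hrs
  exact hr hrs.1 (hs.trans_le (K.antitoneOn (mem_Ici.2 hrs.1.le)
    (mem_Ici.2 (hrs.1.le.trans hrs.2)) hrs.2))

theorem intervalIntegral_congr_weight {f g : ℝ → E} (h : f =ᵐ[K.weight] g) {s : ℝ} (hs0 : 0 ≤ s)
    (hs : 0 < K.μ s) : ∫ r in (0 : ℝ)..s, f r = ∫ r in (0 : ℝ)..s, g r := by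
  refine intervalIntegral.integral_congr_ae ?_
  rw [uIoc_of_le hs0]
  exact ae_Ioc_of_ae_weight h hs

theorem intervalIntegrable_of_integrable_weight {f : ℝ → E} (hfm : StronglyMeasurable f)
    (hf : Integrable f K.weight) {s : ℝ} (hs0 : 0 ≤ s) (hs : 0 < K.μ s) :
    IntervalIntegrable f volume 0 s := by
  rw [intervalIntegrable_iff_integrableOn_Ioc_of_le hs0]
  have h1 := ((integrable_weight_iff.1 hf).mono_set (show Ioc 0 s ⊆ Ioi 0 from Ioc_subset_Ioi_self)).norm.const_mul
    (K.μ s)⁻¹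
  refine h1.mono' hfm.aestronglyMeasurable
    ((ae_restrict_mem measurableSet_Ioc).mono fun r hr => ?_)
  have h2 : K.μ s ≤ K.μ r :=
    K.antitoneOn (mem_Ici.2 hr.1.le) (mem_Ici.2 (hr.1.le.trans hr.2)) hr.2
  rw [norm_smul, Real.norm_of_nonneg (hs.trans_le h2).le, ← mul_assoc]
  refine le_mul_of_one_le_left (norm_nonneg _) ?_
  rw [inv_mul_eq_div]
  exact (one_le_div hs).2 h2

/-- Integration by parts against the kernel, as an instance of Fubini's theorem for
`μ(s) = ∫ₛ^∞ -μ'(r) dr`. -/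
theorem integral_weight_eq_integral_primitive [CompleteSpace E] {f : ℝ → E}
    (hfm : StronglyMeasurable f) (hf : Integrable f K.weight) :
    IntegrableOn (fun r => (-deriv K.μ r) • ∫ s in (0 : ℝ)..r, f s) (Ioi 0) ∧
    ∫ s, f s ∂K.weight = ∫ r in Ioi (0 : ℝ), (-deriv K.μ r) • ∫ s in (0 : ℝ)..r, f s := by
  set ν : Measure ℝ := volume.restrict (Ioi 0) with hν
  -- The function `-μ'(r) f(s)` on the region `s < r`: integration in `r` first produces `μ(s)
  -- f(s)`, integration in `s` first the primitive of `f`.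
  let h : ℝ × ℝ → E :=
    {z : ℝ × ℝ | z.1 < z.2}.indicator fun z => (-deriv K.μ z.2) • f z.1
  have hmeas : MeasurableSet {z : ℝ × ℝ | z.1 < z.2} := measurableSet_lt measurable_fst measurable_snd
  have hm : AEStronglyMeasurable h (ν.prod ν) := by
    refine AEStronglyMeasurable.indicator ?_ hmeas
    refine AEStronglyMeasurable.smul ?_ ?_
    · exact (((measurable_deriv K.μ).comp measurable_snd).neg).aestronglyMeasurable
    · exact (hfm.comp_measurable measurable_fst).aestronglyMeasurable
  have hrow : ∀ s r, h (s, r) = (Ioi s).indicator (fun r => (-deriv K.μ r) • f s) r := by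
    intro s r; simp [h, indicator]
  have hcol : ∀ s r, h (s, r) = (Iio r).indicator (fun s => (-deriv K.μ r) • f s) s := by
    intro s r; simp [h, indicator]
  have hset : ∀ s, 0 < s → Ioi s ∩ Ioi (0 : ℝ) = Ioi s := fun s hs =>
    inter_eq_left.2 (Ioi_subset_Ioi hs.le)
  have hrowi : ∀ s, 0 < s → Integrable (fun r => h (s, r)) ν := by
    intro s hs
    simp_rw [hrow]
    rw [integrable_indicator_iff measurableSet_Ioi, IntegrableOn, hν,
      Measure.restrict_restrict measurableSet_Ioi, hset s hs]
    exact ((K.integrableOn_deriv hs.le).neg).smul_const (f s)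
  have hrowint : ∀ s, 0 < s → ∫ r, h (s, r) ∂ν = K.μ s • f s := by
    intro s hs
    simp_rw [hrow]
    rw [integral_indicator measurableSet_Ioi, hν, Measure.restrict_restrict measurableSet_Ioi,
      hset s hs, integral_smul_const, K.integral_neg_deriv hs.le]
  have hrownorm : ∀ s, 0 < s → ∫ r, ‖h (s, r)‖ ∂ν = ‖K.μ s • f s‖ := by
    intro s hs
    have e : ∀ r ∈ Ioi (0 : ℝ), ‖h (s, r)‖ = (Ioi s).indicator (fun r => -deriv K.μ r * ‖f s‖) r := by
      intro r hr
      rw [hrow, norm_indicator_eq_indicator_norm]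
      refine congrFun (indicator_congr (fun r hr => ?_)) r
      rw [norm_smul, Real.norm_of_nonneg (neg_nonneg.2 (K.deriv_nonpos (hs.trans hr)))]
    rw [hν, setIntegral_congr_fun measurableSet_Ioi e, integral_indicator measurableSet_Ioi,
      Measure.restrict_restrict measurableSet_Ioi, hset s hs, integral_mul_const,
      K.integral_neg_deriv hs.le, norm_smul, Real.norm_of_nonneg (K.nonneg s hs.le)]
  have hint : Integrable h (ν.prod ν) := by
    rw [integrable_prod_iff hm]
    refine ⟨(ae_restrict_mem measurableSet_Ioi).mono fun s hs => hrowi s hs, ?_⟩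
    exact (integrable_weight_iff.1 hf).norm.congr
      ((ae_restrict_mem measurableSet_Ioi).mono fun s hs => (hrownorm s hs).symm)
  have hcolint : ∀ r, 0 < r → ∫ s, h (s, r) ∂ν = (-deriv K.μ r) • ∫ s in (0 : ℝ)..r, f s := by
    intro r hr
    simp_rw [hcol]
    rw [integral_indicator measurableSet_Iio, hν, Measure.restrict_restrict measurableSet_Iio,
      integral_smul, inter_comm, Ioi_inter_Iio, ← integral_Ioc_eq_integral_Ioo,
      intervalIntegral.integral_of_le hr.le]
  refine ⟨hint.integral_prod_right.congr
    ((ae_restrict_mem measurableSet_Ioi).mono fun r hr => hcolint r hr), ?_⟩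
  rw [integral_weight, ← setIntegral_congr_fun measurableSet_Ioi hrowint,
    ← setIntegral_congr_fun measurableSet_Ioi hcolint]
  exact integral_integral_swap hint

end MemoryKernel

set_option linter.unusedSectionVars false

/-! ### The derivative on the memory space: dissipation identities -/

section Primitive

variable {K : MemoryKernel} {E : Type*} [NormedAddCommGroup E] [InnerProductSpace ℝ E]
  [CompleteSpace E]

/-- `w` is the primitive of `w'` that vanishes at `0`. -/
def HasPrimitive (w w' : Lp E 2 K.weight) : Prop :=
  ∀ᵐ s ∂K.weight, w s = ∫ r in (0 : ℝ)..s, w' r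

theorem Lp_integrable_weight (f : Lp E 2 K.weight) : Integrable f K.weight :=
  (Lp.memLp f).integrable one_le_two

theorem Lp_intervalIntegrable (f : Lp E 2 K.weight) {s : ℝ} (hs0 : 0 ≤ s) (hs : 0 < K.μ s) :
    IntervalIntegrable f volume 0 s :=
  MemoryKernel.intervalIntegrable_of_integrable_weight (Lp.stronglyMeasurable f)
    (Lp_integrable_weight f) hs0 hs

namespace HasPrimitive

theorem ae_eq {w w' : Lp E 2 K.weight} (h : HasPrimitive w w') :
    ∀ᵐ s ∂(volume.restrict (Ioi 0)), 0 < K.μ s → w s = ∫ r in (0 : ℝ)..s, w' r :=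
  K.ae_weight_iff.1 h

theorem of_pos {w w' : Lp E 2 K.weight}
    (h : ∀ᵐ s ∂(volume.restrict (Ioi 0)), 0 < s → 0 < K.μ s → w s = ∫ r in (0 : ℝ)..s, w' r) :
    HasPrimitive w w' := by
  refine K.ae_weight_iff.2 ?_
  filter_upwards [h, ae_restrict_mem measurableSet_Ioi] with s hs hs0 using hs hs0

theorem zero : HasPrimitive (0 : Lp E 2 K.weight) 0 := by
  refine of_pos ?_
  filter_upwards [K.ae_weight_iff.1 (Lp.coeFn_zero E 2 K.weight)] with s h1 hs0 hs
  rw [h1 hs, MemoryKernel.intervalIntegral_congr_weight (Lp.coeFn_zero E 2 K.weight) hs0.le hs]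
  simp

theorem add {w w' z z' : Lp E 2 K.weight} (hw : HasPrimitive w w') (hz : HasPrimitive z z') :
    HasPrimitive (w + z) (w' + z') := by
  refine of_pos ?_
  filter_upwards [hw.ae_eq, hz.ae_eq, K.ae_weight_iff.1 (Lp.coeFn_add w z)] with s h1 h2 h3 hs0 hs
  rw [h3 hs, MemoryKernel.intervalIntegral_congr_weight (Lp.coeFn_add w' z') hs0.le hs,
    Pi.add_apply, h1 hs, h2 hs]
  simp only [Pi.add_apply]
  rw [intervalIntegral.integral_add (Lp_intervalIntegrable _ hs0.le hs)
    (Lp_intervalIntegrable _ hs0.le hs)]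

theorem smul {w w' : Lp E 2 K.weight} (hw : HasPrimitive w w') (c : ℝ) :
    HasPrimitive (c • w) (c • w') := by
  refine of_pos ?_
  filter_upwards [hw.ae_eq, K.ae_weight_iff.1 (Lp.coeFn_smul c w)] with s h1 h3 hs0 hs
  rw [h3 hs, MemoryKernel.intervalIntegral_congr_weight (Lp.coeFn_smul c w') hs0.le hs,
    Pi.smul_apply, h1 hs]
  simp only [Pi.smul_apply]
  rw [intervalIntegral.integral_smul]

/-- The primitive vanishes almost everywhere, hence everywhere by continuity as long as `μ > 0`, and
Lebesgue differentiation recovers `w' = 0`. Rational right end points keep the union of exceptional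
sets null. The wave operator is single-valued for this reason. -/
theorem eq_zero {w' : Lp E 2 K.weight} (h : HasPrimitive 0 w') : w' = 0 := by
  have h0 : ∀ᵐ s ∂(volume.restrict (Ioi 0)), 0 < K.μ s → ∫ r in (0 : ℝ)..s, w' r = 0 := by
    filter_upwards [h.ae_eq, K.ae_weight_iff.1 (Lp.coeFn_zero E 2 K.weight)] with s h1 h2 hs
    rw [← h1 hs, h2 hs, Pi.zero_apply]
  rw [ae_restrict_iff' measurableSet_Ioi] at h0
  have key : ∀ b : ℚ, ∀ᵐ x, x ∈ Ioo (0 : ℝ) b → 0 < K.μ b → w' x = 0 := by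
    intro b
    by_cases hb : (0 : ℝ) < b ∧ 0 < K.μ b
    swap
    · refine Eventually.of_forall fun x hx hb' => ?_
      exact absurd ⟨hx.1.trans hx.2, hb'⟩ hb
    obtain ⟨hb0, hb⟩ := hb
    have hi := Lp_intervalIntegrable w' hb0.le hb
    have hmono : ∀ s ∈ Ioo (0 : ℝ) b, 0 < K.μ s := fun s hs =>
      hb.trans_le (K.antitoneOn (mem_Ici.2 hs.1.le) (mem_Ici.2 hb0.le) hs.2.le)
    have hcont : ContinuousOn (fun s => ∫ r in (0 : ℝ)..s, w' r) (Ioo (0 : ℝ) b) := by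
      have h1 := intervalIntegral.continuousOn_primitive_interval (f := w') (a := 0) (b := b)
        (μ := volume)
        (by rw [uIcc_of_le hb0.le, integrableOn_Icc_iff_integrableOn_Ioc]
            exact (intervalIntegrable_iff_integrableOn_Ioc_of_le hb0.le).1 hi)
      exact h1.mono (by rw [uIcc_of_le hb0.le]; exact Ioo_subset_Icc_self)
    have hzero : EqOn (fun s => ∫ r in (0 : ℝ)..s, w' r) (fun _ => 0) (Ioo (0 : ℝ) b) := by
      refine Measure.eqOn_open_of_ae_eq (μ := volume) ?_ isOpen_Ioo hcont continuousOn_const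
      refine (ae_restrict_iff' measurableSet_Ioo).2 ?_
      filter_upwards [h0] with s hs hs' using hs hs'.1 (hmono s hs')
    filter_upwards [hi.ae_hasDerivAt_integral] with x hx hxb _
    rw [uIcc_of_le hb0.le] at hx
    have h1 := hx (Ioo_subset_Icc_self hxb) 0 ⟨le_rfl, hb0.le⟩
    have h2 : HasDerivAt (fun s => ∫ r in (0 : ℝ)..s, w' r) 0 x :=
      (hasDerivAt_const x (0 : E)).congr_of_eventuallyEq
        (hzero.eventuallyEq_of_mem (Ioo_mem_nhds hxb.1 hxb.2))
    exact h1.unique h2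
  refine Lp.ext ?_
  refine EventuallyEq.trans ?_ (Lp.coeFn_zero E 2 K.weight).symm
  refine K.ae_weight_iff.2 ((ae_restrict_iff' measurableSet_Ioi).2 ?_)
  filter_upwards [ae_all_iff.2 key] with s hs hs0 hμ
  have hev : ∀ᶠ r in 𝓝 s, 0 < K.μ r :=
    ((K.cont.continuousAt (Ici_mem_nhds hs0)).eventually (lt_mem_nhds hμ))
  obtain ⟨ε, hε, hball⟩ := Metric.eventually_nhds_iff.1 hev
  obtain ⟨b, hb1, hb2⟩ := exists_rat_btwn (show s < s + ε by linarith)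
  refine hs b ⟨hs0, hb1⟩ (hball ?_)
  rw [Real.dist_eq, abs_of_pos (by linarith)]
  linarith

/-- The product rule gives `2∫₀ʳ⟨w', w⟩ = ‖w(r)‖²`, without a boundary term as `w(0) = 0`, and
`integral_weight_eq_integral_primitive` passes from the weight `μ` to `-μ'`. -/
theorem inner_eq {w w' : Lp E 2 K.weight} (h : HasPrimitive w w') :
    IntegrableOn (fun r => -deriv K.μ r * ‖w r‖ ^ 2) (Ioi 0) ∧
      2 * inner ℝ w' w = ∫ r in Ioi (0 : ℝ), -deriv K.μ r * ‖w r‖ ^ 2 := by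
  obtain ⟨h1, h2⟩ := MemoryKernel.integral_weight_eq_integral_primitive
    (f := fun s => inner ℝ (w' s) (w s))
    ((Lp.stronglyMeasurable w').inner (Lp.stronglyMeasurable w)) (L2.integrable_inner w' w)
  have hpt : ∀ᵐ r ∂(volume.restrict (Ioi 0)), (-deriv K.μ r) • ∫ s in (0 : ℝ)..r, inner ℝ (w' s) (w s)
      = (1 / 2) * (-deriv K.μ r * ‖w r‖ ^ 2) := by
    filter_upwards [h.ae_eq, ae_restrict_mem measurableSet_Ioi] with r hr hr0
    rcases eq_or_lt_of_le (K.nonneg r (le_of_lt hr0)) with hμ | hμ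
    · rw [K.deriv_eq_zero hr0 hμ.symm]; simp
    · have hi := Lp_intervalIntegrable w' (le_of_lt hr0) hμ
      have e1 : ∫ s in (0 : ℝ)..r, inner ℝ (w' s) (w s) =
          ∫ s in (0 : ℝ)..r, inner ℝ (w' s) (∫ a in (0 : ℝ)..s, w' a) := by
        refine MemoryKernel.intervalIntegral_congr_weight ?_ (le_of_lt hr0) hμ
        have h' : ∀ᵐ s ∂K.weight, w s = ∫ r in (0 : ℝ)..s, w' r := h
        filter_upwards [h'] with s hs
        rw [← hs]
      have e2 := bilin_primitive_eq (innerSL ℝ (E := E)) (le_of_lt hr0) hi hi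
      have e3 : ∀ s, inner ℝ (∫ a in (0 : ℝ)..s, w' a) (w' s) +
          inner ℝ (w' s) (∫ a in (0 : ℝ)..s, w' a) =
          2 * inner ℝ (w' s) (∫ a in (0 : ℝ)..s, w' a) := fun s => by
        rw [real_inner_comm]; ring
      change inner ℝ (∫ s in (0 : ℝ)..r, w' s) (∫ s in (0 : ℝ)..r, w' s) =
        ∫ s in (0 : ℝ)..r, (inner ℝ (∫ a in (0 : ℝ)..s, w' a) (w' s) +
          inner ℝ (w' s) (∫ a in (0 : ℝ)..s, w' a)) at e2
      simp only [e3, real_inner_self_eq_norm_sq] at e2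
      rw [intervalIntegral.integral_const_mul, ← hr hμ] at e2
      rw [e1, e2, smul_eq_mul]
      ring
  have h3 := h1.congr hpt
  refine ⟨(h3.const_mul 2).congr (Eventually.of_forall fun r => by ring), ?_⟩
  rw [L2.inner_def, h2, integral_congr_ae hpt, integral_const_mul]
  ring

theorem le_inner {w w' : Lp E 2 K.weight} (h : HasPrimitive w w') {δ : ℝ}
    (hδ : ∀ s, 0 < s → deriv K.μ s ≤ -δ * K.μ s) : δ * ‖w‖ ^ 2 ≤ 2 * inner ℝ w' w := by
  obtain ⟨h1, h2⟩ := h.inner_eq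
  have e1 : ‖w‖ ^ 2 = ∫ s in Ioi (0 : ℝ), K.μ s * ‖w s‖ ^ 2 := by
    rw [← real_inner_self_eq_norm_sq, L2.inner_def, MemoryKernel.integral_weight]
    simp only [real_inner_self_eq_norm_sq, smul_eq_mul]
  have hi : IntegrableOn (fun s => K.μ s * ‖w s‖ ^ 2) (Ioi 0) := by
    have := MemoryKernel.integrable_weight_iff.1 (L2.integrable_inner (𝕜 := ℝ) w w)
    simpa only [real_inner_self_eq_norm_sq, smul_eq_mul] using this
  rw [e1, h2, ← integral_const_mul]
  refine setIntegral_mono_on (hi.const_mul δ) h1 measurableSet_Ioi fun s hs => ?_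
  have := hδ s hs
  nlinarith [sq_nonneg ‖w s‖]

/-- Integration by parts replaces `∫ μ w'` by `∫ -μ' w`, and the Cauchy–Schwarz inequality for `-μ'
ds`, of total mass `μ(0)`, brings in the dissipation. The mean of `w'` is thus controlled without a
bound on `‖w'‖`. -/
theorem norm_integral_sq_le {w w' : Lp E 2 K.weight} (h : HasPrimitive w w') :
    ‖∫ s, w' s ∂K.weight‖ ^ 2 ≤ K.μ 0 * (2 * inner ℝ w' w) := by
  obtain ⟨h1, h2⟩ := h.inner_eq
  obtain ⟨h3, h4⟩ := MemoryKernel.integral_weight_eq_integral_primitive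
    (Lp.stronglyMeasurable w') (Lp_integrable_weight w')
  have hpt : ∀ᵐ r ∂(volume.restrict (Ioi 0)), (-deriv K.μ r) • ∫ s in (0 : ℝ)..r, w' s =
      (-deriv K.μ r) • w r := by
    filter_upwards [h.ae_eq, ae_restrict_mem measurableSet_Ioi] with r hr hr0
    rcases eq_or_lt_of_le (K.nonneg r (le_of_lt hr0)) with hμ | hμ
    · rw [K.deriv_eq_zero hr0 hμ.symm]; simp
    · rw [hr hμ]
  rw [h4, integral_congr_ae hpt, h2, ← K.integral_neg_deriv le_rfl]
  exact norm_sq_integral_smul_le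
    ((ae_restrict_mem measurableSet_Ioi).mono fun r hr => neg_nonneg.2 (K.deriv_nonpos hr))
    (K.integrableOn_deriv le_rfl).neg (h3.congr hpt) h1

end HasPrimitive

end Primitive

/-! ### The resolvent of the derivative on the memory space -/

section PrimitiveResolvent

variable {K : MemoryKernel} {E : Type*} [NormedAddCommGroup E] [InnerProductSpace ℝ E]
  [CompleteSpace E]

/-- The variation of constants formula for `W' = f - l W`, `W(0) = 0`. -/
theorem exp_conv_eq_integral {f : ℝ → E} {l t : ℝ} (ht : 0 ≤ t)
    (hf : IntervalIntegrable f volume 0 t) :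
    ∫ r in (0 : ℝ)..t, Real.exp (-(l * (t - r))) • f r =
      ∫ s in (0 : ℝ)..t, (f s - l • ∫ r in (0 : ℝ)..s, Real.exp (-(l * (s - r))) • f r) := by
  have hg : IntervalIntegrable (fun r => Real.exp (l * r) • f r) volume 0 t :=
    hf.continuousOn_smul (by fun_prop)
  have hW : ∀ s, ∫ r in (0 : ℝ)..s, Real.exp (-(l * (s - r))) • f r =
      Real.exp (-(l * s)) • ∫ r in (0 : ℝ)..s, Real.exp (l * r) • f r := by
    intro s
    rw [← intervalIntegral.integral_smul]
    refine intervalIntegral.integral_congr fun r _ => ?_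
    simp only [smul_smul, ← Real.exp_add]
    congr 2; ring
  have he : ∀ s, ∫ r in (0 : ℝ)..s, -l * Real.exp (-(l * r)) = Real.exp (-(l * s)) - 1 := by
    intro s
    rw [intervalIntegral.integral_eq_sub_of_hasDerivAt (f := fun r => Real.exp (-(l * r)))]
    · simp
    · intro r _
      have := (((hasDerivAt_id' r).const_mul l).fun_neg).exp
      exact this.congr_deriv (by ring)
    · exact Continuous.intervalIntegrable (by fun_prop) _ _
  -- The scalar factor must be a primitive that vanishes at `0`, hence `e^{-lt} - 1`; the extra `-1`
  -- adds the same integral to both sides, and it cancels at the end.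
  have hb := bilin_primitive_eq (ContinuousLinearMap.lsmul ℝ ℝ (E := E)) ht
    (f := fun r => -l * Real.exp (-(l * r)))
    (Continuous.intervalIntegrable (by fun_prop) _ _) hg
  simp only [he, ContinuousLinearMap.lsmul_apply] at hb
  have hpt : ∀ s, (Real.exp (-(l * s)) - 1) • Real.exp (l * s) • f s +
      (-l * Real.exp (-(l * s))) • (∫ r in (0 : ℝ)..s, Real.exp (l * r) • f r) =
      (f s - l • ∫ r in (0 : ℝ)..s, Real.exp (-(l * (s - r))) • f r) -
        Real.exp (l * s) • f s := by
    intro s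
    rw [hW, sub_smul, smul_smul, ← Real.exp_add, neg_add_cancel, Real.exp_zero]
    module
  simp_rw [hpt] at hb
  have hi : IntervalIntegrable
      (fun s => f s - l • ∫ r in (0 : ℝ)..s, Real.exp (-(l * (s - r))) • f r) volume 0 t := by
    refine hf.sub ?_
    simp_rw [hW]
    refine ContinuousOn.intervalIntegrable ?_
    refine continuousOn_const.smul (ContinuousOn.smul (by fun_prop) ?_)
    refine intervalIntegral.continuousOn_primitive_interval ?_
    rw [uIcc_of_le ht, integrableOn_Icc_iff_integrableOn_Ioc]
    exact (intervalIntegrable_iff_integrableOn_Ioc_of_le ht).1 hg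
  rw [intervalIntegral.integral_sub hi hg, sub_smul, one_smul, sub_left_inj] at hb
  rw [hW, hb]

theorem integral_exp_conv_one_le {l s : ℝ} (hl : 0 < l) :
    ∫ r in (0 : ℝ)..s, Real.exp (-(l * (s - r))) ≤ l⁻¹ := by
  have : ∫ r in (0 : ℝ)..s, Real.exp (-(l * (s - r))) = l⁻¹ - l⁻¹ * Real.exp (-(l * s)) := by
    rw [intervalIntegral.integral_eq_sub_of_hasDerivAt
      (f := fun r => l⁻¹ * Real.exp (-(l * (s - r))))]
    · simp
    · intro r _
      have := ((((hasDerivAt_id' r).const_sub s).const_mul l).fun_neg).exp.const_mul l⁻¹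
      exact this.congr_deriv (by field_simp)
    · exact Continuous.intervalIntegrable (by fun_prop) _ _
  rw [this]
  have := Real.exp_pos (-(l * s))
  have := inv_pos.2 hl
  nlinarith [mul_pos this (Real.exp_pos (-(l * s)))]

/-- A weighted form of Young's inequality. The Cauchy–Schwarz inequality for the exponential, of
mass at most `1/l`, and `μ(s) ≤ μ(r)` for `r ≤ s` bound `μ‖W‖²` by `1/l` times the convolution of
the integrable functions `μ‖q‖²` and `e^{-l·}`. -/
theorem memLp_exp_conv (q : Lp E 2 K.weight) {l : ℝ} (hl : 0 < l) :
    ∃ W : ℝ → E, StronglyMeasurable W ∧ MemLp W 2 K.weight ∧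
      ∀ s, 0 < s → W s = ∫ r in (0 : ℝ)..s, Real.exp (-(l * (s - r))) • q r := by
  have hqm := Lp.stronglyMeasurable q
  let h : ℝ × ℝ → E := {z : ℝ × ℝ | z.2 ≤ z.1}.indicator fun z => Real.exp (-(l * (z.1 - z.2))) • q z.2
  have hm : StronglyMeasurable h := by
    refine StronglyMeasurable.indicator ?_ (measurableSet_le measurable_snd measurable_fst)
    exact (by fun_prop : Continuous fun z : ℝ × ℝ => Real.exp (-(l * (z.1 - z.2)))).stronglyMeasurable.smul
      (hqm.comp_measurable measurable_snd)
  let W : ℝ → E := fun s => ∫ r in Ioi (0 : ℝ), h (s, r)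
  have hWm : StronglyMeasurable W := StronglyMeasurable.integral_prod_right' hm
  have hW : ∀ s, 0 < s → W s = ∫ r in (0 : ℝ)..s, Real.exp (-(l * (s - r))) • q r := by
    intro s hs
    have e : ∀ r, h (s, r) = (Iic s).indicator (fun r => Real.exp (-(l * (s - r))) • q r) r := by
      intro r; simp [h, indicator]
    simp only [W, e]
    rw [integral_indicator measurableSet_Iic, Measure.restrict_restrict measurableSet_Iic,
      inter_comm, Ioi_inter_Iic, intervalIntegral.integral_of_le hs.le]
  refine ⟨W, hWm, ?_, hW⟩
  rw [memLp_two_iff_integrable_sq_norm hWm.aestronglyMeasurable]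
  rw [MemoryKernel.integrable_weight_iff]
  let φ : ℝ → ℝ := (Ioi (0 : ℝ)).indicator fun r => K.μ r * ‖q r‖ ^ 2
  let e : ℝ → ℝ := (Ici (0 : ℝ)).indicator fun r => Real.exp (-(l * r))
  have hφi : IntegrableOn (fun s => K.μ s * ‖q s‖ ^ 2) (Ioi 0) := by
    have := MemoryKernel.integrable_weight_iff.1 (L2.integrable_inner (𝕜 := ℝ) q q)
    simpa only [real_inner_self_eq_norm_sq, smul_eq_mul] using this
  have hφ : Integrable φ volume := (integrable_indicator_iff measurableSet_Ioi).2 hφi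
  have he : Integrable e volume := by
    refine (integrable_indicator_iff measurableSet_Ici).2 ?_
    rw [integrableOn_Ici_iff_integrableOn_Ioi]
    simpa only [neg_mul] using integrableOn_exp_mul_Ioi (neg_lt_zero.2 hl) 0
  have hconv : Integrable (fun s => l⁻¹ * ∫ r, φ r * e (s - r)) volume :=
    (hφ.integrable_convolution (ContinuousLinearMap.mul ℝ ℝ) he).const_mul _
  have hφ0 : ∀ r, 0 ≤ φ r := fun r => indicator_nonneg (fun r hr =>
    mul_nonneg (K.nonneg r (le_of_lt hr)) (sq_nonneg _)) r
  have he0 : ∀ r, 0 ≤ e r := fun r => indicator_nonneg (fun r _ => (Real.exp_pos _).le) r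
  have hci : ∀ᵐ s, Integrable (fun r => φ r * e (s - r)) volume :=
    hφ.ae_convolution_exists (ContinuousLinearMap.mul ℝ ℝ) he
  refine hconv.integrableOn.mono' ?_ ?_
  · exact K.aemeasurable_μ.aestronglyMeasurable.smul
      ((hWm.norm.pow 2).aestronglyMeasurable)
  · filter_upwards [ae_restrict_mem measurableSet_Ioi, ae_restrict_of_ae hci] with s hs hsi
    have hs0 : 0 < s := hs
    have hR : 0 ≤ ∫ r, φ r * e (s - r) := integral_nonneg fun r => mul_nonneg (hφ0 r) (he0 _)
    rw [smul_eq_mul, Real.norm_of_nonneg (mul_nonneg (K.nonneg s hs0.le) (sq_nonneg _))]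
    rcases eq_or_lt_of_le (K.nonneg s hs0.le) with hμ | hμ
    · rw [← hμ, zero_mul]
      exact mul_nonneg (inv_pos.2 hl).le hR
    set ν : Measure ℝ := volume.restrict (Ioc 0 s) with hν
    have hqi := Lp_intervalIntegrable q hs0.le hμ
    have hq2i : IntervalIntegrable (fun r => ‖q r‖ ^ 2) volume 0 s := by
      refine MemoryKernel.intervalIntegrable_of_integrable_weight (f := fun r => ‖q r‖ ^ 2) (hqm.norm.pow 2) ?_ hs0.le hμ
      simpa only [real_inner_self_eq_norm_sq] using L2.integrable_inner (𝕜 := ℝ) q q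
    have hcs := norm_sq_integral_smul_le (ν := ν) (κ := fun r => Real.exp (-(l * (s - r))))
      (f := q) (Eventually.of_forall fun r => (Real.exp_pos _).le)
      ((intervalIntegrable_iff_integrableOn_Ioc_of_le hs0.le).1
        (Continuous.intervalIntegrable (by fun_prop) _ _))
      ((intervalIntegrable_iff_integrableOn_Ioc_of_le hs0.le).1
        (hqi.continuousOn_smul (by fun_prop)))
      ((intervalIntegrable_iff_integrableOn_Ioc_of_le hs0.le).1
        (hq2i.continuousOn_mul (by fun_prop)))
    have h1 : ∫ r, Real.exp (-(l * (s - r))) ∂ν ≤ l⁻¹ := by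
      rw [hν, ← intervalIntegral.integral_of_le hs0.le]
      exact integral_exp_conv_one_le hl
    have h2 : 0 ≤ ∫ r, Real.exp (-(l * (s - r))) * ‖q r‖ ^ 2 ∂ν :=
      integral_nonneg fun r => by positivity
    have h3 : ‖W s‖ ^ 2 ≤ l⁻¹ * ∫ r, Real.exp (-(l * (s - r))) * ‖q r‖ ^ 2 ∂ν := by
      rw [hW s hs0, intervalIntegral.integral_of_le hs0.le]
      exact hcs.trans (mul_le_mul_of_nonneg_right h1 h2)
    have h4 : K.μ s * ∫ r, Real.exp (-(l * (s - r))) * ‖q r‖ ^ 2 ∂ν ≤ ∫ r, φ r * e (s - r) := by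
      rw [← integral_const_mul]
      refine le_trans ?_ (setIntegral_le_integral (s := Ioc 0 s) hsi
        (Eventually.of_forall fun r => mul_nonneg (hφ0 r) (he0 _)))
      refine setIntegral_mono_on ?_ hsi.integrableOn measurableSet_Ioc fun r hr => ?_
      · exact ((intervalIntegrable_iff_integrableOn_Ioc_of_le hs0.le).1
          (hq2i.continuousOn_mul (by fun_prop))).const_mul _
      · have h5 : K.μ s ≤ K.μ r :=
          K.antitoneOn (mem_Ici.2 hr.1.le) (mem_Ici.2 (hr.1.le.trans hr.2)) hr.2
        have h6 : φ r = K.μ r * ‖q r‖ ^ 2 := indicator_of_mem (show r ∈ Ioi (0 : ℝ) from hr.1) _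
        have h7 : e (s - r) = Real.exp (-(l * (s - r))) :=
          indicator_of_mem (show s - r ∈ Ici (0 : ℝ) from sub_nonneg.2 hr.2) _
        rw [h6, h7]
        have := mul_le_mul_of_nonneg_right h5
          (by positivity : 0 ≤ Real.exp (-(l * (s - r))) * ‖q r‖ ^ 2)
        linarith
    calc K.μ s * ‖W s‖ ^ 2
        ≤ K.μ s * (l⁻¹ * ∫ r, Real.exp (-(l * (s - r))) * ‖q r‖ ^ 2 ∂ν) :=
          mul_le_mul_of_nonneg_left h3 hμ.le
      _ = l⁻¹ * (K.μ s * ∫ r, Real.exp (-(l * (s - r))) * ‖q r‖ ^ 2 ∂ν) := by ring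
      _ ≤ l⁻¹ * ∫ r, φ r * e (s - r) := mul_le_mul_of_nonneg_left h4 (inv_pos.2 hl).le

/-- The equation `w' + l w = q`, `w(0) = 0`, has a solution in the memory space. -/
theorem exists_hasPrimitive (q : Lp E 2 K.weight) {l : ℝ} (hl : 0 < l) :
    ∃ w : Lp E 2 K.weight, HasPrimitive w (q - l • w) := by
  obtain ⟨W, hWm, hWL, hW⟩ := memLp_exp_conv q hl
  refine ⟨hWL.toLp W, HasPrimitive.of_pos ?_⟩
  have hwW : (hWL.toLp W : ℝ → E) =ᵐ[K.weight] W := hWL.coeFn_toLp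
  filter_upwards [K.ae_weight_iff.1 hwW] with s h1 hs0 hs
  rw [h1 hs, hW s hs0, exp_conv_eq_integral hs0.le (Lp_intervalIntegrable q hs0.le hs)]
  have h2 : ((q - l • hWL.toLp W : Lp E 2 K.weight) : ℝ → E) =ᵐ[K.weight] fun s => q s - l • W s := by
    filter_upwards [hwW, Lp.coeFn_sub q (l • hWL.toLp W), Lp.coeFn_smul l (hWL.toLp W)]
      with s e1 e2 e3
    rw [e2, Pi.sub_apply, e3, Pi.smul_apply, e1]
  rw [MemoryKernel.intervalIntegral_congr_weight h2 hs0.le hs]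
  refine intervalIntegral.integral_congr_ae (Eventually.of_forall fun r hr => ?_)
  rw [uIoc_of_le hs0.le] at hr
  rw [hW r hr.1]

/-- The solution of `w' + l w = v`, `w(0) = 0`, for constant `v`. -/
theorem exists_hasPrimitive_const (K : MemoryKernel) {l : ℝ} (hl : 0 < l) :
    ∃ c : ℝ, 0 ≤ c ∧ ∀ v : E, ∃ w w' : Lp E 2 K.weight, HasPrimitive w w' ∧
      (∀ᵐ s ∂K.weight, w' s = v - l • w s) ∧ ∫ s, w s ∂K.weight = c • v := by
  obtain ⟨θ, hθ⟩ := exists_hasPrimitive (K := K) (Lp.const 2 K.weight (1 : ℝ)) hl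
  set θ' := Lp.const 2 K.weight (1 : ℝ) - l • θ with hθ'
  have hθ'e : ∀ᵐ s ∂K.weight, θ' s = 1 - l * θ s := by
    filter_upwards [Lp.coeFn_sub (Lp.const 2 K.weight (1 : ℝ)) (l • θ), Lp.coeFn_smul l θ,
      Lp.coeFn_const 2 K.weight (1 : ℝ)] with s e1 e2 e3
    rw [e1, Pi.sub_apply, e2, e3, Pi.smul_apply, smul_eq_mul]
    rfl
  -- The solution for `v` is `θ v`, with `θ` the scalar solution for `1`. Its mean is nonnegative
  -- because `0 ≤ ⟨θ', θ⟩ = ∫ θ - l‖θ‖²`, the integral being taken against the weight.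
  refine ⟨∫ s, θ s ∂K.weight, ?_, fun v => ?_⟩
  · have h0 : 0 ≤ 2 * inner ℝ θ' θ := by
      have := hθ.le_inner (δ := 0) fun s hs => by simpa using K.deriv_nonpos hs
      simpa using this
    have h1 : inner ℝ (Lp.const 2 K.weight (1 : ℝ)) θ = ∫ s, θ s ∂K.weight := by
      rw [L2.inner_def]
      refine integral_congr_ae ?_
      filter_upwards [Lp.coeFn_const 2 K.weight (1 : ℝ)] with s e3
      rw [e3]; simp
    rw [hθ', inner_sub_left, real_inner_smul_left, real_inner_self_eq_norm_sq, h1] at h0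
    nlinarith [sq_nonneg ‖θ‖]
  · let T : ℝ →L[ℝ] E := ContinuousLinearMap.toSpanSingleton ℝ v
    refine ⟨T.compLp θ, T.compLp θ', HasPrimitive.of_pos ?_, ?_, ?_⟩
    · filter_upwards [hθ.ae_eq, K.ae_weight_iff.1 (T.coeFn_compLp θ)] with s h1 h2 hs0 hs
      rw [h2 hs, h1 hs, MemoryKernel.intervalIntegral_congr_weight (T.coeFn_compLp θ') hs0.le hs]
      simp only [T, ContinuousLinearMap.toSpanSingleton_apply]
      rw [intervalIntegral.integral_smul_const]
    · filter_upwards [T.coeFn_compLp θ, T.coeFn_compLp θ', hθ'e] with s h1 h2 h3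
      rw [h1, h2, h3]
      simp only [T, ContinuousLinearMap.toSpanSingleton_apply]
      module
    · rw [integral_congr_ae (T.coeFn_compLp θ)]
      simp only [T, ContinuousLinearMap.toSpanSingleton_apply]
      rw [integral_smul_const]

end PrimitiveResolvent

section

variable {H : Type*} [NormedAddCommGroup H] [InnerProductSpace ℝ H] [CompleteSpace H]

/-! ### The energy space and weak forms of equations with `A` -/

section Energy

variable {A : PosOp H}

theorem energy_inner (u v : Energy A) :
    inner ℝ u v = inner ℝ (HalfDomain.half u) (HalfDomain.half v) := by
  rw [HalfDomain.inner_def]; exact one_mul _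

theorem energy_norm (u : Energy A) : ‖u‖ = ‖HalfDomain.half u‖ := by
  rw [HalfDomain.norm_eq, show ((⟨1, Set.mem_Ioi.2 one_pos⟩ : Ioi (0 : ℝ)) : ℝ) = 1 from rfl,
    Real.sqrt_one, one_mul]

theorem incl_injective {c : Ioi (0 : ℝ)} :
    Function.Injective (HalfDomain.incl : HalfDomain A c →ₗ[ℝ] H) := Subtype.coe_injective

theorem incl_half_mem_graph (u : Energy A) :
    (HalfDomain.incl u, HalfDomain.half u) ∈ A.sqrt.graph := A.sqrt.mem_graph u

theorem exists_energy_of_mem_graph {x y : H} (h : (x, y) ∈ A.sqrt.graph) :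
    ∃ u : Energy A, HalfDomain.incl u = x ∧ HalfDomain.half u = y := by
  obtain ⟨u, hu1, hu2⟩ := (LinearPMap.mem_graph_iff _).1 h
  exact ⟨u, hu1, hu2⟩

theorem sqrt_inner_comm {x y x' y' : H} (h : (x, y) ∈ A.sqrt.graph) (h' : (x', y') ∈ A.sqrt.graph) :
    inner ℝ y x' = inner ℝ x y' := by
  obtain ⟨u, hu1, hu2⟩ := (LinearPMap.mem_graph_iff _).1 h
  obtain ⟨v, hv1, hv2⟩ := (LinearPMap.mem_graph_iff _).1 h'
  have hs := A.sqrt_spec.selfAdjoint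
  have := LinearPMap.adjoint_isFormalAdjoint hs.dense_domain
  rw [LinearPMap.isSelfAdjoint_def.1 hs] at this
  have h := this u v
  simp only at hu1 hu2 hv1 hv2
  rwa [hu1, hu2, hv1, hv2] at h

/-- The weak form of `A z = g`. -/
theorem inner_incl_of_mem_graph {z : Energy A} {g : H} (h : (HalfDomain.incl z, g) ∈ A.op.graph)
    (v : Energy A) : inner ℝ g (HalfDomain.incl v) = inner ℝ z v := by
  obtain ⟨y, hy1, hy2⟩ := (A.sqrt_spec.sq _ _).1 h
  obtain ⟨z', hz1, hz2⟩ := exists_energy_of_mem_graph hy1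
  have : z' = z := incl_injective hz1
  subst this
  rw [energy_inner, hz2]
  exact sqrt_inner_comm hy2 (incl_half_mem_graph v)

/-- With `T = A⁻¹` and the symmetry of `A^{1/2}`, `‖u‖² = ⟨T A^{1/2}u, A^{1/2}u⟩ ≤ ‖T‖ ‖A^{1/2}u‖²`.
-/
theorem exists_norm_incl_le (A : PosOp H) :
    ∃ C : ℝ, ∀ u : Energy A, ‖HalfDomain.incl u‖ ≤ C * ‖u‖ := by
  obtain ⟨T, -, hT⟩ := A.compact_inv
  refine ⟨Real.sqrt ‖T‖, fun u => ?_⟩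
  obtain ⟨y, hy1, hy2⟩ := (A.sqrt_spec.sq _ _).1 ((hT (T (HalfDomain.half u)) _).2 rfl)
  have hyu : y = HalfDomain.incl u := by
    obtain ⟨z, hz1, hz2⟩ := exists_energy_of_mem_graph hy2
    rw [← hz1]
    congr 1
    have h0 : A.sqrt (z - u : A.sqrt.domain) = 0 := by
      have h1 : HalfDomain.half (z - u) = 0 := by rw [map_sub, hz2, sub_self]
      exact h1
    exact sub_eq_zero.1 (A.sqrt_injective _ h0)
  rw [← hyu, energy_norm]
  refine le_of_sq_le_sq ?_ (by positivity)
  rw [mul_pow, Real.sq_sqrt (norm_nonneg _), ← real_inner_self_eq_norm_sq,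
    sqrt_inner_comm hy1 hy2]
  refine (real_inner_le_norm _ _).trans ?_
  nlinarith [T.le_opNorm (HalfDomain.half u), norm_nonneg (HalfDomain.half u)]

/-- The bounded inclusion of `D(A^{1/2})` into `H`. -/
def inclL (A : PosOp H) : Energy A →L[ℝ] H :=
  HalfDomain.incl.mkContinuousOfExistsBound (exists_norm_incl_le A)

theorem inclL_apply (u : Energy A) : inclL A u = HalfDomain.incl u := rfl

/-- Solvability of `A z + β z = g`. -/
theorem exists_add_smul_eq (A : PosOp H) {β : ℝ} (hβ : 0 < β) (g : H) :
    ∃ (z : Energy A) (y : H), (HalfDomain.incl z, y) ∈ A.op.graph ∧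
      y + β • HalfDomain.incl z = g := by
  obtain ⟨T, -, hT⟩ := A.compact_inv
  have hpos : ∀ y, 0 ≤ inner ℝ y (T y) := by
    intro y
    obtain ⟨u, hu1, hu2⟩ := (LinearPMap.mem_graph_iff _).1 ((hT (T y) y).2 rfl)
    have := A.nonneg u
    simp only at hu1 hu2
    rwa [hu1, hu2] at this
  -- Setting `z = T y` with `T = A⁻¹` turns the equation into `y + β T y = g`, which is bounded on
  -- `H` and coercive since `T ≥ 0`; the Lax–Milgram theorem solves it.
  let B : H →L[ℝ] H →L[ℝ] ℝ := (innerSL ℝ : H →L[ℝ] H →L[ℝ] ℝ).comp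
    (ContinuousLinearMap.id ℝ H + β • T)
  have hB : ∀ x y, B x y = inner ℝ (x + β • T x) y := fun x y => rfl
  have hco : IsCoercive B := by
    refine ⟨1, one_pos, fun u => ?_⟩
    rw [hB, inner_add_left, real_inner_smul_left, real_inner_self_eq_norm_sq, real_inner_comm]
    nlinarith [mul_nonneg hβ.le (hpos u)]
  obtain ⟨y, hy⟩ := hco.continuousLinearEquivOfBilin.surjective g
  have hy' : y + β • T y = g := by
    refine ext_inner_right ℝ fun w => ?_
    rw [← hB, ← hy, hco.continuousLinearEquivOfBilin_apply]
  have hg := (hT (T y) y).2 rfl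
  obtain ⟨x, hx1, -⟩ := (A.sqrt_spec.sq _ _).1 hg
  obtain ⟨z, hz, -⟩ := exists_energy_of_mem_graph hx1
  exact ⟨z, y, by rw [hz]; exact hg, by rw [hz]; exact hy'⟩

end Energy

/-! ### The phase space and its components -/

section PhaseSpace

variable {A : PosOp H} {K : MemoryKernel}

/-- The Lyapunov functional damps position and velocity at rates proportional to the mass, so the
mass has to be positive; `μ(0) > 0` and continuity ensure this. -/
theorem MemoryKernel.mass_pos (K : MemoryKernel) : 0 < K.mass := by
  have h1 : ∀ᶠ s in 𝓝[≥] (0 : ℝ), 0 < K.μ s :=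
    (K.cont 0 self_mem_Ici).eventually (lt_mem_nhds K.pos_zero)
  obtain ⟨s, hs, hs0⟩ := ((h1.filter_mono (nhdsWithin_mono _ Ioi_subset_Ici_self)).and
    (self_mem_nhdsWithin (a := (0 : ℝ)) (s := Ioi 0))).exists
  have hs0 : 0 < s := hs0
  have h2 : ∫ r in Ioc 0 s, K.μ s ≤ ∫ r in Ioc 0 s, K.μ r :=
    setIntegral_mono_on (integrable_const _) (K.integrable.mono_set Ioc_subset_Ioi_self)
      measurableSet_Ioc fun r hr => K.antitoneOn (mem_Ici.2 hr.1.le) (mem_Ici.2 hs0.le) hr.2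
  have h3 : ∫ r in Ioc 0 s, K.μ r ≤ K.mass :=
    setIntegral_mono_set K.integrable ((ae_restrict_mem measurableSet_Ioi).mono fun r hr =>
      K.nonneg r (le_of_lt hr)) (Ioc_subset_Ioi_self.eventuallyLE)
  rw [setIntegral_const, Real.volume_real_Ioc_of_le hs0.le, sub_zero, smul_eq_mul] at h2
  have := mul_pos hs0 hs
  linarith

theorem integral_one_weight : ∫ _s, (1 : ℝ) ∂K.weight = K.mass := by
  rw [MemoryKernel.integral_weight]
  simp [MemoryKernel.mass]

section Integral

variable {E : Type*} [NormedAddCommGroup E] [InnerProductSpace ℝ E] [CompleteSpace E]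

theorem norm_sq_integral_weight_le (w : Lp E 2 K.weight) :
    ‖∫ s, w s ∂K.weight‖ ^ 2 ≤ K.mass * ‖w‖ ^ 2 := by
  have h := norm_sq_integral_smul_le (ν := K.weight) (κ := fun _ => 1) (f := w)
    (Eventually.of_forall fun _ => zero_le_one) (integrable_const _)
    (by simpa using Lp_integrable_weight w)
    (by simpa using L2.integrable_inner (𝕜 := ℝ) w w)
  rw [integral_one_weight] at h
  have e : ∫ s, 1 * ‖w s‖ ^ 2 ∂K.weight = ‖w‖ ^ 2 := by
    rw [← real_inner_self_eq_norm_sq, L2.inner_def]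
    simp only [one_mul, real_inner_self_eq_norm_sq]
  rw [e] at h
  simpa using h

/-- The operator `w ↦ ∫₀^∞ μ(s) w(s) ds`. -/
def integralL (K : MemoryKernel) (E : Type*) [NormedAddCommGroup E] [InnerProductSpace ℝ E]
    [CompleteSpace E] : Lp E 2 K.weight →L[ℝ] E :=
  LinearMap.mkContinuous
    { toFun := fun w => ∫ s, w s ∂K.weight
      map_add' := fun w z => by
        rw [integral_congr_ae (Lp.coeFn_add w z)]
        exact integral_add (Lp_integrable_weight w) (Lp_integrable_weight z)
      map_smul' := fun c w => by
        rw [integral_congr_ae (Lp.coeFn_smul c w)]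
        exact integral_smul c _ } (Real.sqrt K.mass) fun w => by
    refine le_of_sq_le_sq ?_ (by positivity)
    rw [mul_pow, Real.sq_sqrt K.mass_pos.le]
    exact norm_sq_integral_weight_le w

theorem integralL_apply (w : Lp E 2 K.weight) : integralL K E w = ∫ s, w s ∂K.weight := rfl

theorem integralL_const (v : E) : integralL K E (Lp.const 2 K.weight v) = K.mass • v := by
  rw [integralL_apply, integral_congr_ae (Lp.coeFn_const 2 K.weight v), ← integral_one_weight,
    ← integral_smul_const]
  simp

theorem inner_const (v : E) (w : Lp E 2 K.weight) :
    inner ℝ (Lp.const 2 K.weight v) w = inner ℝ v (integralL K E w) := by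
  rw [L2.inner_def, integralL_apply, ← integral_inner (Lp_integrable_weight w)]
  refine integral_congr_ae ?_
  filter_upwards [Lp.coeFn_const 2 K.weight v] with s hs
  rw [hs]; rfl

end Integral

namespace Phase

theorem pos_add (U V : Phase A K) : (U + V).pos = U.pos + V.pos := rfl

theorem pos_smul (c : ℝ) (U : Phase A K) : (c • U).pos = c • U.pos := rfl

theorem vel_add (U V : Phase A K) : (U + V).vel = U.vel + V.vel := rfl

theorem vel_sub (U V : Phase A K) : (U - V).vel = U.vel - V.vel := rfl

theorem vel_smul (c : ℝ) (U : Phase A K) : (c • U).vel = c • U.vel := rfl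

theorem mem_add (U V : Phase A K) : (U + V).mem = U.mem + V.mem := rfl

theorem mem_sub (U V : Phase A K) : (U - V).mem = U.mem - V.mem := rfl

theorem mem_smul (c : ℝ) (U : Phase A K) : (c • U).mem = c • U.mem := rfl

theorem pos_mk (u : Energy A) (v : H) (w : MemorySpace A K) : (mk u v w).pos = u := rfl

theorem vel_mk (u : Energy A) (v : H) (w : MemorySpace A K) : (mk u v w).vel = v := rfl

theorem mem_mk (u : Energy A) (v : H) (w : MemorySpace A K) : (mk u v w).mem = w := rfl

end Phase

theorem Phase.norm_sq (U : Phase A K) :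
    ‖U‖ ^ 2 = (1 - K.mass) * ‖U.pos‖ ^ 2 + (‖U.vel‖ ^ 2 + ‖U.mem‖ ^ 2) := by
  rw [← real_inner_self_eq_norm_sq, Phase.inner_eq, energy_norm]
  simp only [real_inner_self_eq_norm_sq]

theorem gap_pos (K : MemoryKernel) : 0 < 1 - K.mass := sub_pos.2 K.mass_lt_one

/-- The position component, as a bounded operator. -/
def Phase.posL (A : PosOp H) (K : MemoryKernel) : Phase A K →L[ℝ] Energy A :=
  LinearMap.mkContinuous
    { toFun := Phase.pos
      map_add' := Phase.pos_add
      map_smul' := Phase.pos_smul } (Real.sqrt (1 - K.mass))⁻¹ fun U => by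
    refine le_of_sq_le_sq ?_ (by positivity)
    have h := gap_pos K
    rw [mul_pow, inv_pow, Real.sq_sqrt h.le, inv_mul_eq_div, le_div_iff₀ h, Phase.norm_sq]
    change ‖U.pos‖ ^ 2 * (1 - K.mass) ≤ _
    nlinarith [sq_nonneg ‖U.vel‖, sq_nonneg ‖U.mem‖]

/-- The velocity component, as a bounded operator. -/
def Phase.velL (A : PosOp H) (K : MemoryKernel) : Phase A K →L[ℝ] H :=
  LinearMap.mkContinuous
    { toFun := Phase.vel
      map_add' := Phase.vel_add
      map_smul' := Phase.vel_smul } 1 fun U => by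
    refine le_of_sq_le_sq ?_ (by positivity)
    have h := gap_pos K
    rw [one_mul, Phase.norm_sq]
    change ‖U.vel‖ ^ 2 ≤ _
    nlinarith [mul_nonneg h.le (sq_nonneg ‖U.pos‖), sq_nonneg ‖U.mem‖]

/-- The memory component, as a bounded operator. -/
def Phase.memL (A : PosOp H) (K : MemoryKernel) : Phase A K →L[ℝ] MemorySpace A K :=
  LinearMap.mkContinuous
    { toFun := Phase.mem
      map_add' := Phase.mem_add
      map_smul' := Phase.mem_smul } 1 fun U => by
    refine le_of_sq_le_sq ?_ (by positivity)
    have h := gap_pos K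
    rw [one_mul, Phase.norm_sq]
    change ‖U.mem‖ ^ 2 ≤ _
    nlinarith [mul_nonneg h.le (sq_nonneg ‖U.pos‖), sq_nonneg ‖U.vel‖]

end PhaseSpace

/-! ### The wave operator as a linear relation -/

section WaveOperator

variable {A : PosOp H} {K : MemoryKernel}

/-- With the bounded operators `integralL` and `Lp.const`, the pointwise conditions become
identities in the memory space that can be added, scaled and paired. -/
theorem waveGraph_iff (U Z : Phase A K) : WaveGraph U Z ↔
    ∃ (v : Energy A) (w' : MemorySpace A K), HalfDomain.incl v = U.vel ∧ HasPrimitive U.mem w' ∧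
      Z.pos = v ∧
      (HalfDomain.incl ((1 - K.mass) • U.pos + integralL K _ U.mem), -Z.vel) ∈ A.op.graph ∧
      Z.mem = -w' + Lp.const 2 K.weight v := by
  unfold WaveGraph
  simp only [← MemoryKernel.integral_weight]
  have hm : ∀ (v : Energy A) (w' : MemorySpace A K),
      (∀ᵐ s ∂K.weight, Z.mem s = -w' s + v) ↔ Z.mem = -w' + Lp.const 2 K.weight v := by
    intro v w'
    have hc : ((-w' + Lp.const 2 K.weight v : MemorySpace A K) : ℝ → Energy A) =ᵐ[K.weight]
        fun s => -w' s + v := by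
      filter_upwards [Lp.coeFn_add (-w') (Lp.const 2 K.weight v), Lp.coeFn_neg w',
        Lp.coeFn_const 2 K.weight v] with s h1 h2 h3
      rw [h1, Pi.add_apply, h2, h3]; rfl
    constructor
    · intro h
      exact Lp.ext (EventuallyEq.trans h hc.symm)
    · intro h
      rw [h]; exact hc
  simp only [hm]
  rfl

/-- The graph of the wave operator, as a subspace. -/
def waveSubmodule (A : PosOp H) (K : MemoryKernel) : Submodule ℝ (Phase A K × Phase A K) where
  carrier := {p | WaveGraph p.1 p.2}
  zero_mem' := by
    refine (waveGraph_iff _ _).2 ⟨0, 0, map_zero _, HasPrimitive.zero, rfl, ?_, ?_⟩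
    · change (HalfDomain.incl ((1 - K.mass) • (0 : Energy A) + integralL K _ 0), -(0 : H)) ∈ _
      simp
    · change (0 : MemorySpace A K) = _
      rw [show Lp.const 2 K.weight (0 : Energy A) = 0 from map_zero (Lp.constₗ 2 K.weight ℝ)]
      simp
  add_mem' := by
    rintro ⟨U, Z⟩ ⟨U', Z'⟩ h h'
    obtain ⟨v, w, h1, h2, h3, h4, h5⟩ := (waveGraph_iff _ _).1 h
    obtain ⟨v', w', h1', h2', h3', h4', h5'⟩ := (waveGraph_iff _ _).1 h'
    refine (waveGraph_iff _ _).2 ⟨v + v', w + w', ?_, h2.add h2', ?_, ?_, ?_⟩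
    · rw [map_add, h1, h1']; rfl
    · rw [← h3, ← h3']; rfl
    · convert A.op.graph.add_mem h4 h4' using 1
      refine Prod.ext ?_ ?_
      · change HalfDomain.incl ((1 - K.mass) • (U.pos + U'.pos) + integralL K _ (U.mem + U'.mem)) =
          HalfDomain.incl _ + HalfDomain.incl _
        rw [← map_add, map_add (integralL K _), smul_add]
        congr 1; abel
      · change -(Z.vel + Z'.vel) = -Z.vel + -Z'.vel
        abel
    · change Z.mem + Z'.mem = _
      rw [h5, h5', show Lp.const 2 K.weight (v + v') = Lp.const 2 K.weight v + Lp.const 2 K.weight v'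
        from map_add (Lp.constₗ 2 K.weight ℝ) v v']
      abel
  smul_mem' := by
    rintro c ⟨U, Z⟩ h
    obtain ⟨v, w, h1, h2, h3, h4, h5⟩ := (waveGraph_iff _ _).1 h
    refine (waveGraph_iff _ _).2 ⟨c • v, c • w, ?_, h2.smul c, ?_, ?_, ?_⟩
    · rw [map_smul, h1]; rfl
    · rw [← h3]; rfl
    · convert A.op.graph.smul_mem c h4 using 1
      refine Prod.ext ?_ ?_
      · change HalfDomain.incl ((1 - K.mass) • (c • U.pos) + integralL K _ (c • U.mem)) =
          c • HalfDomain.incl _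
        rw [← map_smul, map_smul (integralL K _), smul_add, smul_comm]
      · change -(c • Z.vel) = c • -Z.vel
        rw [smul_neg]
    · change c • Z.mem = _
      rw [h5, show Lp.const 2 K.weight (c • v) = c • Lp.const 2 K.weight v
        from map_smul (Lp.constₗ 2 K.weight ℝ) c v]
      simp

theorem mem_waveSubmodule (U Z : Phase A K) : (U, Z) ∈ waveSubmodule A K ↔ WaveGraph U Z := Iff.rfl

end WaveOperator

end

/-! ### Dissipativity, range condition and Lyapunov functional of the wave operator -/

section

variable {H : Type*} [NormedAddCommGroup H] [InnerProductSpace ℝ H] [CompleteSpace H]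
  {A : PosOp H} {K : MemoryKernel}

theorem Phase.inner_def (U V : Phase A K) : inner ℝ U V =
    (1 - K.mass) * inner ℝ U.pos V.pos + (inner ℝ U.vel V.vel + inner ℝ U.mem V.mem) := by
  rw [Phase.inner_eq, energy_inner]

/-- The energy identity. -/
theorem inner_waveGraph {U Z : Phase A K} {v : Energy A} {w' : MemorySpace A K}
    (h1 : HalfDomain.incl v = U.vel) (h3 : Z.pos = v)
    (h4 : (HalfDomain.incl ((1 - K.mass) • U.pos + integralL K _ U.mem), -Z.vel) ∈ A.op.graph)
    (h5 : Z.mem = -w' + Lp.const 2 K.weight v) :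
    inner ℝ Z U = -inner ℝ w' U.mem := by
  -- The elastic equation tested with the velocity cancels the position and memory couplings in `⟨Z,
  -- U⟩`.
  have e := inner_incl_of_mem_graph h4 v
  rw [inner_neg_left, inner_add_left, real_inner_smul_left, h1] at e
  rw [Phase.inner_def, h3, h5, inner_add_left, inner_neg_left, inner_const,
    real_inner_comm v U.pos, real_inner_comm v (integralL K _ U.mem)] at *
  linarith

/-- Elimination. From `v = l u - F.pos` and `w = w₁ + w₂`, where `w₁` answers to `F.mem` and `w₂`,
with mean `c v`, to `v`, the vector `z = (1 - m)u + ∫μw` equals `a u + k₀`. The velocity equation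
becomes `A z + (l²/a) z = g`, and `c ≥ 0` guarantees `a > 0`. -/
theorem waveSubmodule_range (A : PosOp H) (K : MemoryKernel) {l : ℝ} (hl : 0 < l)
    (F : Phase A K) : ∃ U : Phase A K, (U, l • U - F) ∈ waveSubmodule A K := by
  obtain ⟨w₁, hw₁⟩ := exists_hasPrimitive F.mem hl
  obtain ⟨c, hc, hconst⟩ := exists_hasPrimitive_const (E := Energy A) K hl
  have ha : 0 < (1 - K.mass) + l * c := by
    have := gap_pos K
    positivity
  set a := (1 - K.mass) + l * c with hadef
  set k₀ : Energy A := integralL K _ w₁ - c • F.pos with hk₀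
  obtain ⟨z, y, hzy, hy⟩ := exists_add_smul_eq A (by positivity : 0 < l ^ 2 / a)
    (F.vel + l • HalfDomain.incl F.pos + (l ^ 2 / a) • HalfDomain.incl k₀)
  set u : Energy A := a⁻¹ • (z - k₀) with hu
  set v : Energy A := l • u - F.pos with hv
  obtain ⟨w₂, w₂', hw₂, hw₂', hI⟩ := hconst v
  refine ⟨Phase.mk u (HalfDomain.incl v) (w₁ + w₂), (mem_waveSubmodule _ _).2
    ((waveGraph_iff _ _).2 ⟨v, (F.mem - l • w₁) + w₂', rfl, hw₁.add hw₂, rfl, ?_, ?_⟩)⟩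
  · have e1 : (1 - K.mass) • u + integralL K _ (w₁ + w₂) = z := by
      have hau : a • u = z - k₀ := by rw [hu, smul_inv_smul₀ ha.ne']
      rw [map_add, show integralL K (Energy A) w₂ = c • v from hI]
      have h2 : (1 - K.mass) • u + (integralL K (Energy A) w₁ + c • v) = a • u + k₀ := by
        rw [hv, hk₀, hadef]; module
      rw [h2, hau, sub_add_cancel]
    have e2 : -(l • HalfDomain.incl v - F.vel) = y := by
      rw [eq_sub_of_add_eq hy, hv, hu]
      simp only [map_sub, map_smul]
      have : l ^ 2 / a = l * l * a⁻¹ := by rw [div_eq_mul_inv, sq]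
      rw [this]
      module
    rw [Phase.pos_mk, Phase.mem_mk, e1, Phase.vel_sub, Phase.vel_smul, Phase.vel_mk, e2]
    exact hzy
  · rw [Phase.mem_sub, Phase.mem_smul, Phase.mem_mk]
    have h2 : w₂' = Lp.const 2 K.weight v - l • w₂ := by
      refine Lp.ext ?_
      filter_upwards [hw₂', Lp.coeFn_sub (Lp.const 2 K.weight v) (l • w₂), Lp.coeFn_smul l w₂,
        Lp.coeFn_const 2 K.weight v] with s h1 h2 h3 h4
      rw [h1, h2, Pi.sub_apply, h3, h4]; rfl
    rw [h2]
    module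

theorem waveSubmodule_isMaxDissipative (A : PosOp H) (K : MemoryKernel) :
    IsMaxDissipative (waveSubmodule A K) where
  dissipative U Z h := by
    obtain ⟨v, w', h1, h2, h3, h4, h5⟩ := (waveGraph_iff _ _).1 h
    rw [inner_waveGraph h1 h3 h4 h5]
    have := h2.le_inner (δ := 0) fun s hs => by simpa using K.deriv_nonpos hs
    linarith
  range l hl F := waveSubmodule_range A K hl F
  single Z h := by
    obtain ⟨v, w', h1, h2, h3, h4, h5⟩ := (waveGraph_iff _ _).1 h
    have hv : v = 0 := incl_injective (h1.trans (map_zero HalfDomain.incl).symm)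
    have hw : w' = 0 := HasPrimitive.eq_zero h2
    have hvel : Z.vel = 0 := by
      change (HalfDomain.incl ((1 - K.mass) • (0 : Energy A) + integralL K _ 0), -Z.vel) ∈ _ at h4
      rw [smul_zero, map_zero, add_zero, map_zero] at h4
      exact neg_eq_zero.1 (LinearPMap.graph_fst_eq_zero_snd _ h4 rfl)
    have hmem : Z.mem = 0 := by
      rw [h5, hw, hv, show Lp.const 2 K.weight (0 : Energy A) = 0
        from map_zero (Lp.constₗ 2 K.weight ℝ)]
      simp
    have hn := Phase.norm_sq Z
    rw [h3, hv, hvel, hmem] at hn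
    simpa using hn

/-- The elementary inequality behind the choice of the Lyapunov functional. -/
theorem lyapunov_inequality {m a j δ μ₀ N X Y P R n D s : ℝ} (hm : 0 < m) (ha : 0 < a)
    (ham : a + m = 1) (hδ : 0 < δ) (hR : R ^ 2 ≤ μ₀ * D) (hP : P ^ 2 ≤ m * n ^ 2)
    (hD : δ * n ^ 2 ≤ D) (hs : |s| ≤ X * P)
    (hN : j ^ 2 * μ₀ / m + (1 / (m * a) + 1) * (m / δ) + 1 ≤ N) :
    -N * D + j * Y * R - m / 2 * Y ^ 2 + (a - m / 2) * s + P ^ 2 - m / 2 * (a * X ^ 2) ≤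
      -min δ (m / 4) * (a * X ^ 2 + (Y ^ 2 + n ^ 2)) := by
  -- In the application `X`, `Y`, `n` are the norms of `u`, `v`, `w`, `P` and `R` those of `∫μw` and
  -- `∫μw'`, `s = ⟨u, ∫μw⟩`, and `D = 2⟨w', w⟩`. The first summand of the bound on `N` absorbs `j Y
  -- R`, the second the terms with `P`, and the last leaves `-D ≤ -δn²`. Half of each good term in
  -- `X` and `Y` is spent, hence `m/4`.
  have hD0 : 0 ≤ D := le_trans (by positivity) hD
  have h1 : j * Y * R ≤ m / 4 * Y ^ 2 + j ^ 2 * μ₀ / m * D := by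
    have h2 : j * Y * R ≤ m / 4 * Y ^ 2 + j ^ 2 / m * R ^ 2 := by
      have h3 : m / 4 * Y ^ 2 + j ^ 2 / m * R ^ 2 - j * Y * R = (m * Y / 2 - j * R) ^ 2 / m := by
        field_simp; ring
      have : 0 ≤ (m * Y / 2 - j * R) ^ 2 / m := by positivity
      linarith
    have h3 := mul_le_mul_of_nonneg_left hR (by positivity : 0 ≤ j ^ 2 / m)
    have h4 : j ^ 2 / m * (μ₀ * D) = j ^ 2 * μ₀ / m * D := by ring
    linarith
  have hPD : P ^ 2 ≤ m / δ * D := by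
    refine hP.trans ?_
    rw [div_mul_eq_mul_div, le_div_iff₀ hδ]
    nlinarith
  have h5 : (a - m / 2) * s ≤ m / 4 * (a * X ^ 2) + 1 / (m * a) * P ^ 2 := by
    have h6 : |a - m / 2| ≤ 1 := abs_le.2 ⟨by linarith, by linarith⟩
    have h7 : (a - m / 2) * s ≤ X * P := by
      refine (le_abs_self _).trans ?_
      rw [abs_mul]
      have := mul_le_mul h6 hs (abs_nonneg s) zero_le_one
      linarith
    have h8 : m / 4 * (a * X ^ 2) + 1 / (m * a) * P ^ 2 - X * P =
        (m * a * X / 2 - P) ^ 2 / (m * a) := by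
      field_simp; ring
    have : 0 ≤ (m * a * X / 2 - P) ^ 2 / (m * a) := by positivity
    linarith
  have h9 : (1 / (m * a) + 1) * P ^ 2 ≤ (1 / (m * a) + 1) * (m / δ) * D := by
    rw [mul_assoc]
    exact mul_le_mul_of_nonneg_left hPD (by positivity)
  have h10 := mul_le_mul_of_nonneg_right hN hD0
  have e1 := min_le_left δ (m / 4)
  have e2 := min_le_right δ (m / 4)
  have f1 := mul_le_mul_of_nonneg_right e2 (by positivity : 0 ≤ a * X ^ 2 + Y ^ 2)
  have f2 := mul_le_mul_of_nonneg_right e1 (sq_nonneg n)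
  nlinarith

/-- Small perturbations of a large multiple of the inner product. -/
theorem exists_perturbed_inner {X : Type*} [NormedAddCommGroup X] [InnerProductSpace ℝ X]
    (V T : X →L[ℝ] H) (N₀ : ℝ) : ∃ (Q : X →L[ℝ] X →L[ℝ] ℝ) (N : ℝ), N₀ ≤ N ∧
      (∀ x y, Q x y = N * inner ℝ x y + inner ℝ (V x) (T y)) ∧ ∀ x, 1 * ‖x‖ ^ 2 ≤ Q x x := by
  let B : X →L[ℝ] X →L[ℝ] ℝ := (innerSL ℝ : H →L[ℝ] H →L[ℝ] ℝ).bilinearComp V T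
  let I : X →L[ℝ] X →L[ℝ] ℝ := innerSL ℝ
  set N := max N₀ (‖B‖ + 1)
  refine ⟨N • I + B, N, le_max_left _ _, fun x y => rfl, fun x => ?_⟩
  have h1 : |B x x| ≤ ‖B‖ * ‖x‖ * ‖x‖ := B.le_opNorm₂ x x
  have h2 := (abs_le.1 h1).1
  have h3 : ‖B‖ + 1 ≤ N := le_max_right _ _
  have h4 : (N • I + B) x x = N * inner ℝ x x + B x x := rfl
  rw [h4, real_inner_self_eq_norm_sq]
  nlinarith [mul_le_mul_of_nonneg_right h3 (sq_nonneg ‖x‖)]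

theorem exists_lyapunov (A : PosOp H) (K : MemoryKernel) :
    ∃ (Q : Phase A K →L[ℝ] Phase A K →L[ℝ] ℝ) (c : ℝ), 0 < c ∧
      (∀ U, 1 * ‖U‖ ^ 2 ≤ Q U U) ∧
      ∀ U Z, (U, Z) ∈ waveSubmodule A K → Q U Z + Q Z U ≤ -c * ‖U‖ ^ 2 := by
  obtain ⟨δ, hδ, hdec⟩ := K.decay
  have hm := K.mass_pos
  set m := K.mass with hmdef
  set a := 1 - m with ha
  have ha0 : 0 < a := gap_pos K
  -- The memory equation gives `∫μ Z.mem = -∫μw' + m v`, so `-∫μw` produces `-m‖v‖²` in `⟨v, T Z⟩`,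
  -- of which `(m/2)u` gives back half. Paired with `-A((1-m)u + ∫μw)`, the same `(m/2)u` produces
  -- the damping of the position.
  let T : Phase A K →L[ℝ] Energy A := (m / 2) • Phase.posL A K - (integralL K _).comp (Phase.memL A K)
  have hT : ∀ V, T V = (m / 2) • V.pos - integralL K _ V.mem := fun V => rfl
  set j := ‖inclL A‖ with hj
  obtain ⟨Q, N, hN, hQ, hQ1⟩ := exists_perturbed_inner (Phase.velL A K) ((inclL A).comp T)
    (j ^ 2 * K.μ 0 / m + (1 / (m * a) + 1) * (m / δ) + 1)
  refine ⟨Q, min δ (m / 4), lt_min hδ (by positivity), hQ1, fun U Z h => ?_⟩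
  have hQ : ∀ U V, Q U V = N * inner ℝ U V + inner ℝ U.vel (inclL A (T V)) := hQ
  obtain ⟨v, w', h1, h2, h3, h4, h5⟩ := (waveGraph_iff _ _).1 h
  have hi := inner_waveGraph h1 h3 h4 h5
  have hIz : integralL K _ Z.mem = -integralL K _ w' + m • v := by
    rw [h5, map_add, map_neg, integralL_const]
  have e1 : inner ℝ U.vel (inclL A (T Z)) = inner ℝ (inclL A v) (inclL A (integralL K _ w')) - m / 2 * ‖inclL A v‖ ^ 2 := by
    have : T Z = integralL K _ w' - (m / 2) • v := by
      rw [hT, hIz, h3]; module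
    rw [this, ← h1, ← inclL_apply, map_sub, map_smul, inner_sub_right, real_inner_smul_right,
      real_inner_self_eq_norm_sq]
  have e2 : inner ℝ Z.vel (inclL A (T U)) = (a - m / 2) * inner ℝ U.pos (integralL K _ U.mem) +
      ‖integralL K _ U.mem‖ ^ 2 - m / 2 * (a * ‖U.pos‖ ^ 2) := by
    have h6 := inner_incl_of_mem_graph h4 (T U)
    rw [inner_neg_left] at h6
    rw [inclL_apply, ← neg_eq_iff_eq_neg.2 h6.symm, hT, inner_sub_right, inner_add_left,
      inner_add_left]
    simp only [real_inner_smul_left, real_inner_smul_right, real_inner_self_eq_norm_sq,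
      real_inner_comm U.pos (integralL K _ U.mem)]
    ring
  have e3 : inner ℝ (inclL A v) (inclL A (integralL K _ w')) ≤
      j * ‖inclL A v‖ * ‖integralL K _ w'‖ := by
    refine (real_inner_le_norm _ _).trans ?_
    have := (inclL A).le_opNorm (integralL K _ w')
    nlinarith [norm_nonneg (inclL A v)]
  have e4 : ‖inclL A v‖ = ‖U.vel‖ := by rw [inclL_apply, h1]
  have key := lyapunov_inequality (j := j) (Y := ‖inclL A v‖) (N := N) hm ha0
    (by rw [ha]; ring) hδ h2.norm_integral_sq_le (norm_sq_integral_weight_le U.mem)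
    (h2.le_inner hdec) (abs_real_inner_le_norm U.pos (integralL K _ U.mem)) hN
  rw [hQ, hQ, real_inner_comm Z U, hi, e1, e2, Phase.norm_sq, ← e4]
  rw [← integralL_apply, ← integralL_apply] at key
  linarith

/-- The wave operator generates an exponentially stable semigroup. -/
theorem exists_wave_semigroup (A : PosOp H) (K : MemoryKernel) :
    ∃ S : ℝ → Phase A K →L[ℝ] Phase A K, IsC0Semigroup S ∧ IsGenerator S WaveGraph ∧
      ∃ M ω : ℝ, 0 < M ∧ 0 < ω ∧ ∀ t, 0 ≤ t → ‖S t‖ ≤ M * Real.exp (-ω * t) := by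
  have hG := waveSubmodule_isMaxDissipative A K
  obtain ⟨S, hS, hS1, hint, hgen⟩ := hG.exists_semigroup
  obtain ⟨Q, c, hc, hQ, hQG⟩ := exists_lyapunov A K
  exact ⟨S, hS, hgen, exists_exp_decay hG hS hS1 hint hgen Q one_pos hc hQ hQG⟩

end

/-! ### The feedback and the source on the phase space -/

section Nonlinearity

variable {H : Type*} [NormedAddCommGroup H] [InnerProductSpace ℝ H] [CompleteSpace H]
variable {A : PosOp H} {K : MemoryKernel}

/-- The norm of a vector all of whose components but the velocity vanish. -/
theorem Phase.norm_mk_vel (h : H) : ‖(Phase.mk 0 h 0 : Phase A K)‖ = ‖h‖ := by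
  have h1 := Phase.norm_sq (Phase.mk 0 h 0 : Phase A K)
  rw [Phase.pos_mk, Phase.vel_mk, Phase.mem_mk, norm_zero, norm_zero] at h1
  rw [← sq_eq_sq₀ (norm_nonneg _) (norm_nonneg _), h1]
  ring

theorem Phase.mk_vel_sub (h h' : H) :
    (Phase.mk 0 h 0 - Phase.mk 0 h' 0 : Phase A K) = Phase.mk 0 (h - h') 0 := by
  have h1 : (Phase.mk 0 h 0 - Phase.mk 0 h' 0 : Phase A K) =
      Phase.mk (0 - 0) (h - h') (0 - 0) := rfl
  rw [h1, sub_zero, sub_zero]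

theorem Phase.mk_zero : (Phase.mk 0 0 0 : Phase A K) = 0 := rfl

theorem Phase.norm_vel_le (U : Phase A K) : ‖U.vel‖ ≤ ‖U‖ := by
  refine le_of_sq_le_sq ?_ (norm_nonneg _)
  rw [Phase.norm_sq]
  have := mul_nonneg (gap_pos K).le (sq_nonneg ‖U.pos‖)
  nlinarith [sq_nonneg ‖U.mem‖]

theorem Phase.sqrt_gap_mul_norm_pos_le (U : Phase A K) :
    Real.sqrt (1 - K.mass) * ‖U.pos‖ ≤ ‖U‖ := by
  refine le_of_sq_le_sq ?_ (norm_nonneg _)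
  rw [Phase.norm_sq, mul_pow, Real.sq_sqrt (gap_pos K).le]
  nlinarith [sq_nonneg ‖U.mem‖, sq_nonneg ‖U.vel‖]

theorem feedback_zero (B : H →L[ℝ] H) : feedback B (0 : Phase A K) = 0 := by
  have h : (0 : Phase A K).vel = 0 := rfl
  rw [feedback, h, map_zero, map_zero, Phase.mk_zero]

theorem norm_feedback_sub_le (B : H →L[ℝ] H) (U V : Phase A K) :
    ‖feedback B U - feedback B V‖ ≤ ‖B‖ ^ 2 * ‖U - V‖ := by
  have h1 : U.vel - V.vel = (U - V).vel := rfl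
  rw [feedback, feedback, Phase.mk_vel_sub, Phase.norm_mk_vel, ← map_sub, ← map_sub, h1, sq,
    mul_assoc]
  refine (B.le_opNorm _).trans (mul_le_mul_of_nonneg_left ?_ (norm_nonneg _))
  refine (ContinuousLinearMap.le_opNorm _ _).trans ?_
  rw [LinearIsometryEquiv.norm_map]
  exact mul_le_mul_of_nonneg_left (Phase.norm_vel_le _) (norm_nonneg _)

variable {ψ : Energy A → ℝ} {L : ℝ → ℝ}

theorem IsPotential.source_zero (hψ : IsPotential ψ L) : source ψ (0 : Phase A K) = 0 := by
  have h : (0 : Phase A K).pos = 0 := rfl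
  rw [source, h, hψ.grad_zero, Phase.mk_zero]

theorem IsPotential.phaseLip_pos (hψ : IsPotential ψ L) {r : ℝ} (hr : 0 < r) :
    0 < phaseLip K L r :=
  have hs := Real.sqrt_pos.2 (gap_pos K)
  div_pos (hψ.lipschitz _ (div_pos hr hs)).1 hs

theorem IsPotential.norm_source_sub_le (hψ : IsPotential ψ L) {r : ℝ} (hr : 0 < r)
    {U V : Phase A K} (hU : ‖U‖ ≤ r) (hV : ‖V‖ ≤ r) :
    ‖source ψ U - source ψ V‖ ≤ phaseLip K L r * ‖U - V‖ := by
  have hs := Real.sqrt_pos.2 (gap_pos K)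
  obtain ⟨hl, h⟩ := hψ.lipschitz _ (div_pos hr hs)
  have hpos : ∀ W : Phase A K, ‖HalfDomain.half W.pos‖ ≤ ‖W‖ / Real.sqrt (1 - K.mass) := by
    intro W
    rw [le_div_iff₀ hs, mul_comm, ← energy_norm]
    exact Phase.sqrt_gap_mul_norm_pos_le W
  rw [source, source, Phase.mk_vel_sub, Phase.norm_mk_vel]
  refine (h _ _ ((hpos U).trans (div_le_div_of_nonneg_right hU hs.le))
    ((hpos V).trans (div_le_div_of_nonneg_right hV hs.le))).trans ?_
  rw [phaseLip, div_mul_eq_mul_div, mul_div_assoc]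
  exact mul_le_mul_of_nonneg_left (hpos (U - V)) hl.le

theorem tendsto_phaseLip (hL : Tendsto L (𝓝[>] 0) (𝓝 0)) :
    Tendsto (phaseLip K L) (𝓝[>] 0) (𝓝 0) := by
  have hs := Real.sqrt_pos.2 (gap_pos K)
  have h : Tendsto (fun r : ℝ => r / Real.sqrt (1 - K.mass)) (𝓝[>] 0) (𝓝[>] 0) := by
    refine tendsto_nhdsWithin_iff.2 ⟨?_, ?_⟩
    · have h0 : Tendsto (fun r : ℝ => r / Real.sqrt (1 - K.mass)) (𝓝 0)
          (𝓝 (0 / Real.sqrt (1 - K.mass))) :=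
        (continuous_id.div_const _).tendsto 0
      rw [zero_div] at h0
      exact h0.mono_left nhdsWithin_le_nhds
    · filter_upwards [self_mem_nhdsWithin] with r hr using div_pos hr hs
  have h1 := (hL.comp h).div_const (Real.sqrt (1 - K.mass))
  rwa [zero_div] at h1

theorem exists_phaseLip_lt (hL : Tendsto L (𝓝[>] 0) (𝓝 0)) {ε : ℝ} (hε : 0 < ε) :
    ∃ C, 0 < C ∧ phaseLip K L C < ε := by
  obtain ⟨C, h, hC⟩ := (((tendsto_phaseLip (K := K) hL).eventually_lt_const hε).and
    self_mem_nhdsWithin).exists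
  exact ⟨C, hC, h⟩

end Nonlinearity

/-! ### The size of the data -/

section Data

variable {X : Type*} [NormedAddCommGroup X]

theorem sq_integral_abs_mul_norm_le {k : ℝ → ℝ} (hk : LocallyIntegrableOn k (Ici 0)) {τ : ℝ}
    (hτ : 0 ≤ τ) {g : ℝ → X} (hg : ContinuousOn g (Icc 0 τ)) :
    (∫ s in (0 : ℝ)..τ, |k s| * ‖g s‖) ^ 2 ≤
      (∫ s in (0 : ℝ)..τ, |k s|) * ∫ s in (0 : ℝ)..τ, |k s| * ‖g s‖ ^ 2 := by
  have hki := (intervalIntegrable_of_locallyIntegrableOn hk le_rfl hτ).norm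
  have hg' : ContinuousOn (fun s => ‖g s‖) (uIcc 0 τ) := by
    rw [uIcc_of_le hτ]; exact hg.norm
  have h1 := hki.mul_continuousOn hg'
  have h2 := hki.mul_continuousOn (hg'.pow 2)
  simp only [Real.norm_eq_abs] at hki h1 h2
  rw [intervalIntegrable_iff_integrableOn_Ioc_of_le hτ] at hki h1 h2
  simp only [intervalIntegral.integral_of_le hτ]
  have := norm_sq_integral_smul_le (ν := volume.restrict (Ioc 0 τ)) (κ := fun s => |k s|)
    (f := fun s => ‖g s‖) (ae_of_all _ fun _ => abs_nonneg _) hki h1 (h2.congr (ae_of_all _ fun s => by simp))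
  simpa only [smul_eq_mul, norm_norm, Real.norm_eq_abs, sq_abs] using this

/-- The size of the data that enters the decay estimate is controlled by their quadratic size. -/
theorem norm_add_integral_le_of_small {k : ℝ → ℝ} (hk : LocallyIntegrableOn k (Ici 0)) {τ ω ρ : ℝ}
    (hτ : 0 ≤ τ) (hω : 0 ≤ ω) (hρ : 0 ≤ ρ) {U₀ : X} {g : ℝ → X} (hg : ContinuousOn g (Icc 0 τ))
    (h : ‖U₀‖ ^ 2 + (∫ s in (0 : ℝ)..τ, |k s| * ‖g s‖ ^ 2) < ρ ^ 2) :
    ‖U₀‖ + (∫ s in (0 : ℝ)..τ, Real.exp (ω * s) * |k s| * ‖g s‖) ≤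
      (1 + Real.exp (ω * τ) * Real.sqrt (∫ s in (0 : ℝ)..τ, |k s|)) * ρ := by
  have hκ : 0 ≤ ∫ s in (0 : ℝ)..τ, |k s| :=
    intervalIntegral.integral_nonneg hτ fun s _ => abs_nonneg _
  have hI : 0 ≤ ∫ s in (0 : ℝ)..τ, |k s| * ‖g s‖ ^ 2 :=
    intervalIntegral.integral_nonneg hτ fun s _ => by positivity
  have h0 : ‖U₀‖ ≤ ρ := le_of_sq_le_sq (by linarith) hρ
  have h1 : (∫ s in (0 : ℝ)..τ, |k s| * ‖g s‖) ≤
      Real.sqrt (∫ s in (0 : ℝ)..τ, |k s|) * ρ := by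
    refine le_of_sq_le_sq ?_ (by positivity)
    rw [mul_pow, Real.sq_sqrt hκ]
    refine (sq_integral_abs_mul_norm_le hk hτ hg).trans (mul_le_mul_of_nonneg_left ?_ hκ)
    linarith [sq_nonneg ‖U₀‖]
  have hki := (intervalIntegrable_of_locallyIntegrableOn hk le_rfl hτ).norm
  have hg' : ContinuousOn (fun s => ‖g s‖) (uIcc 0 τ) := by
    rw [uIcc_of_le hτ]; exact hg.norm
  have h2 : (∫ s in (0 : ℝ)..τ, Real.exp (ω * s) * |k s| * ‖g s‖) ≤
      Real.exp (ω * τ) * ∫ s in (0 : ℝ)..τ, |k s| * ‖g s‖ := by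
    rw [← intervalIntegral.integral_const_mul]
    refine intervalIntegral.integral_mono_on hτ
      ((hki.continuousOn_mul (by fun_prop)).mul_continuousOn hg')
      ((hki.mul_continuousOn hg').const_mul _) fun s hs => ?_
    rw [mul_assoc]
    exact mul_le_mul_of_nonneg_right
      (Real.exp_le_exp.2 (mul_le_mul_of_nonneg_left hs.2 hω)) (by positivity)
  have h3 := mul_le_mul_of_nonneg_left h1 (Real.exp_pos (ω * τ)).le
  linarith

end Data

end DelayWave

end

/-! ### The theorem -/

theorem theorem3p5 {H : Type*} [NormedAddCommGroup H] [InnerProductSpace ℝ H] [CompleteSpace H]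
    (A : DelayWave.PosOp H) (K : DelayWave.MemoryKernel) (B : H →L[ℝ] H)
    (τ : ℝ) (hτ : 0 < τ)
    (k : ℝ → ℝ) (hk : LocallyIntegrableOn k (Ici 0))
    (Cstar : ℝ) (hCstar : ∀ t, 0 < t → (∫ s in (max 0 (t - τ))..t, |k s|) < Cstar)
    (ψ : DelayWave.Energy A → ℝ) (L : ℝ → ℝ) (hψ : DelayWave.IsPotential ψ L)
    (hL : Tendsto L (𝓝[>] 0) (𝓝 0)) :
    -- the operator `𝒜` generates an exponentially stable semigroup `S`
    ∃ S : ℝ → DelayWave.Phase A K →L[ℝ] DelayWave.Phase A K,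
      DelayWave.IsC0Semigroup S ∧ DelayWave.IsGenerator S DelayWave.WaveGraph ∧
      (∃ M ω : ℝ, 0 < M ∧ 0 < ω ∧ ∀ t, 0 ≤ t → ‖S t‖ ≤ M * Real.exp (-ω * t)) ∧
      -- the nonlinear term is Lipschitz on balls with constants `phaseLip K L r`
      DelayWave.source ψ (0 : DelayWave.Phase A K) = 0 ∧
      (∀ r, 0 < r → 0 < DelayWave.phaseLip K L r ∧ ∀ U V : DelayWave.Phase A K,
        ‖U‖ ≤ r → ‖V‖ ≤ r →
          ‖DelayWave.source ψ U - DelayWave.source ψ V‖ ≤ DelayWave.phaseLip K L r * ‖U - V‖) ∧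
      -- well-posedness and exponential decay for small data
      ∀ M ω : ℝ, 0 < M → 0 < ω → (∀ t, 0 ≤ t → ‖S t‖ ≤ M * Real.exp (-ω * t)) →
      ∀ ω' γ : ℝ, 0 ≤ ω' → ω' < ω →
        (∀ t, 0 ≤ t → ‖B‖ ^ 2 * M * Real.exp (ω * τ) * (∫ s in (0 : ℝ)..t, |k (s + τ)|) ≤
          γ + ω' * t) →
        ∃ ρ C : ℝ, 0 < ρ ∧ 0 < C ∧ DelayWave.phaseLip K L C < (ω - ω') / M ∧
          DelayWave.GloballyWellPosed S B τ k ψ ρ C ∧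
          ∀ (U₀ : DelayWave.Phase A K) (g U : ℝ → DelayWave.Phase A K),
            DelayWave.SmallData τ k ρ U₀ g → DelayWave.IsSolution S B τ k ψ U₀ g U →
            ∀ t, 0 ≤ t → ‖U t‖ ≤ M * Real.exp γ *
              (‖U₀‖ + (∫ s in (0 : ℝ)..τ, Real.exp (ω * s) * |k s| * ‖g s‖)) *
              Real.exp (-(ω - ω' - M * DelayWave.phaseLip K L C) * t) := by
  open DelayWave in
  obtain ⟨S, hS, hgen, hstab⟩ := exists_wave_semigroup A K
  have hlip : ∀ r, 0 < r → 0 < phaseLip K L r ∧ ∀ U V : Phase A K, ‖U‖ ≤ r → ‖V‖ ≤ r →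
      ‖source ψ U - source ψ V‖ ≤ phaseLip K L r * ‖U - V‖ := fun r hr =>
    ⟨hψ.phaseLip_pos hr, fun U V hU hV => hψ.norm_source_sub_le hr hU hV⟩
  refine ⟨S, hS, hgen, hstab, hψ.source_zero, hlip, ?_⟩
  intro M ω hM hω hSM ω' γ _ hωω' hγ
  -- The choice of `C` leaves a positive decay rate. The constant `c` bounds the weighted `L¹` size
  -- of the data by their quadratic size, so the radius `C / (M e^γ c)` makes `M e^γ` times the data
  -- at most `C`.
  obtain ⟨C, hC, hCl⟩ := exists_phaseLip_lt (K := K) hL (div_pos (sub_pos.2 hωω') hM)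
  set c := 1 + Real.exp (ω * τ) * Real.sqrt (∫ s in (0 : ℝ)..τ, |k s|) with hc
  have hc0 : 0 < c := by positivity
  have hd0 : 0 < M * Real.exp γ * c := by positivity
  have hρ : 0 < C / (M * Real.exp γ * c) := div_pos hC hd0
  have hSM' : ∀ t, 0 ≤ t → ‖S t‖ ≤ M := fun t ht => (hSM t ht).trans
    (mul_le_of_le_one_right hM.le (Real.exp_le_one_iff.2 (by nlinarith)))
  have hunique : ∀ {U₀ : Phase A K} {g U V : ℝ → Phase A K}, ContinuousOn g (Icc 0 τ) →
      IsSolution S B τ k ψ U₀ g V → IsSolution S B τ k ψ U₀ g U → EqOn V U (Ici 0) :=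
    fun hg hV hU => delay_problem_unique hSM' hS hτ.le hk (sq_nonneg ‖B‖)
      (norm_feedback_sub_le B) hg
      (fun r hr => ⟨_, (hlip r hr).1.le, (hlip r hr).2⟩) hV.cont hU.cont hV.duhamel hU.duhamel
  have hexists : ∀ (U₀ : Phase A K) (g : ℝ → Phase A K),
      SmallData τ k (C / (M * Real.exp γ * c)) U₀ g →
      ∃ U, IsSolution S B τ k ψ U₀ g U ∧ (∀ t, 0 ≤ t → ‖U t‖ ≤ C) ∧
        ∀ t, 0 ≤ t → ‖U t‖ ≤ M * Real.exp γ *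
          (‖U₀‖ + (∫ s in (0 : ℝ)..τ, Real.exp (ω * s) * |k s| * ‖g s‖)) *
          Real.exp (-(ω - ω' - M * phaseLip K L C) * t) := by
    rintro U₀ g ⟨hg, hsmall⟩
    have hbound := mul_le_mul_of_nonneg_left
      (norm_add_integral_le_of_small hk hτ.le hω.le hρ.le hg hsmall)
      (mul_pos hM (Real.exp_pos γ)).le
    rw [← hc, ← mul_assoc, mul_div_cancel₀ _ hd0.ne'] at hbound
    obtain ⟨U, hU, hUs, hUC, hUd⟩ := exists_small_solution hSM hM.le hω.le hS hτ.le hk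
      (sq_nonneg ‖B‖) (feedback_zero B) (norm_feedback_sub_le B) hg (hlip C hC).1.le hC hγ
      (hψ.source_zero) (hlip C hC).2
      (by rw [mul_comm]; exact ((lt_div_iff₀ hM).1 hCl).le) hbound
    exact ⟨U, ⟨hU, hUs⟩, hUC, hUd⟩
  refine ⟨_, C, hρ, hC, hCl, ?_, ?_⟩
  · intro U₀ g hdata
    obtain ⟨U, hU, hUC, -⟩ := hexists U₀ g hdata
    exact ⟨U, hU, fun t ht => hUC t ht.le, fun V hV => hunique hdata.1 hV hU⟩
  · intro U₀ g U hdata hU t ht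
    -- The estimate is known for the constructed solution; uniqueness transfers it to an arbitrary
    -- one.
    obtain ⟨V, hV, -, hVd⟩ := hexists U₀ g hdata
    rw [hunique hdata.1 hU hV ht]
    exact hVd t ht
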